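/- **Theorem.** MapReduce model: the input is a simple graph with vertex set $\{0,\dots,n-1\}$, $m=n^{1+c}$ edges and maximum degree $\Delta$, where $c>\mu$ and $\mu=\mu(n)=\omega(\log\log n/\log n)$. There are $M=\lceil n^{c-\mu}\rceil$ machines. The edges are distributed over the machines in an arbitrary way, at most $s=\lceil n^{1+\mu}\rceil$ edges per machine. Computation proceeds in rounds. In each round every machine executes, on the words that it received (together with $n,m,s,M$ and its own number), a randomized word-RAM program, using $O(n^{1+\mu})$ words of memory of $O(\log n)$ bits each and a number of steps polynomial in $n$; it sends $O(n^{1+\mu})$ words to machines of its choice, and these words (again $O(n^{1+\mu})$ per recipient) are the recipients' input in the next round. Machines keep nothing between rounds except what they send to themselves. The output is what the machines hold after the last round. In this model there are constant-round algorithms for $(1+o(1))\Delta$ vertex colouring and for $(1+o(1))\Delta$ edge colouring that succeed with high probability. Precisely, for each of the two problems there are a fixed finite sequence of programs (one per round; in particular the number of rounds is an absolute constant) and a constant $K$ such that for every function $\mu:\mathbb N\to\mathbb R$ with $\mu(n)/(\log\log n/\log n)\to\infty$ there is a sequence $\varepsilon_n\to0$ such that for every $a\in\mathbb N$ and all sufficiently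 large $n$ the following holds. For every graph on $n$ vertices with $m=n^{1+c}$ edges, $c>\mu(n)$, and every distribution of its edges over the machines as above, with probability at least $1-n^{-a}$ no machine ever exceeds $K s$ words of input, of each of its finitely many arrays, or of sent messages, nor words of value larger than $n^K$, nor $n^K$ steps per round, and the output is a proper vertex colouring (respectively, a proper edge colouring) of the graph that uses at most $(1+\varepsilon_n)\Delta$ colours, listing each vertex (respectively, each edge) exactly once together with its colour. -/

import Mathlib

open Filter Topology MeasureTheory

namespace MapReduce

/-! ## Local computation: a randomized word RAM with step counting -/

/-- Arithmetic expressions over scalar variables `var x` and array cells `get a i`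
(both named by natural-number literals, so a program uses a fixed finite number of them). -/
inductive Expr : Type
  | lit (k : ℕ)
  | var (x : ℕ)
  | get (a : ℕ) (i : Expr)
  | add (e f : Expr)
  | sub (e f : Expr)
  | mul (e f : Expr)
  | div (e f : Expr)
  | mod (e f : Expr)
  | lt (e f : Expr)
  | eq (e f : Expr)

/-- Programs. `rand x e` draws a uniform element of `{0, …, e}`; `send d e` sends the word `e`
to machine number `d`; `ite` and `loop` (a while loop) test whether their guard is nonzero. -/
inductive Cmd : Type
  | skip
  | set (x : ℕ) (e : Expr)
  | put (a : ℕ) (i e : Expr)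
  | rand (x : ℕ) (e : Expr)
  | send (d e : Expr)
  | seq (p q : Cmd)
  | ite (g : Expr) (p q : Cmd)
  | loop (g : Expr) (p : Cmd)

/-- The local state of a machine: scalar variables, arrays, the number of random draws made so
far in the current round, and the (destination, word) messages sent so far in the round. -/
structure Mem : Type where
  var : ℕ → ℕ
  arr : ℕ → ℕ → ℕ
  draws : ℕ
  out : List (ℕ × ℕ)

/-- The value of an expression; comparisons give `0` or `1`. -/
def Expr.eval (σ : Mem) : Expr → ℕ
  | .lit k => k
  | .var x => σ.var x
  | .get a i => σ.arr a (i.eval σ)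
  | .add e f => e.eval σ + f.eval σ
  | .sub e f => e.eval σ - f.eval σ
  | .mul e f => e.eval σ * f.eval σ
  | .div e f => e.eval σ / f.eval σ
  | .mod e f => e.eval σ % f.eval σ
  | .lt e f => if e.eval σ < f.eval σ then 1 else 0
  | .eq e f => if e.eval σ = f.eval σ then 1 else 0

/-- The random source of one machine in one round: `ρ t k` is the outcome of the `t`-th draw
if that draw is from `{0, …, k}`. -/
abbrev Tape : Type := ℕ → (k : ℕ) → Fin (k + 1)

/-- `Exec S W ρ p σ t σ'`: started in state `σ` with random source `ρ`, the program `p` halts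
after `t` steps in state `σ'`. Every array cell written has an address `< S`, at most `S` words
are sent, and every word stored, sent, or used as a range for a random draw is at most `W`; an
execution that would violate one of these bounds is stuck, that is, it has no derivation. -/
inductive Exec (S W : ℕ) (ρ : Tape) : Cmd → Mem → ℕ → Mem → Prop
  | skip (σ : Mem) : Exec S W ρ .skip σ 1 σ
  | set (x : ℕ) (e : Expr) (σ : Mem) (hw : e.eval σ ≤ W) :
      Exec S W ρ (.set x e) σ 1 { σ with var := Function.update σ.var x (e.eval σ) }
  | put (a : ℕ) (i e : Expr) (σ : Mem) (hs : i.eval σ < S) (hw : e.eval σ ≤ W) :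
      Exec S W ρ (.put a i e) σ 1
        { σ with arr := Function.update σ.arr a
                          (Function.update (σ.arr a) (i.eval σ) (e.eval σ)) }
  | rand (x : ℕ) (e : Expr) (σ : Mem) (hw : e.eval σ ≤ W) :
      Exec S W ρ (.rand x e) σ 1
        { σ with
          var := Function.update σ.var x (ρ σ.draws (e.eval σ) : ℕ)
          draws := σ.draws + 1 }
  | send (d e : Expr) (σ : Mem) (hs : σ.out.length < S) (hw : e.eval σ ≤ W) :
      Exec S W ρ (.send d e) σ 1 { σ with out := σ.out ++ [(d.eval σ, e.eval σ)] }
  | seq (p q : Cmd) (σ σ' σ'' : Mem) (t t' : ℕ)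
      (hp : Exec S W ρ p σ t σ') (hq : Exec S W ρ q σ' t' σ'') :
      Exec S W ρ (.seq p q) σ (t + t') σ''
  | iteTrue (g : Expr) (p q : Cmd) (σ σ' : Mem) (t : ℕ)
      (hg : g.eval σ ≠ 0) (hp : Exec S W ρ p σ t σ') :
      Exec S W ρ (.ite g p q) σ (t + 1) σ'
  | iteFalse (g : Expr) (p q : Cmd) (σ σ' : Mem) (t : ℕ)
      (hg : g.eval σ = 0) (hq : Exec S W ρ q σ t σ') :
      Exec S W ρ (.ite g p q) σ (t + 1) σ'
  | loopDone (g : Expr) (p : Cmd) (σ : Mem) (hg : g.eval σ = 0) :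
      Exec S W ρ (.loop g p) σ 1 σ
  | loopStep (g : Expr) (p : Cmd) (σ σ' σ'' : Mem) (t t' : ℕ)
      (hg : g.eval σ ≠ 0) (hp : Exec S W ρ p σ t σ')
      (hl : Exec S W ρ (.loop g p) σ' t' σ'') :
      Exec S W ρ (.loop g p) σ (t + t' + 1) σ''

/-- Given the random source, a program has at most one halting execution, so that speaking of
the existence of a halting execution is speaking of the execution. -/
theorem Exec.deterministic {S W : ℕ} {ρ : Tape} {p : Cmd} {σ σ₁ σ₂ : Mem} {t₁ t₂ : ℕ}
    (h₁ : Exec S W ρ p σ t₁ σ₁) (h₂ : Exec S W ρ p σ t₂ σ₂) : t₁ = t₂ ∧ σ₁ = σ₂ := by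
  induction h₁ generalizing t₂ σ₂ with
  | skip | set | put | rand | send => cases h₂; exact ⟨rfl, rfl⟩
  | seq _ _ _ _ _ _ _ _ _ ihp ihq =>
    cases h₂ with
    | seq _ _ _ _ _ _ _ hp hq =>
      obtain ⟨rfl, rfl⟩ := ihp hp
      obtain ⟨rfl, rfl⟩ := ihq hq
      exact ⟨rfl, rfl⟩
  | iteTrue _ _ _ _ _ _ hg _ ih =>
    cases h₂ with
    | iteTrue _ _ _ _ _ _ _ h => obtain ⟨rfl, rfl⟩ := ih h; exact ⟨rfl, rfl⟩
    | iteFalse _ _ _ _ _ _ hg' _ => exact absurd hg' hg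
  | iteFalse _ _ _ _ _ _ hg _ ih =>
    cases h₂ with
    | iteTrue _ _ _ _ _ _ hg' _ => exact absurd hg hg'
    | iteFalse _ _ _ _ _ _ _ h => obtain ⟨rfl, rfl⟩ := ih h; exact ⟨rfl, rfl⟩
  | loopDone _ _ _ hg =>
    cases h₂ with
    | loopDone => exact ⟨rfl, rfl⟩
    | loopStep _ _ _ _ _ _ _ hg' _ _ => exact absurd hg hg'
  | loopStep _ _ _ _ _ _ _ hg _ _ ihp ihl =>
    cases h₂ with
    | loopDone _ _ _ hg' => exact absurd hg' hg
    | loopStep _ _ _ _ _ _ _ _ hp hl =>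
      obtain ⟨rfl, rfl⟩ := ihp hp
      obtain ⟨rfl, rfl⟩ := ihl hl
      exact ⟨rfl, rfl⟩

/-! ## Rounds -/

/-- Public parameters of a run on a graph: the number `n` of vertices, the number `m` of edges,
the memory parameter `s` and the number `M` of machines. -/
structure Params : Type where
  n : ℕ
  m : ℕ
  s : ℕ
  M : ℕ

/-- The state of machine `i` at the start of a round: the public parameters, its own number and
the length of its input are in variables `0` to `5`, its input is in array `0`, and everything
else is zero. In particular a machine remembers nothing but what was sent to it (it may send
messages to itself). -/
def initMem (P : Params) (i : ℕ) (inbox : List ℕ) : Mem where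
  var x := ([P.n, P.m, P.s, P.M, i, inbox.length] : List ℕ).getD x 0
  arr a j := if a = 0 then inbox.getD j 0 else 0
  draws := 0
  out := []

/-- The data held by the machines between rounds: the input words of each machine. -/
abbrev Data (M : ℕ) : Type := Fin M → List ℕ

/-- Delivery: machine `j` receives the words addressed to it, ordered by the number of the
sender, and for each sender in the order in which they were sent. -/
def deliver {M : ℕ} (out : Fin M → List (ℕ × ℕ)) : Data M := fun j =>
  (List.finRange M).flatMap fun i => ((out i).filter fun q => q.1 = (j : ℕ)).map Prod.snd

/-- Machine `i`, number of the round, number of the draw within the round, range of the draw. -/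
abbrev DrawIndex (M : ℕ) : Type := Fin M × ℕ × ℕ × ℕ

/-- All random choices that the `M` machines may make. -/
abbrev Coins (M : ℕ) : Type := (x : DrawIndex M) → Fin (x.2.2.2 + 1)

/-- The law of the random choices: independent, each one uniform on its range. -/
noncomputable def coinMeasure (M : ℕ) : Measure (Coins M) :=
  Measure.infinitePi fun x : DrawIndex M => (PMF.uniformOfFintype (Fin (x.2.2.2 + 1))).toMeasure

/-- One round in which all machines run the program `p`, each within `S` words of input, memory
and output, with words of size at most `W`, and at most `T` steps. The data change from `I` to
`J`. -/
def Round (P : Params) (S W T : ℕ) (p : Cmd) (ρ : Fin P.M → Tape) (I J : Data P.M) : Prop :=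
  (∀ i, (I i).length ≤ S) ∧
  ∃ F : Fin P.M → Mem,
    (∀ i, ∃ t ≤ T, Exec S W (ρ i) p (initMem P i (I i)) t (F i)) ∧
    J = deliver fun i => (F i).out

/-- `Run P S W T ω ps r I J`: with random choices `ω`, executing the rounds `ps` one after the
other, the first one having number `r`, turns the data `I` into the data `J`, and no machine ever
exceeds its bounds. -/
def Run (P : Params) (S W T : ℕ) (ω : Coins P.M) :
    List Cmd → ℕ → Data P.M → Data P.M → Prop
  | [], _, I, J => (∀ i, (I i).length ≤ S) ∧ J = I
  | p :: ps, r, I, J => ∃ I' : Data P.M,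
      Round P S W T p (fun i t k => ω (i, r, t, k)) I I' ∧ Run P S W T ω ps (r + 1) I' J

/-! ## Graph colouring problems -/

/-- `L` distributes the edges of `G` over `M` machines: each edge is listed exactly once, in one
of its two orientations. -/
def ListsEdges {n M : ℕ} (G : SimpleGraph (Fin n)) (L : Fin M → List G.Dart) : Prop :=
  ∀ e ∈ G.edgeSet, (((List.finRange M).flatMap L).map SimpleGraph.Dart.edge).count e = 1

/-- The input data: an edge is given by the two words that are its endpoints. -/
def edgeData {n M : ℕ} {G : SimpleGraph (Fin n)} (L : Fin M → List G.Dart) : Data M := fun i =>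
  (L i).flatMap fun d => [(d.fst : ℕ), (d.snd : ℕ)]

/-- The data `J` are a proper vertex colouring of `G` with at most `k` colours, given by one
record `vertex, colour` for each vertex. -/
def IsVertexColouringOutput {n M : ℕ} (G : SimpleGraph (Fin n)) (k : ℝ) (J : Data M) : Prop :=
  ∃ (χ : G.Coloring ℕ) (L : Fin M → List (Fin n)),
    ((Set.range χ).ncard : ℝ) ≤ k ∧
    (∀ v, ((List.finRange M).flatMap L).count v = 1) ∧
    ∀ i, J i = (L i).flatMap fun v : Fin n => [v.val, χ v]

/-- The data `J` are a proper edge colouring of `G` with at most `k` colours, given by one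
record `endpoint, endpoint, colour` for each edge. -/
def IsEdgeColouringOutput {n M : ℕ} (G : SimpleGraph (Fin n)) (k : ℝ) (J : Data M) : Prop :=
  ∃ (χ : G.lineGraph.Coloring ℕ) (L : Fin M → List G.Dart),
    ((Set.range χ).ncard : ℝ) ≤ k ∧
    ListsEdges G L ∧
    ∀ i, J i = (L i).flatMap fun d => [(d.fst : ℕ), (d.snd : ℕ), χ ⟨d.edge, d.edge_mem⟩]

/-- The parameters for a graph with `n` vertices and `m = n ^ (1 + c)` edges when the memory per
machine is of order `n ^ (1 + μ)`: there are `⌈n ^ (c - μ)⌉` machines. -/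
noncomputable def graphParams (n m : ℕ) (c μ : ℝ) : Params where
  n := n
  m := m
  s := ⌈(n : ℝ) ^ (1 + μ)⌉₊
  M := ⌈(n : ℝ) ^ (c - μ)⌉₊

/-- The algorithm `ps` (one program per round), with constant `K`, solves on the input `L`, for
the random choices `ω`, the task of producing an output that satisfies `Good`: every machine uses
at most `K * s` words of input, memory and output in each round, every word is at most `n ^ K`
(so it has `O(log n)` bits), and every local computation takes at most `n ^ K` steps. -/
def Succeeds (P : Params) (K : ℕ) (ps : List Cmd) {G : SimpleGraph (Fin P.n)}
    (L : Fin P.M → List G.Dart) (Good : Data P.M → Prop) (ω : Coins P.M) : Prop :=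
  ∃ J : Data P.M, Run P (K * P.s) (P.n ^ K) (P.n ^ K) ω ps 0 (edgeData L) J ∧ Good J

end MapReduce

namespace MapReduce

/-! ## Total correctness with time bounds -/

/-! Give every vertex an independent uniform label, one of q = M(⌈log₂ n⌉ + 1). An edge whose ends
have different labels belongs to the class numbered by the sum of these labels mod q; the edges with
equally labelled ends form one more class, with number q. Within a class all neighbours of a vertex
v carry the same label l, so the degree of v in the class is at most its label degree, the number of
neighbours of v labelled l. If all label degrees are at most some D close to Δ/q, then all classes
have maximum degree at most D, and they may be coloured independently with disjoint palettes.

Edge colouring: a class r < q joins each label k only to the label r - k mod q, which is different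
from k on an edge of the class, so the class is bipartite and D + 1 colours suffice by exchanging
colours along alternating paths (`Reach.step`, `Proper.kempe`). The class q is coloured greedily
with 2D + 1 colours. The total is q(D + 1) + 2D + 1. Vertex colouring: the vertices with a given
label are coloured greedily with D + 1 colours, q(D + 1) in total. Both totals are (1 + O(1/log n))Δ
as soon as D ≤ (1 + O(1/log n))Δ/q and log n ≤ q ≤ Δ/log n. The logarithmic factor in q guarantees
the lower bound on q even when there are few machines.

Distribution: write m = nx and u = n^μ, so that M is about x/u and s about nu. An edge with labels k
and l goes to the machine ((k + l) mod q) mod M. Each class r < q then lies on one machine, and so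
do any two edges of the class q that meet, because all their ends have the same label. For a fixed
vertex and a fixed machine only q/M labels of the other end lead to that machine (`card_route_le`),
so a bound on the label degrees also bounds the load by O(nx/M) = O(s) (`length_routed_le`).

Concentration: from u ≥ (log n)^6 it follows that x/q ≥ (log n)^5/6. A Chernoff bound with relative
error 2/log n (`uniformPi_count_le`) fails with probability at most exp(-(log n)^3/6), and a union
bound over vertices and labels finishes. Once the label degrees are under control, the rest is
deterministic (`Params.Regime.succeeds`).

There are three rounds: labels are drawn and broadcast; every edge is sent to its machine; the
machines colour what they hold. The programs are verified by a Hoare calculus with running times,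
`Total`. Since an execution that breaks a bound on memory, messages or word size has no derivation,
each such statement also certifies these bounds. -/

def Mem.setVar (σ : Mem) (x v : ℕ) : Mem := { σ with var := Function.update σ.var x v }

def Mem.setCell (σ : Mem) (a i v : ℕ) : Mem :=
  { σ with arr := Function.update σ.arr a (Function.update (σ.arr a) i v) }

def Mem.setDrawn (σ : Mem) (x v : ℕ) : Mem :=
  { σ with var := Function.update σ.var x v, draws := σ.draws + 1 }

def Mem.addOut (σ : Mem) (d w : ℕ) : Mem := { σ with out := σ.out ++ [(d, w)] }

/-! ### Effect of the elementary commands on a state. -/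

section MemLemmas
variable (σ : Mem) (x y a b i v w : ℕ)

@[simp] theorem Mem.setVar_var : (σ.setVar x v).var y = if y = x then v else σ.var y := by
  simp [Mem.setVar, Function.update_apply]
@[simp] theorem Mem.setVar_arr : (σ.setVar x v).arr = σ.arr := rfl
@[simp] theorem Mem.setVar_out : (σ.setVar x v).out = σ.out := rfl
@[simp] theorem Mem.setVar_draws : (σ.setVar x v).draws = σ.draws := rfl
@[simp] theorem Mem.setCell_var : (σ.setCell a i v).var = σ.var := rfl
@[simp] theorem Mem.setCell_arr :
    (σ.setCell a i v).arr b = if b = a then Function.update (σ.arr a) i v else σ.arr b := by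
  simp [Mem.setCell, Function.update_apply]
@[simp] theorem Mem.setCell_out : (σ.setCell a i v).out = σ.out := rfl
@[simp] theorem Mem.setDrawn_var : (σ.setDrawn x v).var y = if y = x then v else σ.var y := by
  simp [Mem.setDrawn, Function.update_apply]
@[simp] theorem Mem.setDrawn_out : (σ.setDrawn x v).out = σ.out := rfl
@[simp] theorem Mem.setDrawn_draws : (σ.setDrawn x v).draws = σ.draws + 1 := rfl
@[simp] theorem Mem.addOut_var : (σ.addOut v w).var = σ.var := rfl
@[simp] theorem Mem.addOut_arr : (σ.addOut v w).arr = σ.arr := rfl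
@[simp] theorem Mem.addOut_out : (σ.addOut v w).out = σ.out ++ [(v, w)] := rfl
@[simp] theorem Mem.addOut_draws : (σ.addOut v w).draws = σ.draws := rfl

end MemLemmas

/-- The states agree except on the variables in `X` and the arrays in `A`; the messages and the
number of draws are not compared. -/
structure Agree (X A : List ℕ) (σ σ' : Mem) : Prop where
  var : ∀ x, x ∉ X → σ'.var x = σ.var x
  arr : ∀ a, a ∉ A → σ'.arr a = σ.arr a

section AgreeLemmas
variable {X A X' A' : List ℕ} {σ σ' σ'' : Mem} {x a i v w : ℕ}

theorem Agree.refl (X A : List ℕ) (σ : Mem) : Agree X A σ σ := ⟨fun _ _ => rfl, fun _ _ => rfl⟩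

theorem Agree.trans (h : Agree X A σ σ') (h' : Agree X A σ' σ'') : Agree X A σ σ'' :=
  ⟨fun x hx => (h'.var x hx).trans (h.var x hx), fun a ha => (h'.arr a ha).trans (h.arr a ha)⟩

theorem Agree.mono (h : Agree X A σ σ') (hX : X ⊆ X') (hA : A ⊆ A') : Agree X' A' σ σ' :=
  ⟨fun x hx => h.var x fun hx' => hx (hX hx'), fun a ha => h.arr a fun ha' => ha (hA ha')⟩

theorem Agree.setVar (h : Agree X A σ σ') (hx : x ∈ X) : Agree X A σ (σ'.setVar x v) :=
  ⟨fun y hy => by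
    have : y ≠ x := fun e => hy (e ▸ hx)
    simp [this, h.var y hy], h.arr⟩

theorem Agree.setDrawn (h : Agree X A σ σ') (hx : x ∈ X) : Agree X A σ (σ'.setDrawn x v) :=
  ⟨fun y hy => by
    have : y ≠ x := fun e => hy (e ▸ hx)
    simp [this, h.var y hy], h.arr⟩

theorem Agree.setCell (h : Agree X A σ σ') (ha : a ∈ A) : Agree X A σ (σ'.setCell a i v) :=
  ⟨h.var, fun b hb => by
    have : b ≠ a := fun e => hb (e ▸ ha)
    simp [this, h.arr b hb]⟩

theorem Agree.addOut (h : Agree X A σ σ') : Agree X A σ (σ'.addOut v w) := ⟨h.var, h.arr⟩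

end AgreeLemmas

/-- Started in `σ`, the program `p` halts after at most `T` steps in a state satisfying `Q`. -/
def Total (S W : ℕ) (ρ : Tape) (p : Cmd) (T : ℕ) (σ : Mem) (Q : Mem → Prop) : Prop :=
  ∃ t ≤ T, ∃ σ', Exec S W ρ p σ t σ' ∧ Q σ'

section TotalRules
variable {S W : ℕ} {ρ : Tape} {p q : Cmd} {T T' : ℕ} {σ : Mem} {Q Q' : Mem → Prop}

theorem Total.mono (h : Total S W ρ p T σ Q) (hT : T ≤ T') (hQ : ∀ σ', Q σ' → Q' σ') :
    Total S W ρ p T' σ Q' := by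
  obtain ⟨t, ht, σ', he, hq⟩ := h
  exact ⟨t, ht.trans hT, σ', he, hQ _ hq⟩

theorem Total.le_time (h : Total S W ρ p T σ Q) (hT : T ≤ T') : Total S W ρ p T' σ Q :=
  h.mono hT fun _ h => h

theorem Total.skip (h : Q σ) : Total S W ρ .skip 1 σ Q := ⟨1, le_rfl, σ, .skip σ, h⟩

theorem Total.set {x : ℕ} {e : Expr} (hw : e.eval σ ≤ W) (h : Q (σ.setVar x (e.eval σ))) :
    Total S W ρ (.set x e) 1 σ Q := ⟨1, le_rfl, _, .set x e σ hw, h⟩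

theorem Total.put {a : ℕ} {i e : Expr} (hs : i.eval σ < S) (hw : e.eval σ ≤ W)
    (h : Q (σ.setCell a (i.eval σ) (e.eval σ))) :
    Total S W ρ (.put a i e) 1 σ Q := ⟨1, le_rfl, _, .put a i e σ hs hw, h⟩

theorem Total.rand {x : ℕ} {e : Expr} (hw : e.eval σ ≤ W)
    (h : Q (σ.setDrawn x (ρ σ.draws (e.eval σ) : ℕ))) :
    Total S W ρ (.rand x e) 1 σ Q := ⟨1, le_rfl, _, .rand x e σ hw, h⟩

theorem Total.send {d e : Expr} (hs : σ.out.length < S) (hw : e.eval σ ≤ W)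
    (h : Q (σ.addOut (d.eval σ) (e.eval σ))) :
    Total S W ρ (.send d e) 1 σ Q := ⟨1, le_rfl, _, .send d e σ hs hw, h⟩

theorem Total.seq (h : Total S W ρ p T σ fun σ' => Total S W ρ q T' σ' Q) :
    Total S W ρ (.seq p q) (T + T') σ Q := by
  obtain ⟨t, ht, σ', he, t', ht', σ'', he', hq⟩ := h
  exact ⟨t + t', by omega, σ'', .seq _ _ _ _ _ _ _ he he', hq⟩

theorem Total.ite {g : Expr} (h : g.eval σ ≠ 0 → Total S W ρ p T σ Q)
    (h' : g.eval σ = 0 → Total S W ρ q T σ Q) : Total S W ρ (.ite g p q) (T + 1) σ Q := by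
  by_cases hg : g.eval σ = 0
  · obtain ⟨t, ht, σ', he, hq⟩ := h' hg
    exact ⟨t + 1, by omega, σ', .iteFalse _ _ _ _ _ _ hg he, hq⟩
  · obtain ⟨t, ht, σ', he, hq⟩ := h hg
    exact ⟨t + 1, by omega, σ', .iteTrue _ _ _ _ _ _ hg he, hq⟩

/-- A natural-valued measure that drops in every pass bounds the number of passes; each costs the
body and one step for the guard, and the final 1 pays for the failing test. -/
theorem Total.loop {g : Expr} {B : ℕ} (Inv : Mem → Prop) (f : Mem → ℕ)
    (step : ∀ σ, Inv σ → g.eval σ ≠ 0 → Total S W ρ p B σ fun σ' => Inv σ' ∧ f σ' < f σ)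
    (hQ : ∀ σ, Inv σ → g.eval σ = 0 → Q σ) (hI : Inv σ) {N : ℕ} (hN : f σ ≤ N) :
    Total S W ρ (.loop g p) (N * (B + 1) + 1) σ Q := by
  induction N using Nat.strong_induction_on generalizing σ with
  | _ N ih =>
    by_cases hg : g.eval σ = 0
    · exact ⟨1, by omega, σ, .loopDone _ _ _ hg, hQ σ hI hg⟩
    · obtain ⟨t, ht, σ', he, hI', hf⟩ := step σ hI hg
      have hN1 : N - 1 < N := by omega
      obtain ⟨t', ht', σ'', he', hq⟩ := ih (N - 1) hN1 hI' (by omega)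
      refine ⟨t + t' + 1, ?_, σ'', .loopStep _ _ _ _ _ _ _ hg he he', hq⟩
      obtain ⟨k, rfl⟩ : ∃ k, N = k + 1 := ⟨N - 1, by omega⟩
      simp only [Nat.add_sub_cancel] at ht'
      rw [Nat.add_mul]
      omega

/-- `for x := 0, …, b - 1 do p`. -/
def Cmd.forTo (x : ℕ) (b : Expr) (p : Cmd) : Cmd :=
  .seq (.set x (.lit 0)) (.loop (.lt (.var x) b) (.seq p (.set x (.add (.var x) (.lit 1)))))

/-- `Inv k` describes the moment when the counter has just received the value `k`, so it may mention
the counter itself. The bound is evaluated anew in every pass, which is why the invariant must fix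
its value `N`; `N ≤ W` lets the counter be stored. -/
theorem Total.forTo {x : ℕ} {b : Expr} {B : ℕ} (N : ℕ) (Inv : ℕ → Mem → Prop) (hW : N ≤ W)
    (h0 : Inv 0 (σ.setVar x 0)) (hb : ∀ k σ, Inv k σ → b.eval σ = N)
    (step : ∀ k < N, ∀ σ, Inv k σ → σ.var x = k →
      Total S W ρ p B σ fun σ' => σ'.var x = k ∧ Inv (k + 1) (σ'.setVar x (k + 1)))
    (hQ : ∀ σ, Inv N σ → Q σ) :
    Total S W ρ (.forTo x b p) (N * (B + 2) + 2) σ Q := by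
  have key : Total S W ρ (.forTo x b p) (1 + (N * (B + 1 + 1) + 1)) σ Q := by
    refine Total.seq (Total.set (Nat.zero_le _) ?_)
    refine Total.loop (fun σ => ∃ k ≤ N, σ.var x = k ∧ Inv k σ) (fun σ => N - σ.var x) ?_ ?_
      ⟨0, Nat.zero_le _, by simp, h0⟩ (Nat.sub_le _ _)
    · rintro σ ⟨k, hk, hx, hI⟩ hg
      have hlt : k < N := by
        by_contra h
        simp [Expr.eval, hb k σ hI, hx, h] at hg
      refine Total.seq ((step k hlt σ hI hx).mono le_rfl ?_)
      rintro σ' ⟨hx', hI'⟩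
      refine Total.set (by simp only [Expr.eval, hx']; omega) ?_
      simp only [Expr.eval, hx']
      refine ⟨⟨k + 1, hlt, by simp, hI'⟩, ?_⟩
      simp [hx]
      omega
    · rintro σ ⟨k, hk, hx, hI⟩ hg
      have : k = N := by
        by_contra h
        have : k < N := by omega
        simp [Expr.eval, hb k σ hI, hx, this] at hg
      exact hQ σ (this ▸ hI)
  exact key.mono (by ring_nf; omega) fun _ h => h

end TotalRules

/-! ## Searching for the least unused value -/

/-- Puts the least value not hit by any index below `b` into `a`; the test `hit` says whether
index `e` hits the value `a`. -/
def Cmd.mex (a e : ℕ) (b hit : Expr) : Cmd :=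
  .seq (.set a (.lit 0)) <| .seq (.set e (.lit 0)) <|
    .loop (.lt (.var e) b) <|
      .ite hit (.seq (.set a (.add (.var a) (.lit 1))) (.set e (.lit 0)))
        (.set e (.add (.var e) (.lit 1)))

open Classical in
-- Pigeonhole: the least unused colour is at most the number of edges that forbid colours. This
-- turns degree bounds into bounds on colours.
theorem le_card_of_forall_hit {N α : ℕ} {p : ℕ → Prop} {c : ℕ → ℕ}
    (h : ∀ α' < α, ∃ e < N, p e ∧ c e = α') : α ≤ ((Finset.range N).filter p).card := by
  have : Finset.range α ⊆ ((Finset.range N).filter p).image c := by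
    intro α' hα'
    obtain ⟨e, he, hp, hc⟩ := h α' (Finset.mem_range.1 hα')
    exact Finset.mem_image.2 ⟨e, by simp [he, hp], hc⟩
  simpa using (Finset.card_le_card this).trans Finset.card_image_le

theorem le_of_forall_hit {N α : ℕ} {c : ℕ → ℕ} (h : ∀ α' < α, ∃ e < N, c e = α') : α ≤ N := by
  have : Finset.range α ⊆ (Finset.range N).image c := fun α' hα' =>
    let ⟨e, he, hc⟩ := h α' (Finset.mem_range.1 hα')
    Finset.mem_image.2 ⟨e, Finset.mem_range.2 he, hc⟩
  simpa using (Finset.card_le_card this).trans Finset.card_image_le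

/-- No array of used colours is kept: each hit raises the candidate and restarts the scan, so a scan
that reaches the end met no hit for the current candidate. By pigeonhole the candidate never exceeds
`N`. -/
theorem Total.mex {S W : ℕ} {ρ : Tape} {σ : Mem} {a e : ℕ} {b hit : Expr} (hae : a ≠ e) (N : ℕ)
    (p : ℕ → Prop) (c : ℕ → ℕ) (hW : N ≤ W)
    (hb : ∀ σ', Agree [a, e] [] σ σ' → b.eval σ' = N)
    (hhit : ∀ σ', Agree [a, e] [] σ σ' → σ'.var e < N →
      (hit.eval σ' ≠ 0 ↔ p (σ'.var e) ∧ c (σ'.var e) = σ'.var a)) :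
    Total S W ρ (.mex a e b hit) (4 * (N + 2) ^ 2) σ fun σ' =>
      Agree [a, e] [] σ σ' ∧ σ'.out = σ.out ∧ (∀ i < N, p i → c i ≠ σ'.var a) ∧
        ∀ α < σ'.var a, ∃ i < N, p i ∧ c i = α := by
  have key : Total S W ρ (.mex a e b hit) (1 + (1 + (((N + 1) ^ 2 + N) * (3 + 1) + 1))) σ fun σ' =>
      Agree [a, e] [] σ σ' ∧ σ'.out = σ.out ∧ (∀ i < N, p i → c i ≠ σ'.var a) ∧
        ∀ α < σ'.var a, ∃ i < N, p i ∧ c i = α := by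
    refine Total.seq (Total.set (Nat.zero_le _) (Total.seq (Total.set (Nat.zero_le _) ?_)))
    refine Total.loop (fun σ' => Agree [a, e] [] σ σ' ∧ σ'.out = σ.out ∧
        (∀ i < σ'.var e, p i → c i ≠ σ'.var a) ∧ σ'.var e ≤ N ∧
        ∀ α < σ'.var a, ∃ i < N, p i ∧ c i = α)
      -- A lexicographic measure: raising the candidate gains `N + 1`, more than the restart of the
      -- scan can lose.
      (fun σ' => (N + 1 - σ'.var a) * (N + 1) + (N - σ'.var e)) ?_ ?_ ?_ ?_
    · rintro σ' ⟨hA, ho, hfree, heN, hused⟩ hg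
      have hlt : σ'.var e < N := by
        by_contra h
        simp [Expr.eval, hb σ' hA, h] at hg
      have haN : ∀ α, (∀ α' < α, ∃ i < N, p i ∧ c i = α') → α ≤ N := fun α h =>
        le_of_forall_hit fun α' hα' => let ⟨i, hi, _, hc⟩ := h α' hα'; ⟨i, hi, hc⟩
      refine Total.ite (T := 2) (fun hh => ?_) (fun hh => ?_)
      · obtain ⟨hp, hc⟩ := (hhit σ' hA hlt).1 hh
        have hused' : ∀ α < σ'.var a + 1, ∃ i < N, p i ∧ c i = α := by
          intro α hα
          rcases Nat.lt_succ_iff_lt_or_eq.1 hα with h | h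
          · exact hused α h
          · exact ⟨_, hlt, hp, hc.trans h.symm⟩
        have hle := haN _ hused'
        refine Total.seq (T := 1) (T' := 1) (Total.set (by simp only [Expr.eval]; omega) ?_)
        refine Total.set (Nat.zero_le _) ⟨⟨(hA.setVar (by simp)).setVar (by simp), by simpa using ho,
          by simp [Expr.eval], by simp [Expr.eval], ?_⟩, ?_⟩
        · simpa [Expr.eval, hae] using hused'
        · simp only [Expr.eval, Mem.setVar_var, hae, if_false, if_true]
          obtain ⟨d, hd⟩ : ∃ d, N = σ'.var a + 1 + d := ⟨N - (σ'.var a + 1), by omega⟩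
          have e1 : N + 1 - (σ'.var a + 1) = d + 1 := by omega
          have e2 : N + 1 - σ'.var a = d + 1 + 1 := by omega
          rw [e1, e2, Nat.add_mul (d + 1) 1]
          omega
      · have hh' : ¬ (p (σ'.var e) ∧ c (σ'.var e) = σ'.var a) := fun h => (hhit σ' hA hlt).2 h hh
        refine Total.le_time (T := 1) (Total.set (by simp only [Expr.eval]; omega) ?_) (by norm_num)
        refine ⟨⟨hA.setVar (by simp), by simpa using ho, ?_, by simpa [Expr.eval] using hlt, ?_⟩, ?_⟩
        · simp only [Expr.eval, Mem.setVar_var, hae, if_false, if_true]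
          intro i hi hp hc
          rcases Nat.lt_succ_iff_lt_or_eq.1 hi with h | h
          · exact hfree i h hp hc
          · exact hh' (h ▸ ⟨hp, hc⟩)
        · simpa [Expr.eval, hae] using hused
        · simp only [Expr.eval, Mem.setVar_var, hae, if_false, if_true]
          omega
    · rintro σ' ⟨hA, ho, hfree, heN, hused⟩ hg
      have : σ'.var e = N := by
        by_contra h
        have : σ'.var e < N := by omega
        simp [Expr.eval, hb σ' hA, this] at hg
      exact ⟨hA, ho, this ▸ hfree, hused⟩
    · refine ⟨((Agree.refl _ _ _).setVar (by simp)).setVar (by simp), rfl, ?_, ?_, ?_⟩ <;>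
        simp [Expr.eval, hae]
    · simp [Expr.eval, hae]
      nlinarith
  exact key.mono (by nlinarith) fun _ h => h

end MapReduce

namespace MapReduce

/-! ## Words and their parts -/

/-- The number of vertex labels. -/
def labelCount (P : Params) : ℕ := P.M * (Nat.clog 2 P.n + 1)

/-- The word saying that vertex `v` has label `l < q`. -/
def labelWord (q v l : ℕ) : ℕ := (v * q + l) * 2

/-- The word for the edge `uv`. -/
def edgeWord (n u v : ℕ) : ℕ := (min u v * n + max u v) * 2 + 1

/-- The smaller endpoint of the edge encoded by a word. -/
def src (n w : ℕ) : ℕ := w / 2 / n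

/-- The larger endpoint of the edge encoded by a word. -/
def dst (n w : ℕ) : ℕ := w / 2 % n

/-- The machine responsible for the pairs of vertices with labels `k` and `l`. -/
def route (M q k l : ℕ) : ℕ := (k + l) % q % M

/-- The last bit separates the two kinds of words, so that labels and edges may be mixed in an inbox
in any order. -/
theorem edgeWord_mod_two (n u v : ℕ) : edgeWord n u v % 2 = 1 := by
  unfold edgeWord; omega

theorem labelWord_mod_two (q v l : ℕ) : labelWord q v l % 2 = 0 := by
  unfold labelWord; omega

theorem edgeWord_div_two (n u v : ℕ) : edgeWord n u v / 2 = min u v * n + max u v := by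
  unfold edgeWord; omega

theorem src_edgeWord {n u v : ℕ} (hu : u < n) (hv : v < n) : src n (edgeWord n u v) = min u v := by
  have : max u v < n := max_lt hu hv
  rw [src, edgeWord_div_two, mul_comm, Nat.mul_add_div (by omega), Nat.div_eq_of_lt this, add_zero]

theorem dst_edgeWord {n u v : ℕ} (hu : u < n) (hv : v < n) : dst n (edgeWord n u v) = max u v := by
  have : max u v < n := max_lt hu hv
  rw [dst, edgeWord_div_two, mul_comm, Nat.mul_add_mod, Nat.mod_eq_of_lt this]

theorem edgeWord_le {n u v : ℕ} (hu : u < n) (hv : v < n) : edgeWord n u v ≤ 2 * n * n := by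
  have h1 : max u v < n := max_lt hu hv
  have h2 : min u v + 1 ≤ n := (min_le_left u v).trans_lt hu
  have h3 : (min u v + 1) * n ≤ n * n := Nat.mul_le_mul_right n h2
  unfold edgeWord
  nlinarith

theorem labelWord_le {n q v l : ℕ} (hv : v < n) (hl : l < q) : labelWord q v l ≤ 2 * n * q := by
  have h3 : (v + 1) * q ≤ n * q := Nat.mul_le_mul_right q hv
  unfold labelWord
  nlinarith

theorem labelWord_div_div {q v l : ℕ} (hl : l < q) : labelWord q v l / 2 / q = v := by
  rw [labelWord, Nat.mul_div_cancel _ two_pos, mul_comm, Nat.mul_add_div (by omega),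
    Nat.div_eq_of_lt hl, add_zero]

theorem labelWord_div_mod {q v l : ℕ} (hl : l < q) : labelWord q v l / 2 % q = l := by
  rw [labelWord, Nat.mul_div_cancel _ two_pos, mul_comm, Nat.mul_add_mod, Nat.mod_eq_of_lt hl]

/-- The sizes of the parameters, of the memory and of the words are compatible. -/
structure Roomy (P : Params) (S W : ℕ) : Prop where
  n_pos : 1 ≤ P.n
  M_pos : 1 ≤ P.M
  M_le : P.M ≤ P.n
  n_le : P.n ≤ S
  S_le : S ≤ W
  edge_le : 2 * P.n * P.n ≤ W
  label_le : 2 * P.n * labelCount P ≤ W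

theorem Roomy.labelCount_pos {P : Params} {S W : ℕ} (h : Roomy P S W) : 1 ≤ labelCount P :=
  Nat.mul_pos h.M_pos (Nat.succ_pos _)

theorem Roomy.two_mul_le {P : Params} {S W : ℕ} (h : Roomy P S W) : 2 * P.n ≤ W :=
  (Nat.le_mul_of_pos_right _ h.n_pos).trans h.edge_le

theorem Roomy.labelCount_le {P : Params} {S W : ℕ} (h : Roomy P S W) : labelCount P ≤ W :=
  (Nat.le_mul_of_pos_left _ (Nat.mul_pos two_pos h.n_pos)).trans h.label_le

/-! ## The common beginning of all rounds -/

/-- What a machine knows after the common beginning of its program. -/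
structure Base (P : Params) (i : ℕ) (I : List ℕ) (σ : Mem) : Prop where
  n : σ.var 0 = P.n
  M : σ.var 3 = P.M
  self : σ.var 4 = i
  length : σ.var 5 = I.length
  q : σ.var 8 = labelCount P
  inbox : ∀ k, σ.arr 0 k = I.getD k 0

theorem Base.of_agree {P : Params} {i : ℕ} {I : List ℕ} {σ σ' : Mem} {X A : List ℕ}
    (h : Base P i I σ) (hA : Agree X A σ σ') (hX : ∀ x ∈ [0, 3, 4, 5, 8], x ∉ X)
    (h0 : 0 ∉ A) : Base P i I σ' where
  n := (hA.var 0 (hX 0 (by simp))).trans h.n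
  M := (hA.var 3 (hX 3 (by simp))).trans h.M
  self := (hA.var 4 (hX 4 (by simp))).trans h.self
  length := (hA.var 5 (hX 5 (by simp))).trans h.length
  q := (hA.var 8 (hX 8 (by simp))).trans h.q
  inbox k := (congrFun (hA.arr 0 h0) k).trans (h.inbox k)

/-- Computes the number of labels. -/
def Cmd.prelude : Cmd :=
  .seq (.set 6 (.lit 1)) <| .seq (.set 7 (.lit 0)) <|
    .seq (.loop (.lt (.var 6) (.var 0))
      (.seq (.set 6 (.mul (.var 6) (.lit 2))) (.set 7 (.add (.var 7) (.lit 1))))) <|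
    .set 8 (.mul (.var 3) (.add (.var 7) (.lit 1)))

theorem Total.prelude {P : Params} {S W : ℕ} {ρ : Tape} {i : ℕ} {I : List ℕ} (hR : Roomy P S W) :
    Total S W ρ .prelude (3 * P.n + 4) (initMem P i I) fun σ =>
      Base P i I σ ∧ σ.out = [] ∧ σ.draws = 0 := by
  have hn := hR.n_pos
  have h2n := hR.two_mul_le
  refine Total.le_time (T := 1 + (1 + ((P.n * (2 + 1) + 1) + 1))) ?_ (by omega)
  refine Total.seq (Total.set (by simp only [Expr.eval]; omega)
    (Total.seq (Total.set (Nat.zero_le _) (Total.seq ?_))))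
  -- Variable 6 runs through the powers of two until it reaches `n`; its exponent in variable 7 then
  -- equals `Nat.clog 2 n`. Doubling a positive number increases it, so `n` minus variable 6 is a
  -- measure, crude but sufficient.
  refine Total.loop (fun σ => Agree [6, 7] [] (initMem P i I) σ ∧ σ.out = [] ∧ σ.draws = 0 ∧
      σ.var 6 = 2 ^ σ.var 7 ∧ σ.var 7 ≤ Nat.clog 2 P.n) (fun σ => P.n - σ.var 6) ?_ ?_ ?_
      (Nat.sub_le _ _)
  · rintro σ ⟨hA, ho, hd, h6, h7⟩ hg
    have h0 : σ.var 0 = P.n := hA.var 0 (by simp)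
    have hlt : σ.var 6 < P.n := by
      by_contra h
      simp [Expr.eval, h0, h] at hg
    have hk : σ.var 7 < Nat.clog 2 P.n := by
      by_contra h
      have := (Nat.clog_le_iff_le_pow (b := 2) (by norm_num)).1 (not_lt.1 h)
      omega
    have hcl : Nat.clog 2 P.n ≤ P.n :=
      (Nat.clog_le_iff_le_pow (b := 2) (by norm_num)).2 (Nat.lt_two_pow_self).le
    refine Total.seq (T := 1) (T' := 1) (Total.set (by simp only [Expr.eval]; omega)
      (Total.set (by simp [Expr.eval]; omega) ?_))
    refine ⟨⟨(hA.setVar (by simp)).setVar (by simp), by simpa using ho, by simpa using hd, ?_, ?_⟩, ?_⟩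
    · simp [Expr.eval, h6, pow_succ]
    · simpa [Expr.eval] using hk
    · have : 0 < σ.var 6 := by rw [h6]; positivity
      simp [Expr.eval]
      omega
  · rintro σ ⟨hA, ho, hd, h6, h7⟩ hg
    have h0 : σ.var 0 = P.n := hA.var 0 (by simp)
    have h3 : σ.var 3 = P.M := hA.var 3 (by simp)
    have h4 : σ.var 4 = i := hA.var 4 (by simp)
    have h5 : σ.var 5 = I.length := hA.var 5 (by simp)
    have hle : P.n ≤ σ.var 6 := by
      by_contra h
      simp [Expr.eval, h0, not_le.1 h] at hg
    have h7' : σ.var 7 = Nat.clog 2 P.n :=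
      h7.antisymm ((Nat.clog_le_iff_le_pow (b := 2) (by norm_num)).2 (by omega))
    have hq : Expr.eval σ (.mul (.var 3) (.add (.var 7) (.lit 1))) = labelCount P := by
      simp [Expr.eval, h3, h7', labelCount]
    refine Total.set (hq ▸ hR.labelCount_le) ⟨⟨?_, ?_, ?_, ?_, ?_, ?_⟩, by simpa using ho,
      by simpa using hd⟩
    · simpa using h0
    · simpa using h3
    · simpa using h4
    · simpa using h5
    · simpa using hq
    · intro k
      simpa [initMem] using congrFun (hA.arr 0 (by simp)) k
  · refine ⟨((Agree.refl _ _ _).setVar (by simp)).setVar (by simp), rfl, rfl, ?_, ?_⟩ <;>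
      simp [Expr.eval]

/-- Stores the labels of the vertices in array `1`. -/
def Cmd.readLabels : Cmd :=
  .forTo 9 (.var 5) <| .ite (.mod (.get 0 (.var 9)) (.lit 2)) .skip
    (.put 1 (.div (.div (.get 0 (.var 9)) (.lit 2)) (.var 8))
      (.mod (.div (.get 0 (.var 9)) (.lit 2)) (.var 8)))

/-- Among the words of `I`, the even ones tell the labels of all vertices, and the odd ones encode
edges. -/
structure GoodInbox (P : Params) (lab : ℕ → ℕ) (I : List ℕ) : Prop where
  lab_lt : ∀ v < P.n, lab v < labelCount P
  even : ∀ w ∈ I, w % 2 = 0 → ∃ v < P.n, w = labelWord (labelCount P) v (lab v)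
  odd : ∀ w ∈ I, w % 2 = 1 → ∃ u < P.n, ∃ v < P.n, u ≠ v ∧ w = edgeWord P.n u v
  mem : ∀ v < P.n, labelWord (labelCount P) v (lab v) ∈ I

theorem Total.readLabels {P : Params} {S W : ℕ} {ρ : Tape} {i : ℕ} {I : List ℕ} {σ : Mem}
    {lab : ℕ → ℕ} (hR : Roomy P S W) (hb : Base P i I σ) (hI : GoodInbox P lab I)
    (hlen : I.length ≤ S) :
    Total S W ρ .readLabels (4 * I.length + 2) σ fun σ' =>
      Base P i I σ' ∧ σ'.out = σ.out ∧ ∀ v < P.n, σ'.arr 1 v = lab v := by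
  refine Total.le_time (T := I.length * (2 + 2) + 2) ?_ (by omega)
  have hB : ∀ {σ'}, Agree [9] [1] σ σ' → Base P i I σ' := fun h =>
    hb.of_agree h (by simp) (by simp)
  -- The invariant covers the vertices announced so far. Repeated announcements do no harm, since
  -- all of them for one vertex carry the same label, and in the end `GoodInbox.mem` covers all
  -- vertices.
  refine Total.forTo I.length (fun k σ' => Agree [9] [1] σ σ' ∧ σ'.out = σ.out ∧
    ∀ f < k, ∀ v < P.n, I.getD f 0 = labelWord (labelCount P) v (lab v) → σ'.arr 1 v = lab v)
    (hlen.trans hR.S_le) ?_ ?_ ?_ ?_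
  · exact ⟨(Agree.refl _ _ _).setVar (by simp), by simp, by simp⟩
  · rintro k σ' ⟨hA, -⟩
    exact (hB hA).length
  · rintro k hk σ' ⟨hA, ho, hl⟩ hx
    have hb' := hB hA
    have hmem : I.getD k 0 ∈ I := by
      rw [List.getD_eq_getElem _ _ hk]
      exact List.getElem_mem hk
    have hw : Expr.eval σ' (.get 0 (.var 9)) = I.getD k 0 := by
      simp only [Expr.eval, hx, hb'.inbox]
    refine Total.ite (fun hg => Total.skip ?_) (fun hg => ?_)
    · refine ⟨hx, hA.setVar (by simp), by simpa using ho, ?_⟩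
      intro f hf v hv hfv
      rcases Nat.lt_succ_iff_lt_or_eq.1 hf with h | rfl
      · exact hl f h v hv hfv
      · have : Expr.eval σ' (.mod (.get 0 (.var 9)) (.lit 2)) = I.getD f 0 % 2 := by
          rw [← hw]; rfl
        rw [this, hfv, labelWord_mod_two] at hg
        exact absurd rfl hg
    · have h0 : I.getD k 0 % 2 = 0 := by rw [← hw]; exact hg
      obtain ⟨u, hu, hue⟩ := hI.even _ hmem h0
      have e1 : Expr.eval σ' (.div (.div (.get 0 (.var 9)) (.lit 2)) (.var 8)) = u := by
        have : Expr.eval σ' (.div (.div (.get 0 (.var 9)) (.lit 2)) (.var 8)) =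
          I.getD k 0 / 2 / labelCount P := by rw [← hw, ← hb'.q]; rfl
        rw [this, hue, labelWord_div_div (hI.lab_lt u hu)]
      have e2 : Expr.eval σ' (.mod (.div (.get 0 (.var 9)) (.lit 2)) (.var 8)) = lab u := by
        have : Expr.eval σ' (.mod (.div (.get 0 (.var 9)) (.lit 2)) (.var 8)) =
          I.getD k 0 / 2 % labelCount P := by rw [← hw, ← hb'.q]; rfl
        rw [this, hue, labelWord_div_mod (hI.lab_lt u hu)]
      refine Total.put (by rw [e1]; exact hu.trans_le hR.n_le)
        (by rw [e2]; exact (hI.lab_lt u hu).le.trans hR.labelCount_le) ?_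
      rw [e1, e2]
      refine ⟨by simpa using hx, (hA.setCell (by simp)).setVar (by simp), by simpa using ho, ?_⟩
      intro f hf v hv hfv
      by_cases hvu : v = u
      · simp [hvu]
      · rcases Nat.lt_succ_iff_lt_or_eq.1 hf with h | rfl
        · simpa [hvu] using hl f h v hv hfv
        · exfalso
          rw [hue] at hfv
          have := congrArg (fun w => w / 2 / labelCount P) hfv
          simp only [labelWord_div_div (hI.lab_lt u hu), labelWord_div_div (hI.lab_lt v hv)] at this
          exact hvu this.symm
  · rintro σ' ⟨hA, ho, hl⟩
    refine ⟨hB hA, ho, fun v hv => ?_⟩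
    obtain ⟨f, hf, he⟩ := List.getElem_of_mem (hI.mem v hv)
    exact hl f hf v hv (by rw [List.getD_eq_getElem _ _ hf, he])

/-! ## The first round: drawing and announcing the labels -/

/-- The word for the edge with endpoints `u` and `v`. -/
def Expr.edgeWord (u v : Expr) : Expr :=
  .add (.mul (.add (.mul (.lt u v) (.add (.mul u (.var 0)) v))
    (.mul (.eq (.lt u v) (.lit 0)) (.add (.mul v (.var 0)) u))) (.lit 2)) (.lit 1)

theorem Expr.eval_edgeWord (σ : Mem) (u v : Expr) :
    (Expr.edgeWord u v).eval σ = MapReduce.edgeWord (σ.var 0) (u.eval σ) (v.eval σ) := by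
  simp only [Expr.edgeWord, Expr.eval, MapReduce.edgeWord]
  by_cases h : Expr.eval σ u < Expr.eval σ v
  · simp [h, min_eq_left h.le, max_eq_right h.le]
  · simp [h, min_eq_right (not_lt.1 h), max_eq_left (not_lt.1 h)]

/-- Machine `i` is in charge of the vertices `i`, `i + M`, `i + 2 * M`, …, so draw number `t`
belongs to the vertex `i + M * t`. The range is `q - 1` because `rand` includes the upper end. Every
label is sent to all machines. -/
def Cmd.drawLabels : Cmd :=
  .seq (.set 9 (.var 4)) <| .loop (.lt (.var 9) (.var 0)) <|
    .seq (.rand 10 (.sub (.var 8) (.lit 1))) <|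
    .seq (.forTo 11 (.var 3)
      (.send (.var 11) (.mul (.add (.mul (.var 9) (.var 8)) (.var 10)) (.lit 2))))
    (.set 9 (.add (.var 9) (.var 3)))

/-- The messages announcing the labels drawn by machine `i`, up to draw `t`. -/
def labelMessages (P : Params) (lab : ℕ → ℕ) (i t : ℕ) : List (ℕ × ℕ) :=
  (List.range t).flatMap fun t => (List.range P.M).map fun j =>
    (j, labelWord (labelCount P) (i + P.M * t) (lab (i + P.M * t)))

theorem labelMessages_succ (P : Params) (lab : ℕ → ℕ) (i t : ℕ) :
    labelMessages P lab i (t + 1) = labelMessages P lab i t ++ (List.range P.M).map fun j =>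
      (j, labelWord (labelCount P) (i + P.M * t) (lab (i + P.M * t))) := by
  simp [labelMessages, List.range_succ]

theorem length_labelMessages (P : Params) (lab : ℕ → ℕ) (i t : ℕ) :
    (labelMessages P lab i t).length = P.M * t := by
  simp [labelMessages, List.length_flatMap, mul_comm]

theorem Total.drawLabels {P : Params} {S W : ℕ} {ρ : Tape} {i : ℕ} {I : List ℕ} {σ : Mem}
    {lab : ℕ → ℕ} (hR : Roomy P S W) (hb : Base P i I σ) (hi : i < P.M) (ho : σ.out = [])
    (hd : σ.draws = 0) (hlab : ∀ v < P.n, lab v < labelCount P)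
    (hρ : ∀ t, i + P.M * t < P.n → (ρ t (labelCount P - 1) : ℕ) = lab (i + P.M * t))
    (hS : P.n + P.M ≤ S) :
    Total S W ρ .drawLabels (P.n * (3 * P.M + 5) + 2) σ fun σ' =>
      Base P i I σ' ∧ ∃ t, (∀ t', i + P.M * t' < P.n ↔ t' < t) ∧
        σ'.out = labelMessages P lab i t ∧ P.M * t ≤ P.n + P.M := by
  have hM := hR.M_pos
  have hq := hR.labelCount_pos
  have hMn := hR.M_le
  refine Total.le_time (T := 1 + (P.n * ((1 + ((P.M * (1 + 2) + 2) + 1)) + 1) + 1)) ?_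
    (by ring_nf; omega)
  have hB : ∀ {σ'}, Agree [9, 10, 11] [] σ σ' → Base P i I σ' := fun h =>
    hb.of_agree h (by simp) (by simp)
  refine Total.seq (Total.set ?_ ?_)
  · simp only [Expr.eval, hb.self]
    have := hR.two_mul_le
    omega
  refine Total.loop (fun σ' => Agree [9, 10, 11] [] σ σ' ∧ σ'.var 9 = i + P.M * σ'.draws ∧
    (∀ t' < σ'.draws, i + P.M * t' < P.n) ∧ σ'.out = labelMessages P lab i σ'.draws)
    (fun σ' => P.n - σ'.var 9) ?_ ?_ ?_ (Nat.sub_le _ _)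
  · rintro σ₁ ⟨hA, h9, ht, hout⟩ hg
    have hb₁ := hB hA
    have hlt : σ₁.var 9 < P.n := by
      by_contra h
      simp [Expr.eval, hb₁.n, h] at hg
    set d := σ₁.draws with hdd
    have hrand : Expr.eval σ₁ (.sub (.var 8) (.lit 1)) = labelCount P - 1 := by
      simp [Expr.eval, hb₁.q]
    have hle := hR.labelCount_le
    refine Total.seq (Total.rand (by rw [hrand]; omega) ?_)
    rw [hrand, ← hdd, hρ d (h9 ▸ hlt)]
    set σ₂ := σ₁.setDrawn 10 (lab (i + P.M * d)) with hσ₂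
    have hA₂ : Agree [9, 10, 11] [] σ σ₂ := hA.setDrawn (by simp)
    refine Total.seq ?_
    refine Total.forTo P.M (fun k σ' => Agree [11] [] σ₂ σ' ∧ σ'.draws = d + 1 ∧
      σ'.out = labelMessages P lab i d ++ (List.range k).map fun j =>
        (j, labelWord (labelCount P) (i + P.M * d) (lab (i + P.M * d)))) ?_ ?_ ?_ ?_ ?_
    · have := hR.two_mul_le
      omega
    · exact ⟨(Agree.refl _ _ _).setVar (by simp), by simp [hσ₂, hdd], by simp [hσ₂, hout]⟩
    · rintro k σ₃ ⟨hA₃, -⟩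
      exact (hB (hA₂.trans (hA₃.mono (by simp) (by simp)))).M
    · rintro k hk σ₃ ⟨hA₃, hd₃, ho₃⟩ hx
      have hb₃ := hB (hA₂.trans (hA₃.mono (by simp) (by simp)))
      have hw : Expr.eval σ₃ (.mul (.add (.mul (.var 9) (.var 8)) (.var 10)) (.lit 2)) =
          labelWord (labelCount P) (i + P.M * d) (lab (i + P.M * d)) := by
        simp only [Expr.eval, hb₃.q, hA₃.var 9 (by simp), hA₃.var 10 (by simp)]
        simp [hσ₂, h9, labelWord]
      refine Total.send ?_ ?_ ?_
      · rw [ho₃, List.length_append, length_labelMessages, List.length_map, List.length_range]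
        omega
      · rw [hw]
        exact (labelWord_le (h9 ▸ hlt) (hlab _ (h9 ▸ hlt))).trans hR.label_le
      · rw [hw]
        refine ⟨by simpa using hx, hA₃.addOut.setVar (by simp), by simpa using hd₃, ?_⟩
        simp [ho₃, List.range_succ, Expr.eval, hx]
    · rintro σ₃ ⟨hA₃, hd₃, ho₃⟩
      have hA₃' := hA₂.trans (hA₃.mono (by simp) (by simp) : Agree [9, 10, 11] [] σ₂ σ₃)
      have hb₃ := hB hA₃'
      have h9' : σ₃.var 9 = i + P.M * d := by
        rw [hA₃.var 9 (by simp)]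
        simp [hσ₂, h9]
      have he : Expr.eval σ₃ (.add (.var 9) (.var 3)) = i + P.M * (d + 1) := by
        simp [Expr.eval, h9', hb₃.M]
        ring
      have := hR.two_mul_le
      refine Total.set ?_ ?_
      · simp only [Expr.eval, h9', hb₃.M]
        omega
      rw [he]
      refine ⟨⟨hA₃'.setVar (by simp), by simp [hd₃], ?_, ?_⟩, ?_⟩
      · simp only [Mem.setVar_draws, hd₃]
        intro t' ht'
        rcases Nat.lt_succ_iff_lt_or_eq.1 ht' with h | rfl
        · exact ht t' h
        · omega
      · simp [hd₃, ho₃, labelMessages_succ]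
      · have e : P.M * (d + 1) = P.M * d + P.M := by ring
        simp only [Mem.setVar_var, if_true, e]
        omega
  · rintro σ₁ ⟨hA, h9, ht, hout⟩ hg
    have hb₁ := hB hA
    have hge : P.n ≤ σ₁.var 9 := by
      by_contra h
      simp [Expr.eval, hb₁.n, not_le.1 h] at hg
    refine ⟨hb₁, σ₁.draws, fun t' => ⟨fun h => ?_, ht t'⟩, hout, ?_⟩
    · by_contra hc
      have : P.M * σ₁.draws ≤ P.M * t' := Nat.mul_le_mul_left _ (not_lt.1 hc)
      omega
    -- The last draw, number `t - 1`, was for a vertex below `n`, so `M * t` exceeds `n` by at most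
    -- `M`.
    · rcases Nat.eq_zero_or_pos σ₁.draws with h | h
      · simp [h]
      · have := ht (σ₁.draws - 1) (by omega)
        obtain ⟨e, he⟩ : ∃ e, σ₁.draws = e + 1 := ⟨σ₁.draws - 1, by omega⟩
        rw [he] at this ⊢
        simp only [Nat.add_sub_cancel] at this
        rw [Nat.mul_add]
        omega
  · refine ⟨(Agree.refl _ _ _).setVar (by simp), ?_, ?_, ?_⟩
    · simp [hd, Expr.eval, hb.self]
    · simp [hd]
    · simp [hd, ho, labelMessages]

/-- Passes the edges of the input on to the next round. -/
def Cmd.keepEdges : Cmd :=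
  .forTo 9 (.div (.var 5) (.lit 2)) <|
    .send (.var 4) (.edgeWord (.get 0 (.mul (.lit 2) (.var 9)))
      (.get 0 (.add (.mul (.lit 2) (.var 9)) (.lit 1))))

theorem getD_flatMap_pair (E : List (ℕ × ℕ)) {k : ℕ} (hk : k < E.length) :
    (E.flatMap fun e => [e.1, e.2]).getD (2 * k) 0 = E[k].1 ∧
      (E.flatMap fun e => [e.1, e.2]).getD (2 * k + 1) 0 = E[k].2 := by
  induction E generalizing k with
  | nil => simp at hk
  | cons e E ih =>
    cases k with
    | zero => simp
    | succ k =>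
      have := ih (k := k) (by simpa using hk)
      simpa [Nat.mul_add] using this

theorem Total.keepEdges {P : Params} {S W : ℕ} {ρ : Tape} {i : ℕ} {E : List (ℕ × ℕ)} {σ : Mem}
    (hR : Roomy P S W) (hb : Base P i (E.flatMap fun e => [e.1, e.2]) σ)
    (hE : ∀ e ∈ E, e.1 < P.n ∧ e.2 < P.n) (hS : σ.out.length + E.length ≤ S) :
    Total S W ρ .keepEdges (3 * E.length + 2) σ fun σ' =>
      σ'.out = σ.out ++ E.map fun e => (i, edgeWord P.n e.1 e.2) := by
  refine Total.le_time (T := E.length * (1 + 2) + 2) ?_ (by omega)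
  have hB : ∀ {σ'}, Agree [9] [] σ σ' → Base P i (E.flatMap fun e => [e.1, e.2]) σ' := fun h =>
    hb.of_agree h (by simp) (by simp)
  have hS' := hR.S_le
  refine Total.forTo E.length (fun k σ' => Agree [9] [] σ σ' ∧
    σ'.out = σ.out ++ (E.take k).map fun e => (i, edgeWord P.n e.1 e.2)) (by omega) ?_ ?_ ?_ ?_
  · exact ⟨(Agree.refl _ _ _).setVar (by simp), by simp⟩
  · rintro k σ' ⟨hA, -⟩
    simp only [Expr.eval, (hB hA).length]
    simp [List.length_flatMap]
  · rintro k hk σ' ⟨hA, ho⟩ hx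
    have hb' := hB hA
    have hw : Expr.eval σ' (.edgeWord (.get 0 (.mul (.lit 2) (.var 9)))
        (.get 0 (.add (.mul (.lit 2) (.var 9)) (.lit 1)))) = edgeWord P.n E[k].1 E[k].2 := by
      rw [Expr.eval_edgeWord]
      simp only [Expr.eval, hx, hb'.inbox, hb'.n, (getD_flatMap_pair E hk).1,
        (getD_flatMap_pair E hk).2]
    have hEk := hE _ (List.getElem_mem hk)
    refine Total.send ?_ ?_ ?_
    · rw [ho, List.length_append, List.length_map, List.length_take]
      omega
    · rw [hw]
      exact (edgeWord_le hEk.1 hEk.2).trans hR.edge_le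
    · rw [hw]
      refine ⟨by simpa using hx, hA.addOut.setVar (by simp), ?_⟩
      rw [Mem.setVar_out, Mem.addOut_out, ho, ← List.take_append_getElem hk, List.map_append]
      simp [Expr.eval, hb'.self]
  · rintro σ' ⟨hA, ho⟩
    simpa using ho

/-- The program of the first round. -/
def Cmd.announce : Cmd := .seq .prelude (.seq .drawLabels .keepEdges)

theorem Total.announce {P : Params} {S W : ℕ} {ρ : Tape} {i : ℕ} {E : List (ℕ × ℕ)}
    {lab : ℕ → ℕ} (hR : Roomy P S W) (hi : i < P.M) (hlab : ∀ v < P.n, lab v < labelCount P)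
    (hρ : ∀ t, i + P.M * t < P.n → (ρ t (labelCount P - 1) : ℕ) = lab (i + P.M * t))
    (hE : ∀ e ∈ E, e.1 < P.n ∧ e.2 < P.n) (hS : P.n + P.M + E.length ≤ S) :
    Total S W ρ .announce (3 * P.n + 4 + ((P.n * (3 * P.M + 5) + 2) + (3 * E.length + 2)))
      (initMem P i (E.flatMap fun e => [e.1, e.2])) fun σ' =>
      ∃ t, (∀ t', i + P.M * t' < P.n ↔ t' < t) ∧ P.M * t ≤ P.n + P.M ∧
        σ'.out = labelMessages P lab i t ++ E.map fun e => (i, edgeWord P.n e.1 e.2) := by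
  refine Total.seq ((Total.prelude hR).mono le_rfl ?_)
  rintro σ₁ ⟨hb₁, ho₁, hd₁⟩
  refine Total.seq ((Total.drawLabels hR hb₁ hi ho₁ hd₁ hlab hρ (by omega)).mono le_rfl ?_)
  rintro σ₂ ⟨hb₂, t, ht, ho₂, hle⟩
  refine (Total.keepEdges hR hb₂ hE ?_).mono le_rfl ?_
  · rw [ho₂, length_labelMessages]
    omega
  · rintro σ₃ ho₃
    exact ⟨t, ht, hle, by rw [ho₃, ho₂]⟩

/-! ## The second round: sending the edges to the machines responsible for them -/

def Expr.src (w : Expr) : Expr := .div (.div w (.lit 2)) (.var 0)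
def Expr.dst (w : Expr) : Expr := .mod (.div w (.lit 2)) (.var 0)

/-- The labels must be sent by each machine to itself, since nothing else survives the end of a
round and they are needed again for the colouring. -/
def Cmd.dispatch : Cmd :=
  .forTo 9 (.var 5) <| .ite (.mod (.get 0 (.var 9)) (.lit 2))
    (.send (.mod (.mod (.add (.get 1 (.src (.get 0 (.var 9)))) (.get 1 (.dst (.get 0 (.var 9)))))
      (.var 8)) (.var 3)) (.get 0 (.var 9)))
    (.send (.var 4) (.get 0 (.var 9)))

/-- The machine to which machine `i` forwards the word `w`. -/
def forwardTo (P : Params) (lab : ℕ → ℕ) (i w : ℕ) : ℕ :=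
  if w % 2 = 1 then route P.M (labelCount P) (lab (src P.n w)) (lab (dst P.n w)) else i

theorem GoodInbox.src_lt {P : Params} {lab : ℕ → ℕ} {I : List ℕ} (hI : GoodInbox P lab I) {w : ℕ}
    (hw : w ∈ I) (ho : w % 2 = 1) : src P.n w < dst P.n w ∧ dst P.n w < P.n := by
  obtain ⟨u, hu, v, hv, huv, rfl⟩ := hI.odd w hw ho
  rw [src_edgeWord hu hv, dst_edgeWord hu hv]
  exact ⟨min_lt_max.2 huv, max_lt hu hv⟩

theorem GoodInbox.le {P : Params} {S W : ℕ} {lab : ℕ → ℕ} {I : List ℕ} (hI : GoodInbox P lab I)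
    (hR : Roomy P S W) {w : ℕ} (hw : w ∈ I) : w ≤ W := by
  rcases Nat.mod_two_eq_zero_or_one w with h | h
  · obtain ⟨v, hv, rfl⟩ := hI.even w hw h
    exact (labelWord_le hv (hI.lab_lt v hv)).trans hR.label_le
  · obtain ⟨u, hu, v, hv, -, rfl⟩ := hI.odd w hw h
    exact (edgeWord_le hu hv).trans hR.edge_le

theorem Total.dispatch {P : Params} {S W : ℕ} {ρ : Tape} {i : ℕ} {I : List ℕ} {σ : Mem}
    {lab : ℕ → ℕ} (hR : Roomy P S W) (hb : Base P i I σ) (hI : GoodInbox P lab I)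
    (hlen : I.length ≤ S) (hout : σ.out = []) (hlab : ∀ v < P.n, σ.arr 1 v = lab v) :
    Total S W ρ .dispatch (4 * I.length + 2) σ fun σ' =>
      σ'.out = I.map fun w => (forwardTo P lab i w, w) := by
  refine Total.le_time (T := I.length * (2 + 2) + 2) ?_ (by omega)
  have hB : ∀ {σ'}, Agree [9] [] σ σ' → Base P i I σ' := fun h =>
    hb.of_agree h (by simp) (by simp)
  refine Total.forTo I.length (fun k σ' => Agree [9] [] σ σ' ∧
    σ'.out = (I.take k).map fun w => (forwardTo P lab i w, w)) (hlen.trans hR.S_le) ?_ ?_ ?_ ?_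
  · exact ⟨(Agree.refl _ _ _).setVar (by simp), by simp [hout]⟩
  · rintro k σ' ⟨hA, -⟩
    exact (hB hA).length
  · rintro k hk σ' ⟨hA, ho⟩ hx
    have hb' := hB hA
    have hlab' : ∀ v < P.n, σ'.arr 1 v = lab v := fun v hv => by
      rw [hA.arr 1 (by simp), hlab v hv]
    have hmem : I[k] ∈ I := List.getElem_mem hk
    have hw : Expr.eval σ' (.get 0 (.var 9)) = I[k] := by
      simp only [Expr.eval, hx, hb'.inbox, List.getD_eq_getElem _ _ hk]
    have hm : Expr.eval σ' (.mod (.get 0 (.var 9)) (.lit 2)) = I[k] % 2 := by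
      rw [← hw]; rfl
    have hl : σ'.out.length < S := by
      rw [ho, List.length_map, List.length_take]
      omega
    refine Total.ite (fun hg => Total.send hl (hw ▸ hI.le hR hmem) ?_)
      (fun hg => Total.send hl (hw ▸ hI.le hR hmem) ?_)
    · have hodd : I[k] % 2 = 1 := by rw [hm] at hg; omega
      have hlt := hI.src_lt hmem hodd
      have hd : Expr.eval σ' (.mod (.mod (.add (.get 1 (.src (.get 0 (.var 9))))
          (.get 1 (.dst (.get 0 (.var 9))))) (.var 8)) (.var 3)) = forwardTo P lab i I[k] := by
        have : ∀ w : Expr, Expr.eval σ' (.mod (.mod (.add (.get 1 (.src w)) (.get 1 (.dst w)))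
            (.var 8)) (.var 3)) = (σ'.arr 1 (src (σ'.var 0) (w.eval σ')) +
              σ'.arr 1 (dst (σ'.var 0) (w.eval σ'))) % σ'.var 8 % σ'.var 3 := fun _ => rfl
        rw [this, hw, hb'.n, hb'.q, hb'.M, hlab' _ (hlt.1.trans hlt.2), hlab' _ hlt.2, forwardTo,
          if_pos hodd, route]
      rw [hd, hw]
      refine ⟨by simpa using hx, hA.addOut.setVar (by simp), ?_⟩
      rw [Mem.setVar_out, Mem.addOut_out, ho, ← List.take_append_getElem hk, List.map_append]
      simp
    · rw [hm] at hg
      rw [hw]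
      refine ⟨by simpa using hx, hA.addOut.setVar (by simp), ?_⟩
      rw [Mem.setVar_out, Mem.addOut_out, ho, ← List.take_append_getElem hk, List.map_append]
      simp [Expr.eval, hb'.self, forwardTo, hg]
  · rintro σ' ⟨hA, ho⟩
    simpa using ho

/-- The program of the second round. -/
def Cmd.forward : Cmd := .seq .prelude (.seq .readLabels .dispatch)

theorem Total.forward {P : Params} {S W : ℕ} {ρ : Tape} {i : ℕ} {I : List ℕ}
    {lab : ℕ → ℕ} (hR : Roomy P S W) (hI : GoodInbox P lab I) (hlen : I.length ≤ S) :
    Total S W ρ .forward (3 * P.n + 4 + ((4 * I.length + 2) + (4 * I.length + 2)))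
      (initMem P i I) fun σ' => σ'.out = I.map fun w => (forwardTo P lab i w, w) := by
  refine Total.seq ((Total.prelude hR).mono le_rfl ?_)
  rintro σ₁ ⟨hb₁, ho₁, -⟩
  refine Total.seq ((Total.readLabels hR hb₁ hI hlen).mono le_rfl ?_)
  rintro σ₂ ⟨hb₂, ho₂, hl₂⟩
  exact Total.dispatch hR hb₂ hI hlen (ho₂.trans ho₁) hl₂

end MapReduce

namespace MapReduce

/-! ## Extending a partial edge colouring along alternating paths -/

section Kempe

variable {act : ℕ → Prop} {U V R C C' : ℕ → ℕ} {T : ℕ → Prop} {k r a b u v : ℕ}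

/-- Edge `e` has endpoint `x`. -/
def IsEnd (U V : ℕ → ℕ) (x e : ℕ) : Prop := U e = x ∨ V e = x

/-- Among the active edges below `k`, two edges of the same class that share an endpoint have
different colours. -/
def Proper (act : ℕ → Prop) (U V R C : ℕ → ℕ) (k : ℕ) : Prop :=
  ∀ e < k, ∀ f < k, act e → act f → e ≠ f → R e = R f → ∀ x, IsEnd U V x e → IsEnd U V x f →
    C e ≠ C f

/-- The colour `a` is not used at `x` on active edges of class `r` below `k`. -/
def Free (act : ℕ → Prop) (U V R C : ℕ → ℕ) (k r x a : ℕ) : Prop :=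
  ∀ e < k, act e → R e = r → IsEnd U V x e → C e ≠ a

theorem swap_cases (a b c : ℕ) : (c = a ∧ Equiv.swap a b c = b) ∨ (c = b ∧ Equiv.swap a b c = a) ∨
    (c ≠ a ∧ c ≠ b ∧ Equiv.swap a b c = c) := by
  by_cases h : c = a
  · subst h; simp
  · by_cases h' : c = b
    · subst h'; simp
    · exact .inr (.inr ⟨h, h', Equiv.swap_apply_of_ne_of_ne h h'⟩)

open Classical in
-- Exchanging `a` and `b` on the edges inside a set `T` closed under edges of these colours keeps
-- the colouring proper. As `T` contains `V k`, where `b` was missing, `a` is missing there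
-- afterwards; it stays missing at `U k`, which lies outside `T`. So the new edge can take `a`. If
-- `a = b` the exchange is void and nothing about `U k` is needed.
theorem Proper.kempe (hp : Proper act U V R C k)
    (ha : Free act U V R C k (R k) (U k) a) (hb : Free act U V R C k (R k) (V k) b)
    (hT : ∀ e < k, act e → R e = R k → (C e = a ∨ C e = b) → (T (U e) ↔ T (V e)))
    (hv : T (V k)) (hu : a = b ∨ ¬ T (U k))
    (hC : ∀ e < k, C' e = if act e ∧ R e = R k ∧ T (U e) then Equiv.swap a b (C e) else C e)
    (hk : C' k = a) : Proper act U V R C' (k + 1) := by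
  -- After the exchange no older edge of the class that meets the new one has the colour `a`.
  have hnew : ∀ e < k, act e → R e = R k → ∀ x, IsEnd U V x e → IsEnd U V x k → C' e ≠ a := by
    intro e he hae hR x hxe hxk h
    rw [hC e he] at h
    have hTx : (C e = a ∨ C e = b) → (T (U e) ↔ T x) := by
      intro hc
      have := hT e he hae hR hc
      rcases hxe with rfl | rfl
      · rfl
      · exact this
    rcases hxk with rfl | rfl
    · have hca := ha e he hae hR hxe
      rcases hu with rfl | hu
      · simp [hca] at h
      · rcases swap_cases a b (C e) with h' | h' | h'
        · exact hca h'.1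
        · have := hTx (.inr h'.1)
          simp [this, hu] at h
          exact hca h
        · rw [h'.2.2, ite_self] at h
          exact hca h
    · have hcb := hb e he hae hR hxe
      rcases swap_cases a b (C e) with h' | h' | h'
      · have := hTx (.inl h'.1)
        rw [if_pos ⟨hae, hR, this.2 hv⟩, h'.2] at h
        exact hcb (h'.1.trans h.symm)
      · exact hcb h'.1
      · rw [h'.2.2, ite_self] at h
        exact h'.1 h
  intro e he f hf hae haf hef hR x hxe hxf
  rcases Nat.lt_succ_iff_lt_or_eq.1 he with he | rfl <;>
    rcases Nat.lt_succ_iff_lt_or_eq.1 hf with hf | rfl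
  · have hne := hp e he f hf hae haf hef hR x hxe hxf
    rw [hC e he, hC f hf]
    by_cases hr : R e = R k
    · have hrf : R f = R k := hR ▸ hr
      -- An edge at `x` coloured `a` or `b` is exchanged exactly when `x` lies in `T`, so two such
      -- edges at `x` are exchanged together or not at all.
      have hTe : (C e = a ∨ C e = b) → (T (U e) ↔ T x) := by
        intro hc
        have := hT e he hae hr hc
        rcases hxe with rfl | rfl
        · rfl
        · exact this
      have hTf : (C f = a ∨ C f = b) → (T (U f) ↔ T x) := by
        intro hc
        have := hT f hf haf hrf hc
        rcases hxf with rfl | rfl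
        · rfl
        · exact this
      simp only [hae, haf, hr, hrf, true_and]
      rcases swap_cases a b (C e) with h | h | h <;> rcases swap_cases a b (C f) with h' | h' | h'
        <;> grind
    · have hrf : R f ≠ R k := hR ▸ hr
      simpa [hr, hrf] using hne
  · rw [hk]
    exact hnew e he hae hR x hxe hxf
  · rw [hk]
    exact (hnew f hf haf hR.symm x hxf hxe).symm
  · exact absurd rfl hef

/-- The set `T` consists of vertices that can be reached from `v` along paths whose edges are
alternately coloured `a` and `b`, and `u` is not one of them. -/
structure Reach (act : ℕ → Prop) (U V R C : ℕ → ℕ) (k r a b u v : ℕ) (side : ℕ → Bool)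
    (T : ℕ → Prop) : Prop where
  start : T v
  avoid : ¬ T u
  same : ∀ x, T x → x ≠ v → side x = side v →
    ∃ e < k, act e ∧ R e = r ∧ IsEnd U V x e ∧ C e = b ∧ T (U e) ∧ T (V e)
  other : ∀ x, T x → side x ≠ side v →
    ∃ e < k, act e ∧ R e = r ∧ IsEnd U V x e ∧ C e = a ∧ T (U e) ∧ T (V e)

/-- Parity along alternating paths. A vertex other than `v` on the side of `v` is entered by colour
`b` and can only be left by `a`; on the other side it is the reverse; at `v` itself `b` is missing.
Hence an edge leaving `T` towards the side of `u` has colour `a`, which is missing at `u`, and `u`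
is never reached. Remembering for each vertex only the colour of an entering edge inside `T` avoids
handling paths. -/
theorem Reach.step {side : ℕ → Bool} (h : Reach act U V R C k r a b u v side T)
    (hp : Proper act U V R C k) (ha : Free act U V R C k r u a) (hb : Free act U V R C k r v b)
    (hs : ∀ e < k, act e → R e = r → side (U e) ≠ side (V e)) (huv : side u ≠ side v)
    {e : ℕ} (he : e < k) (hae : act e) (hR : R e = r) (hc : C e = a ∨ C e = b)
    (hT : T (U e) ↔ ¬ T (V e)) :
    Reach act U V R C k r a b u v side fun z => T z ∨ z = U e ∨ z = V e := by
  obtain ⟨x, y, hx, hy, hxe, hye, hends⟩ : ∃ x y, T x ∧ ¬ T y ∧ IsEnd U V x e ∧ IsEnd U V y e ∧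
      ∀ z, (z = U e ∨ z = V e) ↔ (z = x ∨ z = y) := by
    by_cases hu : T (U e)
    · exact ⟨U e, V e, hu, hT.1 hu, .inl rfl, .inr rfl, fun _ => Iff.rfl⟩
    · exact ⟨V e, U e, by_contra fun hv => hu (hT.2 hv), hu, .inr rfl, .inl rfl, fun _ => or_comm⟩
  have hside : side x ≠ side y := by
    have := hs e he hae hR
    rcases (hends (U e)).1 (.inl rfl) with h1 | h1 <;>
      rcases (hends (V e)).1 (.inr rfl) with h2 | h2 <;> rw [h1, h2] at this
    · exact absurd rfl this
    · exact this
    · exact this.symm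
    · exact absurd rfl this
  have hTT : ∀ z, T z → (T z ∨ z = U e ∨ z = V e) := fun z hz => .inl hz
  -- Properness leaves one edge of the colour of `e` at `x`, namely `e`, and `e` leaves `T`; so the
  -- colour by which `x` was entered is not that of `e`.
  have huniq : ∀ f < k, act f → R f = r → IsEnd U V x f → T (U f) → T (V f) → C f ≠ C e := by
    intro f hf haf hRf hxf hTU hTV hcc
    have hne : f ≠ e := by
      rintro rfl
      rcases hye with rfl | rfl
      · exact hy hTU
      · exact hy hTV
    exact hp f hf e he haf hae hne (hRf.trans hR.symm) x hxf hxe hcc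
  have lift : ∀ c z, (∃ e < k, act e ∧ R e = r ∧ IsEnd U V z e ∧ C e = c ∧ T (U e) ∧ T (V e)) →
      ∃ f < k, act f ∧ R f = r ∧ IsEnd U V z f ∧ C f = c ∧ (T (U f) ∨ U f = U e ∨ U f = V e) ∧
        (T (V f) ∨ V f = U e ∨ V f = V e) := by
    rintro c z ⟨f, h1, h2, h3, h4, h5, h6, h7⟩
    exact ⟨f, h1, h2, h3, h4, h5, .inl h6, .inl h7⟩
  by_cases hxv : side x = side v
  · have hca : C e = a := by
      rcases hc with hc | hc
      · exact hc
      · exfalso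
        by_cases hv : x = v
        · exact hb e he hae hR (hv ▸ hxe) hc
        · obtain ⟨f, hf, haf, hRf, hxf, hcf, h1, h2⟩ := h.same x hx hv hxv
          exact huniq f hf haf hRf hxf h1 h2 (hcf.trans hc.symm)
    have hyv : side y ≠ side v := fun h => hside (hxv.trans h.symm)
    have hyu : y ≠ u := by
      rintro rfl
      exact ha e he hae hR hye hca
    refine ⟨hTT _ h.start, ?_, ?_, ?_⟩
    · rw [hends]
      rintro (h1 | rfl | h1)
      · exact h.avoid h1
      · exact h.avoid hx
      · exact hyu h1.symm
    · intro z hz hzv hsz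
      rw [hends] at hz
      rcases hz with h1 | rfl | rfl
      · exact lift b z (h.same z h1 hzv hsz)
      · exact lift b z (h.same z hx hzv hsz)
      · exact absurd hsz hyv
    · intro z hz hsz
      rw [hends] at hz
      rcases hz with h1 | rfl | rfl
      · exact lift a z (h.other z h1 hsz)
      · exact absurd hxv hsz
      · exact ⟨e, he, hae, hR, hye, hca, .inr (.inl rfl), .inr (.inr rfl)⟩
  · have hcb : C e = b := by
      rcases hc with hc | hc
      · exfalso
        obtain ⟨f, hf, haf, hRf, hxf, hcf, h1, h2⟩ := h.other x hx hxv
        exact huniq f hf haf hRf hxf h1 h2 (hcf.trans hc.symm)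
      · exact hc
    have hyv : side y = side v := by
      revert hside hxv
      cases side x <;> cases side y <;> cases side v <;> simp
    have hyu : y ≠ u := by
      rintro rfl
      exact huv hyv
    refine ⟨hTT _ h.start, ?_, ?_, ?_⟩
    · rw [hends]
      rintro (h1 | rfl | h1)
      · exact h.avoid h1
      · exact h.avoid hx
      · exact hyu h1.symm
    · intro z hz hzv hsz
      rw [hends] at hz
      rcases hz with h1 | rfl | rfl
      · exact lift b z (h.same z h1 hzv hsz)
      · exact absurd hsz hxv
      · exact ⟨e, he, hae, hR, hye, hcb, .inr (.inl rfl), .inr (.inr rfl)⟩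
    · intro z hz hsz
      rw [hends] at hz
      rcases hz with h1 | rfl | rfl
      · exact lift a z (h.other z h1 hsz)
      · exact lift a z (h.other z hx hsz)
      · exact absurd hyv hsz

theorem Reach.init {side : ℕ → Bool} (huv : side u ≠ side v) :
    Reach act U V R C k r a b u v side fun z => z = v :=
  ⟨rfl, fun h => huv (h ▸ rfl), fun _ hx hxv => absurd hx hxv, fun _ hx hs => absurd (hx ▸ rfl) hs⟩

end Kempe

/-! ## The third round, for edge colouring -/

/-- The class of the edge encoded by `w`: edges with equally labelled endpoints form the class
`q`, and the others are classified by the sum of the labels of the endpoints. -/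
def key (lab : ℕ → ℕ) (q n w : ℕ) : ℕ :=
  if lab (src n w) = lab (dst n w) then q else (lab (src n w) + lab (dst n w)) % q

/-- The side of a vertex in the bipartite graph formed by the class `r`. -/
def sideOf (lab : ℕ → ℕ) (q r x : ℕ) : Bool := decide (lab x < (r + q - lab x) % q)

/-- One label and the class number determine the other label of an edge. -/
theorem mod_add_sub_cancel {q x y : ℕ} (hx : x < q) (hy : y < q) :
    ((x + y) % q + q - x) % q = y := by
  rcases lt_or_ge (x + y) q with h | h
  · rw [Nat.mod_eq_of_lt h]
    have : x + y + q - x = y + q := by omega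
    rw [this, Nat.add_mod_right, Nat.mod_eq_of_lt hy]
  · rw [Nat.mod_eq_sub_mod h, Nat.mod_eq_of_lt (by omega : x + y - q < q)]
    have : x + y - q + q - x = y := by omega
    rw [this, Nat.mod_eq_of_lt hy]

/-- Off the last class, the partner label of each end is the label of the other end. The two labels
differ, so exactly one end has a label smaller than its partner. -/
theorem sideOf_ne {lab : ℕ → ℕ} {q n w r : ℕ} (h1 : lab (src n w) < q) (h2 : lab (dst n w) < q)
    (hr : r ≠ q) (hk : key lab q n w = r) :
    sideOf lab q r (src n w) ≠ sideOf lab q r (dst n w) := by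
  unfold key at hk
  split_ifs at hk with h
  · exact absurd hk.symm hr
  · unfold sideOf
    rw [← hk, mod_add_sub_cancel h1 h2, add_comm (lab (src n w)), mod_add_sub_cancel h2 h1]
    rcases lt_or_gt_of_ne h with h | h
    · simp [h, h.le]
    · simp [h, h.le]

/-- What a machine knows after reading the labels. -/
structure Ctx (P : Params) (i : ℕ) (I : List ℕ) (lab : ℕ → ℕ) (σ : Mem) : Prop where
  base : Base P i I σ
  lab : ∀ v < P.n, σ.arr 1 v = lab v

theorem Ctx.of_agree {P : Params} {i : ℕ} {I : List ℕ} {lab : ℕ → ℕ} {σ σ' : Mem} {X A : List ℕ}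
    (h : Ctx P i I lab σ) (hA : Agree X A σ σ') (hX : ∀ x ∈ [0, 3, 4, 5, 8], x ∉ X)
    (h0 : ∀ a ∈ [0, 1], a ∉ A) : Ctx P i I lab σ' where
  base := h.base.of_agree hA hX (h0 0 (by simp))
  lab v hv := (congrFun (hA.arr 1 (h0 1 (by simp))) v).trans (h.lab v hv)

/-- The word at the index stored in variable `x`. -/
def Expr.wordAt (x : ℕ) : Expr := .get 0 (.var x)

/-- The expression language has no conditionals; they are written as sums weighted by the indicators
of the two cases. -/
def Expr.key (w : Expr) : Expr :=
  .add (.mul (.eq (.get 1 w.src) (.get 1 w.dst)) (.var 8))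
    (.mul (.eq (.eq (.get 1 w.src) (.get 1 w.dst)) (.lit 0))
      (.mod (.add (.get 1 w.src) (.get 1 w.dst)) (.var 8)))

/-- Guards only test for being nonzero, so products serve as conjunctions and sums as disjunctions.
-/
theorem Expr.mul_ne (σ : Mem) (e f : Expr) :
    (Expr.mul e f).eval σ ≠ 0 ↔ e.eval σ ≠ 0 ∧ f.eval σ ≠ 0 := mul_ne_zero_iff

theorem Expr.add_ne (σ : Mem) (e f : Expr) :
    (Expr.add e f).eval σ ≠ 0 ↔ e.eval σ ≠ 0 ∨ f.eval σ ≠ 0 := by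
  simp only [Expr.eval]; omega

theorem Expr.eq_ne (σ : Mem) (e f : Expr) :
    (Expr.eq e f).eval σ ≠ 0 ↔ e.eval σ = f.eval σ := by
  simp [Expr.eval]

section CtxLemmas

variable {P : Params} {i : ℕ} {I : List ℕ} {lab : ℕ → ℕ} {σ : Mem} {x : ℕ}

theorem Ctx.eval_wordAt (h : Ctx P i I lab σ) :
    (Expr.wordAt x).eval σ = I.getD (σ.var x) 0 := h.base.inbox _

theorem Ctx.eval_odd (h : Ctx P i I lab σ) :
    (Expr.mod (Expr.wordAt x) (.lit 2)).eval σ ≠ 0 ↔ I.getD (σ.var x) 0 % 2 = 1 := by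
  have : (Expr.mod (Expr.wordAt x) (.lit 2)).eval σ = I.getD (σ.var x) 0 % 2 := by
    rw [← h.eval_wordAt (x := x)]; rfl
  rw [this]
  omega

theorem Ctx.eval_src (h : Ctx P i I lab σ) :
    (Expr.wordAt x).src.eval σ = src P.n (I.getD (σ.var x) 0) := by
  rw [← h.eval_wordAt (x := x), ← h.base.n]; rfl

theorem Ctx.eval_dst (h : Ctx P i I lab σ) :
    (Expr.wordAt x).dst.eval σ = dst P.n (I.getD (σ.var x) 0) := by
  rw [← h.eval_wordAt (x := x), ← h.base.n]; rfl

theorem GoodInbox.getD_lt (hI : GoodInbox P lab I) {k : ℕ} (hk : I.getD k 0 % 2 = 1) :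
    src P.n (I.getD k 0) < dst P.n (I.getD k 0) ∧ dst P.n (I.getD k 0) < P.n := by
  have hlt : k < I.length := by
    by_contra h
    rw [List.getD_eq_default _ _ (not_lt.1 h)] at hk
    omega
  refine hI.src_lt ?_ hk
  rw [List.getD_eq_getElem _ _ hlt]
  exact List.getElem_mem hlt

theorem Ctx.eval_lab (h : Ctx P i I lab σ) (hI : GoodInbox P lab I)
    (hx : I.getD (σ.var x) 0 % 2 = 1) :
    (Expr.get 1 (Expr.wordAt x).src).eval σ = lab (src P.n (I.getD (σ.var x) 0)) ∧
      (Expr.get 1 (Expr.wordAt x).dst).eval σ = lab (dst P.n (I.getD (σ.var x) 0)) := by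
  have := hI.getD_lt hx
  rw [← h.lab _ (this.1.trans this.2), ← h.lab _ this.2, ← h.eval_src, ← h.eval_dst]
  exact ⟨rfl, rfl⟩

theorem Ctx.eval_key (h : Ctx P i I lab σ) (hI : GoodInbox P lab I)
    (hx : I.getD (σ.var x) 0 % 2 = 1) :
    (Expr.wordAt x).key.eval σ = key lab (labelCount P) P.n (I.getD (σ.var x) 0) := by
  obtain ⟨h1, h2⟩ := h.eval_lab hI hx
  have : ∀ e f : Expr, Expr.eval σ (.add (.mul (.eq e f) (.var 8))
    (.mul (.eq (.eq e f) (.lit 0)) (.mod (.add e f) (.var 8)))) =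
      if e.eval σ = f.eval σ then σ.var 8 else (e.eval σ + f.eval σ) % σ.var 8 := by
    intro e f
    by_cases hef : e.eval σ = f.eval σ <;> simp [Expr.eval, hef]
  rw [Expr.key, this, h1, h2, h.base.q, key]

theorem key_le {lab : ℕ → ℕ} {q n w : ℕ} (hq : 1 ≤ q) : key lab q n w ≤ q := by
  unfold key
  split_ifs
  · exact le_rfl
  · exact (Nat.mod_lt _ hq).le

end CtxLemmas

end MapReduce

/-! ### Marking an alternating component and exchanging its two colours. -/

namespace MapReduce

/-- Tests whether the edge with index `var 17` belongs to the class `var 12`, has an endpoint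
`var y` or `var z`, and has the colour `var c`. -/
def Expr.edgeHit (y z c : ℕ) : Expr :=
  .mul (.mod (.wordAt 17) (.lit 2)) <| .mul (.eq (Expr.wordAt 17).key (.var 12)) <|
    .mul (.add (.add (.eq (Expr.wordAt 17).src (.var y)) (.eq (Expr.wordAt 17).dst (.var y)))
      (.add (.eq (Expr.wordAt 17).src (.var z)) (.eq (Expr.wordAt 17).dst (.var z))))
    (.eq (.get 2 (.var 17)) (.var c))

/-- Tests whether the edge with index `var 17` belongs to the class `var 12`, has colour `var 15`
or `var 16`, and has exactly one marked endpoint. -/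
def Expr.edgeLeaves : Expr :=
  .mul (.mod (.wordAt 17) (.lit 2)) <| .mul (.eq (Expr.wordAt 17).key (.var 12)) <|
    .mul (.add (.eq (.get 2 (.var 17)) (.var 15)) (.eq (.get 2 (.var 17)) (.var 16)))
    (.eq (.eq (.get 3 (Expr.wordAt 17).src) (.lit 0))
      (.eq (.eq (.get 3 (Expr.wordAt 17).dst) (.lit 0)) (.lit 0)))

def Cmd.clearMarks : Cmd := .forTo 17 (.var 0) (.put 3 (.var 17) (.lit 0))

/-- Marks the vertices reachable from the vertex `var 11` along edges of class `var 12` with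
colours `var 15` and `var 16`. -/
def Cmd.markComponent : Cmd :=
  .seq (.put 3 (.var 11) (.lit 1)) <| .seq (.set 17 (.lit 0)) <| .loop (.lt (.var 17) (.var 9)) <|
    .ite .edgeLeaves
      (.seq (.put 3 (Expr.wordAt 17).src (.lit 1)) <|
        .seq (.put 3 (Expr.wordAt 17).dst (.lit 1)) (.set 17 (.lit 0)))
      (.set 17 (.add (.var 17) (.lit 1)))

/-- Exchanges the colours `var 15` and `var 16` on the marked edges of class `var 12`. -/
def Cmd.swapColours : Cmd :=
  .forTo 17 (.var 9) <|
    .ite (.mul (.mod (.wordAt 17) (.lit 2)) <| .mul (.eq (Expr.wordAt 17).key (.var 12))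
        (.get 3 (Expr.wordAt 17).src))
      (.ite (.eq (.get 2 (.var 17)) (.var 15)) (.put 2 (.var 17) (.var 16))
        (.ite (.eq (.get 2 (.var 17)) (.var 16)) (.put 2 (.var 17) (.var 15)) .skip))
      .skip

/-- The variable `x` if the class `var 12` is the last one, and the variable `y` otherwise. -/
def Expr.ifSame (x y : ℕ) : Expr :=
  .add (.mul (.eq (.var 12) (.var 8)) (.var x))
    (.mul (.eq (.eq (.var 12) (.var 8)) (.lit 0)) (.var y))

/-- Colours the edge with index `var 9`. -/
def Cmd.colourEdge : Cmd :=
  .seq (.set 10 (Expr.wordAt 9).src) <| .seq (.set 11 (Expr.wordAt 9).dst) <|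
  .seq (.set 12 (Expr.wordAt 9).key) <|
  .seq (.set 13 (.ifSame 11 10)) <| .seq (.set 14 (.ifSame 10 11)) <|
  .seq (.mex 15 17 (.var 9) (.edgeHit 10 13 15)) <|
  .seq (.mex 16 17 (.var 9) (.edgeHit 11 14 16)) <|
  .seq .clearMarks <| .seq .markComponent <| .seq .swapColours <|
  .put 2 (.var 9) (.var 15)

def IsEdgeIndex (I : List ℕ) (k : ℕ) : Prop := I.getD k 0 % 2 = 1

/-- The class of the edge with index `k`. -/
def keyAt (P : Params) (lab : ℕ → ℕ) (I : List ℕ) (k : ℕ) : ℕ :=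
  key lab (labelCount P) P.n (I.getD k 0)

def srcAt (P : Params) (I : List ℕ) (k : ℕ) : ℕ := src P.n (I.getD k 0)
def dstAt (P : Params) (I : List ℕ) (k : ℕ) : ℕ := dst P.n (I.getD k 0)

section
variable {P : Params} {S W : ℕ} {ρ : Tape} {i : ℕ} {I : List ℕ} {lab : ℕ → ℕ} {σ : Mem} {k : ℕ}

theorem GoodInbox.srcAt_lt (hI : GoodInbox P lab I) (hk : IsEdgeIndex I k) : srcAt P I k < P.n :=
  (hI.getD_lt hk).1.trans (hI.getD_lt hk).2

theorem GoodInbox.dstAt_lt (hI : GoodInbox P lab I) (hk : IsEdgeIndex I k) : dstAt P I k < P.n :=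
  (hI.getD_lt hk).2

theorem Ctx.eval_edgeHit (h : Ctx P i I lab σ) (hI : GoodInbox P lab I) (y z c : ℕ) :
    (Expr.edgeHit y z c).eval σ ≠ 0 ↔ (IsEdgeIndex I (σ.var 17) ∧
      keyAt P lab I (σ.var 17) = σ.var 12 ∧
      (IsEnd (srcAt P I) (dstAt P I) (σ.var y) (σ.var 17) ∨
        IsEnd (srcAt P I) (dstAt P I) (σ.var z) (σ.var 17))) ∧
      σ.arr 2 (σ.var 17) = σ.var c := by
  unfold Expr.edgeHit
  rw [Expr.mul_ne, h.eval_odd, Expr.mul_ne, Expr.eq_ne, Expr.mul_ne, Expr.add_ne, Expr.add_ne,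
    Expr.add_ne, Expr.eq_ne, Expr.eq_ne, Expr.eq_ne, Expr.eq_ne, Expr.eq_ne, h.eval_src, h.eval_dst]
  by_cases hodd : IsEdgeIndex I (σ.var 17)
  · rw [h.eval_key hI hodd]
    simp only [Expr.eval, IsEnd, keyAt, srcAt, dstAt, IsEdgeIndex]
    tauto
  · have : ¬ I.getD (σ.var 17) 0 % 2 = 1 := hodd
    tauto

/-- A vertex is marked in array `3`. -/
def Marked (P : Params) (σ : Mem) (z : ℕ) : Prop := z < P.n ∧ σ.arr 3 z ≠ 0

/-- The number of vertices that are not marked. -/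
def unmarked (P : Params) (σ : Mem) : ℕ :=
  ((Finset.range P.n).filter fun x => σ.arr 3 x = 0).card

theorem unmarked_le (P : Params) (σ : Mem) : unmarked P σ ≤ P.n :=
  (Finset.card_filter_le _ _).trans (by simp)

theorem unmarked_lt {P : Params} {σ σ' : Mem} {x : ℕ} (h : ∀ z, Marked P σ z → Marked P σ' z)
    (hn : x < P.n) (hx : ¬ Marked P σ x) (hx' : Marked P σ' x) : unmarked P σ' < unmarked P σ := by
  refine Finset.card_lt_card ⟨fun z hz => ?_, fun hsub => ?_⟩
  · simp only [Finset.mem_filter, Finset.mem_range] at hz ⊢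
    refine ⟨hz.1, ?_⟩
    by_contra hc
    exact (h z ⟨hz.1, hc⟩).2 hz.2
  · have h0 : σ.arr 3 x = 0 := by
      by_contra hc
      exact hx ⟨hn, hc⟩
    exact hx'.2 (Finset.mem_filter.1 (hsub (Finset.mem_filter.2 ⟨Finset.mem_range.2 hn, h0⟩))).2

theorem Ctx.eval_edgeLeaves (h : Ctx P i I lab σ) (hI : GoodInbox P lab I) :
    Expr.edgeLeaves.eval σ ≠ 0 ↔ IsEdgeIndex I (σ.var 17) ∧
      keyAt P lab I (σ.var 17) = σ.var 12 ∧
      (σ.arr 2 (σ.var 17) = σ.var 15 ∨ σ.arr 2 (σ.var 17) = σ.var 16) ∧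
      (Marked P σ (srcAt P I (σ.var 17)) ↔ ¬ Marked P σ (dstAt P I (σ.var 17))) := by
  unfold Expr.edgeLeaves
  rw [Expr.mul_ne, h.eval_odd, Expr.mul_ne, Expr.eq_ne, Expr.mul_ne, Expr.add_ne, Expr.eq_ne,
    Expr.eq_ne, Expr.eq_ne]
  by_cases hodd : IsEdgeIndex I (σ.var 17)
  · rw [h.eval_key hI hodd]
    have h1 : Expr.eval σ (.get 3 (Expr.wordAt 17).src) = σ.arr 3 (srcAt P I (σ.var 17)) :=
      congrArg (σ.arr 3) h.eval_src
    have h2 : Expr.eval σ (.get 3 (Expr.wordAt 17).dst) = σ.arr 3 (dstAt P I (σ.var 17)) :=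
      congrArg (σ.arr 3) h.eval_dst
    have h3 : Expr.eval σ (.eq (.get 3 (Expr.wordAt 17).src) (.lit 0)) =
        Expr.eval σ (.eq (.eq (.get 3 (Expr.wordAt 17).dst) (.lit 0)) (.lit 0)) ↔
        (Marked P σ (srcAt P I (σ.var 17)) ↔ ¬ Marked P σ (dstAt P I (σ.var 17))) := by
      simp only [Marked, hI.srcAt_lt hodd, hI.dstAt_lt hodd, true_and]
      have h4 : ∀ e f : Expr, Expr.eval σ (.eq e (.lit 0)) = Expr.eval σ (.eq (.eq f (.lit 0)) (.lit 0)) ↔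
          (e.eval σ ≠ 0 ↔ ¬ f.eval σ ≠ 0) := by
        intro e f
        by_cases e1 : e.eval σ = 0 <;> by_cases e2 : f.eval σ = 0 <;> simp [e1, e2, Expr.eval]
      rw [h4, h1, h2]
    rw [h3]
    rfl
  · have : ¬ I.getD (σ.var 17) 0 % 2 = 1 := hodd
    tauto

theorem Total.clearMarks (hR : Roomy P S W) (hc : Ctx P i I lab σ) :
    Total S W ρ .clearMarks (3 * P.n + 2) σ fun σ' =>
      Agree [17] [3] σ σ' ∧ σ'.out = σ.out ∧ ∀ x < P.n, σ'.arr 3 x = 0 := by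
  refine Total.le_time (T := P.n * (1 + 2) + 2) ?_ (by omega)
  refine Total.forTo P.n (fun k σ' => Agree [17] [3] σ σ' ∧ σ'.out = σ.out ∧
    ∀ x < k, σ'.arr 3 x = 0) ?_ ?_ ?_ ?_ ?_
  · have := hR.two_mul_le
    omega
  · exact ⟨(Agree.refl _ _ _).setVar (by simp), rfl, by simp⟩
  · rintro k σ' ⟨hA, -⟩
    exact (hc.of_agree hA (by simp) (by simp)).base.n
  · rintro k hk σ' ⟨hA, ho, h3⟩ hx
    refine Total.put ?_ (Nat.zero_le _) ⟨by simpa using hx, (hA.setCell (by simp)).setVar (by simp),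
      by simpa using ho, ?_⟩
    · simp only [Expr.eval, hx]
      exact hk.trans_le hR.n_le
    · intro x hxk
      rcases Nat.lt_succ_iff_lt_or_eq.1 hxk with h | rfl
      · simp [Expr.eval, Function.update_apply, h3 x h]
      · simp [Expr.eval, hx]
  · rintro σ' h
    exact h

open Classical in
-- Flooding: whenever an edge with exactly one marked end is found, both its ends are marked and the
-- scan restarts; a complete scan certifies that the marked set is closed. The predicate `Pm` is any
-- property that survives such an enlargement; it is later used to carry the parity invariant
-- `Reach` through the loop.
theorem Total.markComponent (hR : Roomy P S W) (hc : Ctx P i I lab σ) (hI : GoodInbox P lab I)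
    (hlen : I.length ≤ S) (hkI : k ≤ I.length) (h9 : σ.var 9 = k) (h11 : σ.var 11 < P.n)
    (h3 : ∀ x < P.n, σ.arr 3 x = 0) (Pm : (ℕ → Prop) → Prop) (hP : Pm fun z => z = σ.var 11)
    (hstep : ∀ (T : ℕ → Prop), ∀ e < k, IsEdgeIndex I e → keyAt P lab I e = σ.var 12 →
      (σ.arr 2 e = σ.var 15 ∨ σ.arr 2 e = σ.var 16) → (T (srcAt P I e) ↔ ¬ T (dstAt P I e)) → Pm T →
      Pm fun z => T z ∨ z = srcAt P I e ∨ z = dstAt P I e) :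
    Total S W ρ .markComponent (5 * (P.n * (k + 1) + k) + 3) σ fun σ' =>
      Agree [17] [3] σ σ' ∧ σ'.out = σ.out ∧ Marked P σ' (σ.var 11) ∧ Pm (Marked P σ') ∧
      ∀ e < k, IsEdgeIndex I e → keyAt P lab I e = σ.var 12 →
        (σ.arr 2 e = σ.var 15 ∨ σ.arr 2 e = σ.var 16) →
        (Marked P σ' (srcAt P I e) ↔ Marked P σ' (dstAt P I e)) := by
  have hW1 : 1 ≤ W := by
    have := hR.two_mul_le
    have := hR.n_pos
    omega
  have hSW := hR.S_le
  have hnS := hR.n_le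
  refine Total.le_time (T := 1 + (1 + ((P.n * (k + 1) + k) * ((1 + (1 + 1) + 1) + 1) + 1))) ?_
    (by ring_nf; omega)
  refine Total.seq (Total.put (by simp only [Expr.eval]; omega) (by simpa [Expr.eval] using hW1) ?_)
  refine Total.seq (Total.set (Nat.zero_le _) ?_)
  refine Total.loop (fun σ' => Agree [17] [3] σ σ' ∧ σ'.out = σ.out ∧ Marked P σ' (σ.var 11) ∧
    Pm (Marked P σ') ∧ σ'.var 17 ≤ k ∧ ∀ e < σ'.var 17, IsEdgeIndex I e →
      keyAt P lab I e = σ.var 12 → (σ.arr 2 e = σ.var 15 ∨ σ.arr 2 e = σ.var 16) →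
      (Marked P σ' (srcAt P I e) ↔ Marked P σ' (dstAt P I e)))
    -- Lexicographic again: a new mark gains `k + 1`, which outweighs the restart of the scan.
    (fun σ' => unmarked P σ' * (k + 1) + (k - σ'.var 17)) ?_ ?_ ?_ ?_
  · rintro σ' ⟨hA, ho, hv, hPm, h17, hcl⟩ hg
    have hc' : Ctx P i I lab σ' := hc.of_agree hA (by simp) (by simp)
    have hlt : σ'.var 17 < k := by
      by_contra h
      simp [Expr.eval, hA.var 9 (by simp), h9, h] at hg
    have hiff := hc'.eval_edgeLeaves hI
    rw [hA.var 12 (by simp), hA.var 15 (by simp), hA.var 16 (by simp), hA.arr 2 (by simp)] at hiff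
    refine Total.ite (fun hh => ?_) (fun hh => ?_)
    · obtain ⟨hodd, hkey, hcol, hT⟩ := hiff.1 hh
      have hs : (Expr.wordAt 17).src.eval σ' = srcAt P I (σ'.var 17) := hc'.eval_src
      have hs' := hI.srcAt_lt hodd
      have hd' := hI.dstAt_lt hodd
      have hPs := hstep _ _ hlt hodd hkey hcol hT hPm
      set x := srcAt P I (σ'.var 17) with hx
      set y := dstAt P I (σ'.var 17) with hy
      refine Total.seq (T := 1) (T' := 1 + 1) (Total.put (by rw [hs]; omega)
        (by simpa [Expr.eval] using hW1) ?_)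
      have hA₁ : Agree [17] [3] σ (σ'.setCell 3 ((Expr.wordAt 17).src.eval σ')
        (Expr.eval σ' (.lit 1))) := hA.setCell (by simp)
      have hd : (Expr.wordAt 17).dst.eval (σ'.setCell 3 ((Expr.wordAt 17).src.eval σ')
        (Expr.eval σ' (.lit 1))) = y :=
        (hc.of_agree hA₁ (by simp) (by simp) : Ctx P i I lab _).eval_dst
      rw [hs] at hd hA₁ ⊢
      refine Total.seq (T := 1) (T' := 1) (Total.put (by rw [hd]; omega)
        (by simpa [Expr.eval] using hW1) (Total.set (Nat.zero_le _) ?_))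
      rw [hd]
      have hM : ∀ z, Marked P (((σ'.setCell 3 x 1).setCell 3 y 1).setVar 17 0) z ↔
          Marked P σ' z ∨ z = x ∨ z = y := by
        intro z
        simp only [Marked, Mem.setVar_arr, Mem.setCell_arr, if_true, Function.update_apply]
        by_cases e1 : z = y
        · simp [e1, hd']
        · by_cases e2 : z = x
          · simp [e2, hs']
          · simp [e1, e2]
      refine ⟨⟨(hA₁.setCell (by simp)).setVar (by simp), by simpa using ho, (hM _).2 (.inl hv), ?_,
        by simp [Expr.eval], by simp [Expr.eval]⟩, ?_⟩
      · have : Marked P (((σ'.setCell 3 x 1).setCell 3 y 1).setVar 17 0) =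
          fun z => Marked P σ' z ∨ z = x ∨ z = y := funext fun z => propext (hM z)
        exact this ▸ hPs
      · have hlt' : unmarked P (((σ'.setCell 3 x 1).setCell 3 y 1).setVar 17 0) < unmarked P σ' := by
          by_cases hmx : Marked P σ' x
          · exact unmarked_lt (fun z hz => (hM z).2 (.inl hz)) hd' (hT.1 hmx)
              ((hM y).2 (.inr (.inr rfl)))
          · exact unmarked_lt (fun z hz => (hM z).2 (.inl hz)) hs' hmx ((hM x).2 (.inr (.inl rfl)))
        have h17' : Mem.var (((σ'.setCell 3 x 1).setCell 3 y 1).setVar 17 0) 17 = 0 := by simp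
        simp only [Expr.eval]
        rw [h17']
        have := Nat.mul_le_mul_right (k + 1) hlt'
        rw [Nat.succ_eq_add_one, Nat.add_mul] at this
        omega
    · have hh' := fun h => (not_iff_not.2 hiff).1 (not_not.2 hh) h
      have heW : Expr.eval σ' (.add (.var 17) (.lit 1)) ≤ W := by
        simp only [Expr.eval]
        omega
      refine Total.le_time (T := 1) (Total.set heW ?_) (by norm_num)
      refine ⟨⟨hA.setVar (by simp), by simpa using ho, hv, hPm, by simpa [Expr.eval] using hlt, ?_⟩,
        ?_⟩
      · intro e he hodd hkey hcol
        simp only [Expr.eval, Mem.setVar_var, if_true] at he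
        rcases Nat.lt_succ_iff_lt_or_eq.1 he with h | rfl
        · exact hcl e h hodd hkey hcol
        · by_contra hne
          refine hh' ⟨hodd, hkey, hcol, ?_⟩
          have : ∀ p q : Prop, ¬ (p ↔ q) → (p ↔ ¬ q) := fun p q => by tauto
          exact this _ _ hne
      · have h17' : ∀ w, unmarked P (σ'.setVar 17 w) = unmarked P σ' := fun _ => rfl
        simp only [Expr.eval, Mem.setVar_var, h17', if_true]
        omega
  · rintro σ' ⟨hA, ho, hv, hPm, h17, hcl⟩ hg
    have : σ'.var 17 = k := by
      by_contra h
      have : σ'.var 17 < k := by omega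
      simp [Expr.eval, hA.var 9 (by simp), h9, this] at hg
    exact ⟨hA, ho, hv, hPm, this ▸ hcl⟩
  · have hM : Marked P ((σ.setCell 3 (Expr.eval σ (.var 11)) (Expr.eval σ (.lit 1))).setVar 17
        (Expr.eval (σ.setCell 3 (Expr.eval σ (.var 11)) (Expr.eval σ (.lit 1))) (.lit 0))) =
        fun z => z = σ.var 11 := by
      funext z
      refine propext ?_
      simp only [Marked, Mem.setVar_arr, Mem.setCell_arr, if_true, Function.update_apply, Expr.eval]
      by_cases e : z = σ.var 11
      · simp [e, h11]
      · simp only [e, if_false, iff_false, not_and, not_not]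
        exact h3 z
    refine ⟨((Agree.refl _ _ _).setCell (by simp)).setVar (by simp), rfl, ?_, ?_, ?_, ?_⟩
    · rw [hM]
    · rw [hM]
      exact hP
    · simp [Expr.eval]
    · simp [Expr.eval]
  · refine Nat.add_le_add (Nat.mul_le_mul_right _ (unmarked_le _ _)) (Nat.sub_le _ _)

open Classical in
theorem Total.swapColours (hR : Roomy P S W) (hc : Ctx P i I lab σ) (hI : GoodInbox P lab I)
    (hlen : I.length ≤ S) (hkI : k ≤ I.length) (h9 : σ.var 9 = k) (h15 : σ.var 15 ≤ W)
    (h16 : σ.var 16 ≤ W) :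
    Total S W ρ .swapColours (6 * k + 2) σ fun σ' =>
      Agree [17] [2] σ σ' ∧ σ'.out = σ.out ∧ ∀ e < k, σ'.arr 2 e =
        if IsEdgeIndex I e ∧ keyAt P lab I e = σ.var 12 ∧ Marked P σ (srcAt P I e) then
          Equiv.swap (σ.var 15) (σ.var 16) (σ.arr 2 e) else σ.arr 2 e := by
  have hSW := hR.S_le
  refine Total.le_time (T := k * ((1 + 1 + 1 + 1) + 2) + 2) ?_ (by ring_nf; omega)
  -- All indices occur here, not only those below `j`, so that the entry about to be read is known
  -- to have its old colour.
  refine Total.forTo k (fun j σ' => Agree [17] [2] σ σ' ∧ σ'.out = σ.out ∧ ∀ e, σ'.arr 2 e =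
    if e < j ∧ IsEdgeIndex I e ∧ keyAt P lab I e = σ.var 12 ∧ Marked P σ (srcAt P I e) then
      Equiv.swap (σ.var 15) (σ.var 16) (σ.arr 2 e) else σ.arr 2 e) (by omega) ?_ ?_ ?_ ?_
  · exact ⟨(Agree.refl _ _ _).setVar (by simp), rfl, by simp⟩
  · rintro j σ' ⟨hA, -⟩
    exact (hA.var 9 (by simp)).trans h9
  · rintro j hj σ' ⟨hA, ho, h2⟩ hx
    have hc' : Ctx P i I lab σ' := hc.of_agree hA (by simp) (by simp)
    have e15 : Expr.eval σ' (.var 15) = σ.var 15 := hA.var 15 (by simp)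
    have e16 : Expr.eval σ' (.var 16) = σ.var 16 := hA.var 16 (by simp)
    have e17 : Expr.eval σ' (.var 17) = j := hx
    have eC : Expr.eval σ' (.get 2 (.var 17)) = σ.arr 2 j := by
      have : Expr.eval σ' (.get 2 (.var 17)) = σ'.arr 2 (σ'.var 17) := rfl
      rw [this, hx, h2]
      simp
    have hcond : Expr.eval σ' (.mul (.mod (.wordAt 17) (.lit 2)) <|
        .mul (.eq (Expr.wordAt 17).key (.var 12)) (.get 3 (Expr.wordAt 17).src)) ≠ 0 ↔
        IsEdgeIndex I j ∧ keyAt P lab I j = σ.var 12 ∧ Marked P σ (srcAt P I j) := by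
      rw [Expr.mul_ne, hc'.eval_odd, Expr.mul_ne, Expr.eq_ne, hx]
      by_cases hodd : IsEdgeIndex I j
      · rw [hc'.eval_key hI (by rw [hx]; exact hodd), hx]
        have e3 : Expr.eval σ' (.get 3 (Expr.wordAt 17).src) = σ.arr 3 (srcAt P I j) := by
          rw [← hA.arr 3 (by simp), ← hx]
          exact congrArg (σ'.arr 3) hc'.eval_src
        have e12 : Expr.eval σ' (.var 12) = σ.var 12 := hA.var 12 (by simp)
        rw [e3, e12, Marked]
        simp only [hI.srcAt_lt hodd, true_and]
        rfl
      · have : ¬ I.getD j 0 % 2 = 1 := hodd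
        tauto
    have hnew : ∀ e, (e < j + 1 ∧ IsEdgeIndex I e ∧ keyAt P lab I e = σ.var 12 ∧
        Marked P σ (srcAt P I e)) ↔ (e < j ∧ IsEdgeIndex I e ∧ keyAt P lab I e = σ.var 12 ∧
        Marked P σ (srcAt P I e)) ∨ (e = j ∧ IsEdgeIndex I j ∧ keyAt P lab I j = σ.var 12 ∧
        Marked P σ (srcAt P I j)) := by
      intro e
      constructor
      · rintro ⟨h, h'⟩
        rcases Nat.lt_succ_iff_lt_or_eq.1 h with h | rfl
        · exact .inl ⟨h, h'⟩
        · exact .inr ⟨rfl, h'⟩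
      · rintro (⟨h, h'⟩ | ⟨rfl, h'⟩)
        · exact ⟨h.trans (Nat.lt_succ_self _), h'⟩
        · exact ⟨Nat.lt_succ_self _, h'⟩
    have hput : ∀ w, (IsEdgeIndex I j ∧ keyAt P lab I j = σ.var 12 ∧ Marked P σ (srcAt P I j)) →
        w = Equiv.swap (σ.var 15) (σ.var 16) (σ.arr 2 j) →
        ∀ e, ((σ'.setCell 2 j w).setVar 17 (j + 1)).arr 2 e =
          if e < j + 1 ∧ IsEdgeIndex I e ∧ keyAt P lab I e = σ.var 12 ∧ Marked P σ (srcAt P I e) then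
            Equiv.swap (σ.var 15) (σ.var 16) (σ.arr 2 e) else σ.arr 2 e := by
      intro w hg hw e
      simp only [Mem.setVar_arr, Mem.setCell_arr, if_true, Function.update_apply]
      by_cases he : e = j
      · rw [if_pos he, he, if_pos ⟨Nat.lt_succ_self _, hg⟩, hw]
      · rw [if_neg he, h2 e]
        simp only [hnew e, he, false_and, or_false]
    have hkeep : (IsEdgeIndex I j ∧ keyAt P lab I j = σ.var 12 ∧ Marked P σ (srcAt P I j) →
        Equiv.swap (σ.var 15) (σ.var 16) (σ.arr 2 j) = σ.arr 2 j) →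
        ∀ e, (σ'.setVar 17 (j + 1)).arr 2 e =
          if e < j + 1 ∧ IsEdgeIndex I e ∧ keyAt P lab I e = σ.var 12 ∧ Marked P σ (srcAt P I e) then
            Equiv.swap (σ.var 15) (σ.var 16) (σ.arr 2 e) else σ.arr 2 e := by
      intro hg e
      rw [Mem.setVar_arr, h2 e]
      by_cases he : e = j
      · subst he
        rw [if_neg (by simp)]
        split_ifs with h
        · exact (hg h.2).symm
        · rfl
      · simp only [hnew e, he, false_and, or_false]
    have hjS : Expr.eval σ' (.var 17) < S := by rw [e17]; omega
    refine Total.ite (fun hg => Total.ite (fun hg1 => ?_) (fun hg1 => Total.ite (fun hg2 => ?_)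
      (fun hg2 => Total.skip ?_))) (fun hg => ?_)
    · refine Total.le_time (T := 1) (Total.put hjS (e16 ▸ h16) ?_) (by norm_num)
      rw [e17, e16]
      refine ⟨by simpa using hx, (hA.setCell (by simp)).setVar (by simp), by simpa using ho,
        hput _ (hcond.1 hg) ?_⟩
      rw [Expr.eq_ne, eC, e15] at hg1
      rw [hg1, Equiv.swap_apply_left]
    · refine Total.put hjS (e15 ▸ h15) ?_
      rw [e17, e15]
      refine ⟨by simpa using hx, (hA.setCell (by simp)).setVar (by simp), by simpa using ho,
        hput _ (hcond.1 hg) ?_⟩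
      rw [Expr.eq_ne, eC, e16] at hg2
      rw [hg2, Equiv.swap_apply_right]
    · refine ⟨hx, hA.setVar (by simp), ho, hkeep fun _ => ?_⟩
      have h1 := (not_iff_not.2 (Expr.eq_ne σ' _ _)).1 (not_not.2 hg1)
      have h2 := (not_iff_not.2 (Expr.eq_ne σ' _ _)).1 (not_not.2 hg2)
      rw [eC, e15] at h1
      rw [eC, e16] at h2
      exact Equiv.swap_apply_of_ne_of_ne h1 h2
    · refine Total.le_time (T := 1) (Total.skip ?_) (by norm_num)
      refine ⟨hx, hA.setVar (by simp), ho, hkeep fun h => ?_⟩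
      exact absurd hg (hcond.2 h)
  · rintro σ' ⟨hA, ho, h2⟩
    refine ⟨hA, ho, fun e he => ?_⟩
    rw [h2 e]
    simp [he]

end

end MapReduce

/-! ### Colouring one more edge within the colour bounds. -/

namespace MapReduce

section
variable {P : Params} {S W : ℕ} {ρ : Tape} {i : ℕ} {I : List ℕ} {lab : ℕ → ℕ} {σ : Mem} {k D : ℕ}

/-- The colours below `k` are at most `D`, and at most `2 * D` in the last class. -/
def Bounded (P : Params) (lab : ℕ → ℕ) (I : List ℕ) (D : ℕ) (C : ℕ → ℕ) (k : ℕ) : Prop :=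
  ∀ e < k, IsEdgeIndex I e → C e ≤ if keyAt P lab I e = labelCount P then 2 * D else D

open Classical in
/-- Every vertex has at most `D` edges in each class. -/
def ClassDegreeLe (P : Params) (lab : ℕ → ℕ) (I : List ℕ) (D : ℕ) : Prop :=
  ∀ x < P.n, ∀ r, ((Finset.range I.length).filter fun e => IsEdgeIndex I e ∧ keyAt P lab I e = r ∧
    IsEnd (srcAt P I) (dstAt P I) x e).card ≤ D

/-- Each colour below `a` is used by an edge of the class at `x` or at `y`. Distinct vertices are
needed for the greedy bound `2 * D` in the last class, and `x = y` for the bound `D` in the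
bipartite classes. -/
theorem ClassDegreeLe.le (h : ClassDegreeLe P lab I D) {x y r a : ℕ} {C : ℕ → ℕ} (hx : x < P.n)
    (hy : y < P.n) (hk : k ≤ I.length)
    (ha : ∀ α < a, ∃ e < k, (IsEdgeIndex I e ∧ keyAt P lab I e = r ∧
      (IsEnd (srcAt P I) (dstAt P I) x e ∨ IsEnd (srcAt P I) (dstAt P I) y e)) ∧ C e = α) :
    a ≤ 2 * D ∧ (x = y → a ≤ D) := by
  classical
  have h1 := le_card_of_forall_hit ha
  set Fx := (Finset.range I.length).filter fun e => IsEdgeIndex I e ∧ keyAt P lab I e = r ∧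
    IsEnd (srcAt P I) (dstAt P I) x e
  set Fy := (Finset.range I.length).filter fun e => IsEdgeIndex I e ∧ keyAt P lab I e = r ∧
    IsEnd (srcAt P I) (dstAt P I) y e
  have hFx : Fx.card ≤ D := by convert h x hx r
  have hFy : Fy.card ≤ D := by convert h y hy r
  have hsub : (Finset.range k).filter (fun e => IsEdgeIndex I e ∧ keyAt P lab I e = r ∧
      (IsEnd (srcAt P I) (dstAt P I) x e ∨ IsEnd (srcAt P I) (dstAt P I) y e)) ⊆ Fx ∪ Fy := by
    intro e he
    simp only [Finset.mem_filter, Finset.mem_range] at he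
    simp only [Fx, Fy, Finset.mem_union, Finset.mem_filter, Finset.mem_range]
    have := he.1.trans_le hk
    tauto
  have h2 : a ≤ (Fx ∪ Fy).card := by
    refine h1.trans ((le_of_eq ?_).trans (Finset.card_le_card hsub))
    congr
  refine ⟨h2.trans ((Finset.card_union_le _ _).trans (by omega)), ?_⟩
  rintro rfl
  rw [show Fx ∪ Fy = Fx from Finset.union_self _] at h2
  exact h2.trans hFx

theorem eval_ifSame (h : Base P i I σ) (x y : ℕ) : (Expr.ifSame x y).eval σ =
    if σ.var 12 = labelCount P then σ.var x else σ.var y := by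
  simp only [Expr.ifSame, Expr.eval, h.q]
  by_cases e : σ.var 12 = labelCount P <;> simp [e]

/-- One program serves both kinds of classes. In a bipartite class `a` is the least colour missing
at `u` and `b` the least one missing at `v`, and the exchange in the component of `v` frees `a` at
both ends. In the last class both searches look at both ends, hence `a = b` and the exchange changes
nothing. -/
theorem Total.colourEdge (hR : Roomy P S W) (hc : Ctx P i I lab σ) (hI : GoodInbox P lab I)
    (hlen : I.length ≤ S) (hk : k < I.length) (hodd : IsEdgeIndex I k) (h9 : σ.var 9 = k)
    (hD : ClassDegreeLe P lab I D)
    (hp : Proper (IsEdgeIndex I) (srcAt P I) (dstAt P I) (keyAt P lab I) (σ.arr 2) k)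
    (hC : Bounded P lab I D (σ.arr 2) k) :
    Total S W ρ .colourEdge (100 * (P.n + I.length + 2) ^ 2) σ fun σ' =>
      Agree [10, 11, 12, 13, 14, 15, 16, 17] [2, 3] σ σ' ∧ σ'.out = σ.out ∧
      Proper (IsEdgeIndex I) (srcAt P I) (dstAt P I) (keyAt P lab I) (σ'.arr 2) (k + 1) ∧
      Bounded P lab I D (σ'.arr 2) (k + 1) := by
  have hSW := hR.S_le
  have hnS := hR.n_le
  have hq1 := hR.labelCount_pos
  have hqW := hR.labelCount_le
  have hkW : k ≤ W := by omega
  set r := keyAt P lab I k with hr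
  set u := srcAt P I k with hu
  set v := dstAt P I k with hv
  have hun : u < P.n := hI.srcAt_lt hodd
  have hvn : v < P.n := hI.dstAt_lt hodd
  have hrq : r ≤ labelCount P := key_le hq1
  refine Total.le_time (T := 1 + (1 + (1 + (1 + (1 + (4 * (k + 2) ^ 2 + (4 * (k + 2) ^ 2 +
    ((3 * P.n + 2) + ((5 * (P.n * (k + 1) + k) + 3) + ((6 * k + 2) + 1)))))))))) ?_ ?_
  swap
  · obtain ⟨d, hd⟩ : ∃ d, I.length = k + 1 + d := ⟨I.length - (k + 1), by omega⟩
    rw [hd]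
    ring_nf
    nlinarith [Nat.zero_le (d * k), Nat.zero_le (d * P.n), Nat.zero_le (k * P.n),
      Nat.zero_le (d * d), Nat.zero_le (P.n * P.n)]
  -- the two endpoints and the class
  have e1 : (Expr.wordAt 9).src.eval σ = u := by rw [hc.eval_src, h9, hu, srcAt]
  refine Total.seq (Total.set (by rw [e1]; omega) ?_)
  rw [e1]
  set σ₁ := σ.setVar 10 u with hσ₁
  have hA₁ : Agree [10, 11, 12, 13, 14] [] σ σ₁ := (Agree.refl _ _ _).setVar (by simp)
  have hc₁ : Ctx P i I lab σ₁ := hc.of_agree hA₁ (by simp) (by simp)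
  have e2 : (Expr.wordAt 9).dst.eval σ₁ = v := by rw [hc₁.eval_dst, hA₁.var 9 (by simp), h9, hv, dstAt]
  refine Total.seq (Total.set (by rw [e2]; omega) ?_)
  rw [e2]
  set σ₂ := σ₁.setVar 11 v with hσ₂
  have hA₂ : Agree [10, 11, 12, 13, 14] [] σ σ₂ := hA₁.setVar (by simp)
  have hc₂ : Ctx P i I lab σ₂ := hc.of_agree hA₂ (by simp) (by simp)
  have e3 : (Expr.wordAt 9).key.eval σ₂ = r := by
    rw [hc₂.eval_key hI (by rw [hA₂.var 9 (by simp), h9]; exact hodd), hA₂.var 9 (by simp), h9]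
    rfl
  refine Total.seq (Total.set (by rw [e3]; omega) ?_)
  rw [e3]
  set σ₃ := σ₂.setVar 12 r with hσ₃
  have hA₃ : Agree [10, 11, 12, 13, 14] [] σ σ₃ := hA₂.setVar (by simp)
  have hc₃ : Ctx P i I lab σ₃ := hc.of_agree hA₃ (by simp) (by simp)
  have e4 : (Expr.ifSame 11 10).eval σ₃ = if r = labelCount P then v else u := by
    rw [eval_ifSame hc₃.base]; simp [hσ₃, hσ₂, hσ₁]
  refine Total.seq (Total.set (by rw [e4]; split_ifs <;> omega) ?_)
  rw [e4]
  set σ₄ := σ₃.setVar 13 (if r = labelCount P then v else u) with hσ₄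
  have hA₄ : Agree [10, 11, 12, 13, 14] [] σ σ₄ := hA₃.setVar (by simp)
  have hc₄ : Ctx P i I lab σ₄ := hc.of_agree hA₄ (by simp) (by simp)
  have e5 : (Expr.ifSame 10 11).eval σ₄ = if r = labelCount P then u else v := by
    rw [eval_ifSame hc₄.base]; simp [hσ₄, hσ₃, hσ₂, hσ₁]
  refine Total.seq (Total.set (by rw [e5]; split_ifs <;> omega) ?_)
  rw [e5]
  set σ₅ := σ₄.setVar 14 (if r = labelCount P then u else v) with hσ₅
  have hA₅ : Agree [10, 11, 12, 13, 14] [] σ σ₅ := hA₄.setVar (by simp)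
  have hc₅ : Ctx P i I lab σ₅ := hc.of_agree hA₅ (by simp) (by simp)
  have h9₅ : σ₅.var 9 = k := (hA₅.var 9 (by simp)).trans h9
  have h10 : σ₅.var 10 = u := by simp [hσ₅, hσ₄, hσ₃, hσ₂, hσ₁]
  have h11 : σ₅.var 11 = v := by simp [hσ₅, hσ₄, hσ₃, hσ₂]
  have h12 : σ₅.var 12 = r := by simp [hσ₅, hσ₄, hσ₃]
  have h13 : σ₅.var 13 = if r = labelCount P then v else u := by simp [hσ₅, hσ₄]
  have h14 : σ₅.var 14 = if r = labelCount P then u else v := by simp [hσ₅]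
  have h2₅ : σ₅.arr 2 = σ.arr 2 := hA₅.arr 2 (by simp)
  have ho₅ : σ₅.out = σ.out := rfl
  clear_value σ₅
  clear e1 e2 e3 e4 e5 hA₁ hA₂ hA₃ hA₄ hc₁ hc₂ hc₃ hc₄ hσ₅ hσ₄ hσ₃ hσ₂ hσ₁ σ₄ σ₃ σ₂ σ₁
  set u' := if r = labelCount P then v else u with hu'
  set v' := if r = labelCount P then u else v with hv'
  have hu'n : u' < P.n := by rw [hu']; split_ifs <;> assumption
  have hv'n : v' < P.n := by rw [hv']; split_ifs <;> assumption
  -- the two free colours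
  refine Total.seq ((Total.mex (b := .var 9) (by norm_num) k (fun e => IsEdgeIndex I e ∧ keyAt P lab I e = r ∧
    (IsEnd (srcAt P I) (dstAt P I) u e ∨ IsEnd (srcAt P I) (dstAt P I) u' e)) (σ.arr 2) hkW
    (fun σ' hA => (hA.var 9 (by simp)).trans h9₅) ?_).mono le_rfl ?_)
  · intro σ' hA _
    rw [(hc₅.of_agree hA (by simp) (by simp) : Ctx P i I lab σ').eval_edgeHit hI,
      hA.var 10 (by simp), hA.var 12 (by simp), hA.var 13 (by simp), hA.arr 2 (by simp),
      h10, h12, h13, h2₅]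
  rintro σ₆ ⟨hA₆, ho₆, hfa, hma⟩
  have hc₆ : Ctx P i I lab σ₆ := hc₅.of_agree hA₆ (by simp) (by simp)
  refine Total.seq ((Total.mex (b := .var 9) (by norm_num) k (fun e => IsEdgeIndex I e ∧ keyAt P lab I e = r ∧
    (IsEnd (srcAt P I) (dstAt P I) v e ∨ IsEnd (srcAt P I) (dstAt P I) v' e)) (σ.arr 2) hkW
    (fun σ' hA => (hA.var 9 (by simp)).trans ((hA₆.var 9 (by simp)).trans h9₅)) ?_).mono le_rfl ?_)
  · intro σ' hA _
    rw [(hc₆.of_agree hA (by simp) (by simp) : Ctx P i I lab σ').eval_edgeHit hI,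
      hA.var 11 (by simp), hA.var 12 (by simp), hA.var 14 (by simp), hA.arr 2 (by simp),
      hA₆.var 11 (by simp), hA₆.var 12 (by simp), hA₆.var 14 (by simp), hA₆.arr 2 (by simp),
      h11, h12, h14, h2₅]
  rintro σ₇ ⟨hA₇, ho₇, hfb, hmb⟩
  have hA₅₇ : Agree [15, 16, 17] [] σ₅ σ₇ :=
    (hA₆.mono (by simp) (by simp)).trans (hA₇.mono (by simp) (by simp))
  have hc₇ : Ctx P i I lab σ₇ := hc₅.of_agree hA₅₇ (by simp) (by simp)
  have h15 : σ₆.var 15 = σ₇.var 15 := (hA₇.var 15 (by simp)).symm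
  rw [h15] at hfa hma
  set a := σ₇.var 15 with ha
  set b := σ₇.var 16 with hb
  have hbda := hD.le hun hu'n hk.le hma
  have hbdb := hD.le hvn hv'n hk.le hmb
  have hak : a ≤ k := le_of_forall_hit fun α hα => let ⟨e, he, _, h⟩ := hma α hα; ⟨e, he, h⟩
  have hbk : b ≤ k := le_of_forall_hit fun α hα => let ⟨e, he, _, h⟩ := hmb α hα; ⟨e, he, h⟩
  -- In the last class the two searches forbid the same colours, and least unused values of the same
  -- set agree.
  have habs : r = labelCount P → a = b := by
    intro h
    have hu'' : u' = v := by rw [hu', if_pos h]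
    have hv'' : v' = u := by rw [hv', if_pos h]
    rw [hu''] at hfa hma
    rw [hv''] at hfb hmb
    rcases lt_trichotomy a b with hlt | heq | hlt
    · obtain ⟨e, he, ⟨h1, h2, h3⟩, h4⟩ := hmb a hlt
      exact absurd h4 (hfa e he ⟨h1, h2, h3.symm⟩)
    · exact heq
    · obtain ⟨e, he, ⟨h1, h2, h3⟩, h4⟩ := hma b hlt
      exact absurd h4 (hfb e he ⟨h1, h2, h3.symm⟩)
  have hbound : ∀ c, c = a ∨ c = b → c ≤ if r = labelCount P then 2 * D else D := by
    intro c hcc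
    by_cases h : r = labelCount P
    · rw [if_pos h]
      rcases hcc with rfl | rfl
      · exact hbda.1
      · exact hbdb.1
    · have hu'' : u = u' := by rw [hu', if_neg h]
      have hv'' : v = v' := by rw [hv', if_neg h]
      rw [if_neg h]
      rcases hcc with rfl | rfl
      · exact hbda.2 hu''
      · exact hbdb.2 hv''
  have hfreea : Free (IsEdgeIndex I) (srcAt P I) (dstAt P I) (keyAt P lab I) (σ.arr 2) k r u a :=
    fun e he h1 h2 h3 => hfa e he ⟨h1, h2, .inl h3⟩
  have hfreeb : Free (IsEdgeIndex I) (srcAt P I) (dstAt P I) (keyAt P lab I) (σ.arr 2) k r v b :=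
    fun e he h1 h2 h3 => hfb e he ⟨h1, h2, .inl h3⟩
  have hsd : ∀ e, IsEdgeIndex I e → keyAt P lab I e = r → r ≠ labelCount P →
      sideOf lab (labelCount P) r (srcAt P I e) ≠ sideOf lab (labelCount P) r (dstAt P I e) :=
    fun e h1 h2 h3 => sideOf_ne (hI.lab_lt _ (hI.srcAt_lt h1)) (hI.lab_lt _ (hI.dstAt_lt h1)) h3 h2
  -- marking
  refine Total.seq ((Total.clearMarks hR hc₇).mono le_rfl ?_)
  rintro σ₈ ⟨hA₈, ho₈, h3₈⟩
  have hc₈ : Ctx P i I lab σ₈ := hc₇.of_agree hA₈ (by simp) (by simp)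
  have h9₈ : σ₈.var 9 = k := by rw [hA₈.var 9 (by simp), hA₅₇.var 9 (by simp), h9₅]
  have h11₈ : σ₈.var 11 = v := by rw [hA₈.var 11 (by simp), hA₅₇.var 11 (by simp), h11]
  have h12₈ : σ₈.var 12 = r := by rw [hA₈.var 12 (by simp), hA₅₇.var 12 (by simp), h12]
  have h15₈ : σ₈.var 15 = a := hA₈.var 15 (by simp)
  have h16₈ : σ₈.var 16 = b := hA₈.var 16 (by simp)
  have h2₈ : σ₈.arr 2 = σ.arr 2 := by rw [hA₈.arr 2 (by simp), hA₅₇.arr 2 (by simp), h2₅]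
  -- The parity invariant makes sense only in a bipartite class; the premise `a ≠ b` restricts it to
  -- that case, by `habs`.
  refine Total.seq ((Total.markComponent hR hc₈ hI hlen hk.le h9₈ (h11₈ ▸ hvn) h3₈
    (fun T => a ≠ b → Reach (IsEdgeIndex I) (srcAt P I) (dstAt P I) (keyAt P lab I) (σ.arr 2) k r a b
      u v (sideOf lab (labelCount P) r) T) ?_ ?_).mono le_rfl ?_)
  · intro hab
    rw [h11₈]
    exact Reach.init (hsd k hodd rfl fun h => hab (habs h))
  · intro T e he h1 h2 h3 h4 h5 hab
    rw [h12₈] at h2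
    rw [h15₈, h16₈, h2₈] at h3
    have hrne : r ≠ labelCount P := fun h => hab (habs h)
    exact (h5 hab).step hp hfreea hfreeb (fun e _ h1 h2 => hsd e h1 h2 hrne)
      (hsd k hodd rfl hrne) he h1 h2 h3 h4
  rintro σ₉ ⟨hA₉, ho₉, hmv, hreach, hclosed⟩
  rw [h11₈] at hmv
  rw [h12₈, h15₈, h16₈, h2₈] at hclosed
  have hc₉ : Ctx P i I lab σ₉ := hc₈.of_agree hA₉ (by simp) (by simp)
  have h9₉ : σ₉.var 9 = k := (hA₉.var 9 (by simp)).trans h9₈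
  have h12₉ : σ₉.var 12 = r := (hA₉.var 12 (by simp)).trans h12₈
  have h15₉ : σ₉.var 15 = a := (hA₉.var 15 (by simp)).trans h15₈
  have h16₉ : σ₉.var 16 = b := (hA₉.var 16 (by simp)).trans h16₈
  have h2₉ : σ₉.arr 2 = σ.arr 2 := (hA₉.arr 2 (by simp)).trans h2₈
  -- swapping
  refine Total.seq ((Total.swapColours hR hc₉ hI hlen hk.le h9₉ (by omega) (by omega)).mono le_rfl ?_)
  rintro σ₁₀ ⟨hA₁₀, ho₁₀, hswap⟩
  rw [h12₉, h15₉, h16₉, h2₉] at hswap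
  have e9 : Expr.eval σ₁₀ (.var 9) = k := (hA₁₀.var 9 (by simp)).trans h9₉
  have e15 : Expr.eval σ₁₀ (.var 15) = a := (hA₁₀.var 15 (by simp)).trans h15₉
  refine Total.put (by rw [e9]; omega) (by rw [e15]; omega) ?_
  rw [e9, e15]
  have hfin : ∀ e, (σ₁₀.setCell 2 k a).arr 2 e = if e = k then a else σ₁₀.arr 2 e := by
    intro e
    simp [Function.update_apply]
  refine ⟨?_, ?_, ?_, ?_⟩
  · refine Agree.setCell ?_ (by simp)
    exact (hA₅.mono (by simp) (by simp)).trans ((hA₅₇.mono (by simp) (by simp)).trans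
      ((hA₈.mono (by simp) (by simp)).trans ((hA₉.mono (by simp) (by simp)).trans
        (hA₁₀.mono (by simp) (by simp)))))
  · rw [Mem.setCell_out, ho₁₀, ho₉, ho₈, ho₇, ho₆, ho₅]
  · refine hp.kempe hfreea hfreeb hclosed hmv ?_ ?_ ?_
    · by_cases hab : a = b
      · exact .inl hab
      · exact .inr (hreach hab).avoid
    · intro e he
      rw [hfin e, if_neg he.ne, hswap e he]
    · rw [hfin k, if_pos rfl]
  · intro e he hae
    rw [hfin e]
    by_cases hek : e = k
    · rw [if_pos hek, hek]
      exact hbound a (.inl rfl)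
    · have hlt : e < k := by omega
      rw [if_neg hek, hswap e hlt]
      -- An exchanged edge lies in the class `r` and gets `a`, `b` or its old colour, all of which
      -- respect the bound of that class.
      split_ifs with h1 h2 h3
      · rcases swap_cases a b (σ.arr 2 e) with h | h | h
        · rw [h.2]
          simpa [h1.2.1.symm.trans h2] using hbound b (.inr rfl)
        · rw [h.2]
          simpa [h1.2.1.symm.trans h2] using hbound a (.inl rfl)
        · rw [h.2.2]
          simpa [h2] using hC e hlt hae
      · rcases swap_cases a b (σ.arr 2 e) with h | h | h
        · have := hbound b (.inr rfl)
          rw [if_neg (fun h => h2 (h1.2.1.trans h))] at this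
          rwa [h.2]
        · have := hbound a (.inl rfl)
          rw [if_neg (fun h => h2 (h1.2.1.trans h))] at this
          rwa [h.2]
        · rw [h.2.2]
          simpa [h2] using hC e hlt hae
      · simpa [h3] using hC e hlt hae
      · simpa [h3] using hC e hlt hae

end

end MapReduce

/-! ### The complete programs of the third round. -/

namespace MapReduce

def Cmd.colourEdges : Cmd :=
  .forTo 9 (.var 5) (.ite (.mod (.wordAt 9) (.lit 2)) .colourEdge .skip)

/-- Outputs the edges together with their colours. -/
def Cmd.reportEdges : Cmd :=
  .forTo 9 (.var 5) <| .ite (.mod (.wordAt 9) (.lit 2))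
    (.seq (.send (.var 4) (Expr.wordAt 9).src) <| .seq (.send (.var 4) (Expr.wordAt 9).dst) <|
      -- Class and colour within the class are packed into one word; the classes are `0, …, q`,
      -- hence the factor `q + 1`. Different classes thereby get disjoint palettes.
      .send (.var 4) (.add (.mul (.get 2 (.var 9)) (.add (.var 8) (.lit 1))) (Expr.wordAt 9).key))
    .skip

/-- The program of the third round of edge colouring. -/
def Cmd.edgeColouring : Cmd := .seq .prelude (.seq .readLabels (.seq .colourEdges .reportEdges))

/-- Tests whether the edge with index `var 17` joins the vertex `var 9` to a smaller vertex with the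
same label and the colour `var 15`. -/
def Expr.vertexHit : Expr :=
  .mul (.mod (.wordAt 17) (.lit 2)) <|
    .mul (.eq (.get 1 (Expr.wordAt 17).src) (.get 1 (Expr.wordAt 17).dst)) <|
    .mul (.eq (Expr.wordAt 17).dst (.var 9)) (.eq (.get 2 (Expr.wordAt 17).src) (.var 15))

def Cmd.colourVertices : Cmd :=
  .forTo 9 (.var 0) <|
    -- The machine to which two equal labels are routed holds all edges between vertices with this
    -- label, so it alone can colour them.
    .ite (.eq (.mod (.mod (.add (.get 1 (.var 9)) (.get 1 (.var 9))) (.var 8)) (.var 3)) (.var 4))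
    (.seq (.mex 15 17 (.var 5) .vertexHit) <| .seq (.put 2 (.var 9) (.var 15)) <|
      .seq (.send (.var 4) (.var 9)) <|
      -- Labels are below `q`, so the factor `q` separates colour and label.
      .send (.var 4) (.add (.mul (.var 15) (.var 8)) (.get 1 (.var 9))))
    .skip

/-- The program of the third round of vertex colouring. -/
def Cmd.vertexColouring : Cmd := .seq .prelude (.seq .readLabels .colourVertices)

/-- The messages by which a machine outputs the edge with index `k`. -/
def edgeRecord (P : Params) (lab : ℕ → ℕ) (i : ℕ) (I : List ℕ) (C : ℕ → ℕ) (k : ℕ) :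
    List (ℕ × ℕ) :=
  if I.getD k 0 % 2 = 1 then [(i, srcAt P I k), (i, dstAt P I k),
    (i, C k * (labelCount P + 1) + keyAt P lab I k)] else []

/-- The messages by which a machine outputs the vertex `v`. -/
def vertexRecord (P : Params) (lab : ℕ → ℕ) (i : ℕ) (c : ℕ → ℕ) (v : ℕ) : List (ℕ × ℕ) :=
  if route P.M (labelCount P) (lab v) (lab v) = i then
    [(i, v), (i, c v * labelCount P + lab v)] else []

theorem length_edgeRecord_le (P : Params) (lab : ℕ → ℕ) (i : ℕ) (I : List ℕ) (C : ℕ → ℕ) (k : ℕ) :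
    (edgeRecord P lab i I C k).length ≤ 3 := by
  unfold edgeRecord; split_ifs <;> simp

theorem length_vertexRecord_le (P : Params) (lab : ℕ → ℕ) (i : ℕ) (c : ℕ → ℕ) (v : ℕ) :
    (vertexRecord P lab i c v).length ≤ 2 := by
  unfold vertexRecord; split_ifs <;> simp

theorem length_flatMap_range_le {α : Type*} (f : ℕ → List α) (b : ℕ) (h : ∀ k, (f k).length ≤ b)
    (k : ℕ) : ((List.range k).flatMap f).length ≤ b * k := by
  induction k with
  | zero => simp
  | succ k ih =>
    rw [List.range_succ, List.flatMap_append, List.length_append]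
    simp only [List.flatMap_cons, List.flatMap_nil, List.append_nil]
    have := h k
    rw [Nat.mul_succ]
    omega

section
variable {P : Params} {S W : ℕ} {ρ : Tape} {i : ℕ} {I : List ℕ} {lab : ℕ → ℕ} {σ : Mem} {k D : ℕ}

theorem Total.colourEdges (hR : Roomy P S W) (hc : Ctx P i I lab σ) (hI : GoodInbox P lab I)
    (hlen : I.length ≤ S) (hD : ClassDegreeLe P lab I D) :
    Total S W ρ .colourEdges (I.length * (100 * (P.n + I.length + 2) ^ 2 + 3) + 2) σ fun σ' =>
      Ctx P i I lab σ' ∧ σ'.out = σ.out ∧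
      Proper (IsEdgeIndex I) (srcAt P I) (dstAt P I) (keyAt P lab I) (σ'.arr 2) I.length ∧
      Bounded P lab I D (σ'.arr 2) I.length := by
  have hSW := hR.S_le
  have hB : ∀ {σ'}, Agree [9, 10, 11, 12, 13, 14, 15, 16, 17] [2, 3] σ σ' → Ctx P i I lab σ' :=
    fun h => hc.of_agree h (by simp) (by simp)
  refine Total.le_time (T := I.length * (100 * (P.n + I.length + 2) ^ 2 + 1 + 2) + 2) ?_ le_rfl
  refine Total.forTo I.length (fun k σ' => Agree [9, 10, 11, 12, 13, 14, 15, 16, 17] [2, 3] σ σ' ∧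
    σ'.out = σ.out ∧
    Proper (IsEdgeIndex I) (srcAt P I) (dstAt P I) (keyAt P lab I) (σ'.arr 2) k ∧
    Bounded P lab I D (σ'.arr 2) k) (by omega) ?_ ?_ ?_ ?_
  · exact ⟨(Agree.refl _ _ _).setVar (by simp), rfl, fun e he => absurd he (Nat.not_lt_zero _),
      fun e he => absurd he (Nat.not_lt_zero _)⟩
  · rintro k σ' ⟨hA, -⟩
    exact (hB hA).base.length
  · rintro k hk σ' ⟨hA, ho, hp, hC⟩ hx
    have hodd : Expr.eval σ' (.mod (.wordAt 9) (.lit 2)) ≠ 0 ↔ IsEdgeIndex I k := by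
      rw [(hB hA).eval_odd, hx]
      rfl
    refine Total.ite (fun hg => ?_) (fun hg => ?_)
    · refine (Total.colourEdge hR (hB hA) hI hlen hk (hodd.1 hg) hx hD hp hC).mono le_rfl ?_
      rintro σ'' ⟨hA', ho', hp', hC'⟩
      exact ⟨(hA'.var 9 (by simp)).trans hx, (hA.trans (hA'.mono (by simp) (by simp))).setVar
        (by simp), ho'.trans ho, hp', hC'⟩
    · have hne : ¬ IsEdgeIndex I k := fun h => absurd hg (hodd.2 h)
      have hlt : ∀ e < k + 1, IsEdgeIndex I e → e < k := by
        intro e he hae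
        rcases Nat.lt_succ_iff_lt_or_eq.1 he with h | rfl
        · exact h
        · exact absurd hae hne
      refine Total.le_time (T := 1) (Total.skip ⟨hx, hA.setVar (by simp), ho, ?_, ?_⟩)
        (by have : 0 < (P.n + I.length + 2) ^ 2 := by positivity
            omega)
      · intro e he f hf hae haf
        exact hp e (hlt e he hae) f (hlt f hf haf) hae haf
      · intro e he hae
        exact hC e (hlt e he hae) hae
  · rintro σ' ⟨hA, h⟩
    exact ⟨hB hA, h⟩

theorem Total.reportEdges (hR : Roomy P S W) (hc : Ctx P i I lab σ) (hI : GoodInbox P lab I)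
    (hlen : 3 * I.length ≤ S) (ho : σ.out = []) (hC : Bounded P lab I D (σ.arr 2) I.length)
    (hW : (2 * D + 1) * (labelCount P + 1) ≤ W) :
    Total S W ρ .reportEdges (6 * I.length + 2) σ fun σ' =>
      σ'.out = (List.range I.length).flatMap (edgeRecord P lab i I (σ.arr 2)) := by
  have hSW := hR.S_le
  have hnS := hR.n_le
  have hB : ∀ {σ'}, Agree [9] [] σ σ' → Ctx P i I lab σ' :=
    fun h => hc.of_agree h (by simp) (by simp)
  refine Total.le_time (T := I.length * ((1 + (1 + 1)) + 1 + 2) + 2) ?_ (by ring_nf; omega)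
  refine Total.forTo I.length (fun k σ' => Agree [9] [] σ σ' ∧
    σ'.out = (List.range k).flatMap (edgeRecord P lab i I (σ.arr 2))) (by omega) ?_ ?_ ?_ ?_
  · exact ⟨(Agree.refl _ _ _).setVar (by simp), by simpa using ho⟩
  · rintro k σ' ⟨hA, -⟩
    exact (hB hA).base.length
  · rintro k hk σ' ⟨hA, ho'⟩ hx
    have hodd : Expr.eval σ' (.mod (.wordAt 9) (.lit 2)) ≠ 0 ↔ I.getD k 0 % 2 = 1 := by
      rw [(hB hA).eval_odd, hx]
    have hl : σ'.out.length ≤ 3 * k := by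
      rw [ho']
      exact length_flatMap_range_le _ 3 (length_edgeRecord_le P lab i I _) k
    refine Total.ite (fun hg => ?_) (fun hg => ?_)
    · have hk1 := hodd.1 hg
      have hs := hI.srcAt_lt hk1
      have hd := hI.dstAt_lt hk1
      have hself : ∀ {σ''}, Agree [9] [] σ σ'' → Expr.eval σ'' (.var 4) = i :=
        fun h => (hB h).base.self
      have esrc : (Expr.wordAt 9).src.eval σ' = srcAt P I k := by rw [(hB hA).eval_src, hx, srcAt]
      refine Total.seq (T := 1) (T' := 2) (Total.send (by omega) (by rw [esrc]; omega) ?_)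
      rw [esrc, hself hA]
      have hA₁ : Agree [9] [] σ (σ'.addOut i (srcAt P I k)) := hA.addOut
      have edst : (Expr.wordAt 9).dst.eval (σ'.addOut i (srcAt P I k)) = dstAt P I k := by
        rw [(hB hA₁).eval_dst, Mem.addOut_var, hx, dstAt]
      refine Total.seq (T := 1) (T' := 1) (Total.send (by simp; omega) (by rw [edst]; omega) ?_)
      rw [edst, hself hA₁]
      have hA₂ : Agree [9] [] σ ((σ'.addOut i (srcAt P I k)).addOut i (dstAt P I k)) := hA₁.addOut
      have ekey : Expr.eval ((σ'.addOut i (srcAt P I k)).addOut i (dstAt P I k))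
          (.add (.mul (.get 2 (.var 9)) (.add (.var 8) (.lit 1))) (Expr.wordAt 9).key) =
          σ.arr 2 k * (labelCount P + 1) + keyAt P lab I k := by
        have h1 := (hB hA₂).eval_key hI (x := 9) (by
          rw [Mem.addOut_var, Mem.addOut_var, hx]; exact hk1)
        rw [Mem.addOut_var, Mem.addOut_var, hx] at h1
        have h2 : ∀ σ'' e, Expr.eval σ'' (.add (.mul (.get 2 (.var 9)) (.add (.var 8) (.lit 1))) e) =
          σ''.arr 2 (σ''.var 9) * (σ''.var 8 + 1) + e.eval σ'' := fun _ _ => rfl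
        rw [h2, h1, (hB hA₂).base.q, hA₂.arr 2 (by simp), Mem.addOut_var, Mem.addOut_var, hx, keyAt]
      refine Total.send (by simp; omega) ?_ ?_
      · rw [ekey]
        have h1 := hC k hk hk1
        have h2 : σ.arr 2 k ≤ 2 * D := h1.trans (by split_ifs <;> omega)
        have h3 : keyAt P lab I k ≤ labelCount P := key_le hR.labelCount_pos
        have h4 := Nat.mul_le_mul_right (labelCount P + 1) h2
        rw [Nat.add_mul] at hW
        omega
      · rw [ekey, hself hA₂]
        refine ⟨by simpa using hx, hA₂.addOut.setVar (by simp), ?_⟩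
        rw [List.range_succ, List.flatMap_append, ← ho']
        simp only [edgeRecord, hk1, if_true, List.flatMap_cons, List.flatMap_nil, List.append_nil]
        simp
    · have hne : ¬ I.getD k 0 % 2 = 1 := fun h => absurd hg (hodd.2 h)
      refine Total.le_time (T := 1) (Total.skip ⟨hx, hA.setVar (by simp), ?_⟩) (by norm_num)
      rw [List.range_succ, List.flatMap_append, ← ho']
      simp only [edgeRecord, hne, if_false, List.flatMap_cons, List.flatMap_nil, List.append_nil]
      rfl
  · rintro σ' ⟨hA, h⟩
    exact h

theorem Total.edgeColouring (hR : Roomy P S W) (hI : GoodInbox P lab I)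
    (hlen : 3 * I.length ≤ S) (hD : ClassDegreeLe P lab I D)
    (hW : (2 * D + 1) * (labelCount P + 1) ≤ W) :
    Total S W ρ .edgeColouring (3 * P.n + 4 + ((4 * I.length + 2) +
      ((I.length * (100 * (P.n + I.length + 2) ^ 2 + 3) + 2) + (6 * I.length + 2))))
      (initMem P i I) fun σ' => ∃ C : ℕ → ℕ,
      Proper (IsEdgeIndex I) (srcAt P I) (dstAt P I) (keyAt P lab I) C I.length ∧
      Bounded P lab I D C I.length ∧
      σ'.out = (List.range I.length).flatMap (edgeRecord P lab i I C) := by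
  refine Total.seq ((Total.prelude hR).mono le_rfl ?_)
  rintro σ₁ ⟨hb₁, ho₁, -⟩
  refine Total.seq ((Total.readLabels hR hb₁ hI (by omega)).mono le_rfl ?_)
  rintro σ₂ ⟨hb₂, ho₂, hl₂⟩
  refine Total.seq ((Total.colourEdges hR ⟨hb₂, hl₂⟩ hI (by omega) hD).mono le_rfl ?_)
  rintro σ₃ ⟨hc₃, ho₃, hp₃, hC₃⟩
  refine (Total.reportEdges hR hc₃ hI hlen (by rw [ho₃, ho₂, ho₁]) hC₃ hW).mono le_rfl ?_
  intro σ₄ ho₄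
  exact ⟨σ₃.arr 2, hp₃, hC₃, ho₄⟩

theorem Ctx.eval_vertexHit (h : Ctx P i I lab σ) (hI : GoodInbox P lab I) :
    Expr.vertexHit.eval σ ≠ 0 ↔ (IsEdgeIndex I (σ.var 17) ∧
      lab (srcAt P I (σ.var 17)) = lab (dstAt P I (σ.var 17)) ∧
      dstAt P I (σ.var 17) = σ.var 9) ∧ σ.arr 2 (srcAt P I (σ.var 17)) = σ.var 15 := by
  unfold Expr.vertexHit
  rw [Expr.mul_ne, h.eval_odd, Expr.mul_ne, Expr.mul_ne, Expr.eq_ne, Expr.eq_ne, Expr.eq_ne]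
  by_cases hodd : IsEdgeIndex I (σ.var 17)
  · have h2 : Expr.eval σ (.get 2 (Expr.wordAt 17).src) = σ.arr 2 (srcAt P I (σ.var 17)) :=
      congrArg (σ.arr 2) h.eval_src
    rw [(h.eval_lab hI hodd).1, (h.eval_lab hI hodd).2, h2, h.eval_dst]
    simp only [Expr.eval, IsEdgeIndex, srcAt, dstAt]
    tauto
  · have : ¬ I.getD (σ.var 17) 0 % 2 = 1 := hodd
    tauto

open Classical in
/-- Every vertex has at most `D` smaller neighbours with the same label. -/
def BackDegreeLe (P : Params) (lab : ℕ → ℕ) (I : List ℕ) (D : ℕ) : Prop :=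
  ∀ v < P.n, ((Finset.range I.length).filter fun e => IsEdgeIndex I e ∧
    lab (srcAt P I e) = lab (dstAt P I e) ∧ dstAt P I e = v).card ≤ D

/-- Greedy colouring in increasing order: only smaller neighbours with the same label forbid
colours, and there are at most `D` of them. The edge list of the inbox suffices because of the
routing, so no adjacency structure is built. -/
theorem Total.colourVertices (hR : Roomy P S W) (hc : Ctx P i I lab σ) (hI : GoodInbox P lab I)
    (hlen : I.length ≤ S) (hn : 2 * P.n ≤ S) (hD : BackDegreeLe P lab I D) (ho : σ.out = [])
    (hW : (2 * D + 1) * (labelCount P + 1) ≤ W) :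
    Total S W ρ .colourVertices (P.n * (4 * (I.length + 2) ^ 2 + 6) + 2) σ fun σ' =>
      ∃ c : ℕ → ℕ, (∀ e < I.length, IsEdgeIndex I e → lab (srcAt P I e) = lab (dstAt P I e) →
        route P.M (labelCount P) (lab (dstAt P I e)) (lab (dstAt P I e)) = i →
        c (srcAt P I e) ≠ c (dstAt P I e)) ∧
      (∀ v < P.n, route P.M (labelCount P) (lab v) (lab v) = i → c v ≤ D) ∧
      σ'.out = (List.range P.n).flatMap (vertexRecord P lab i c) := by
  have hSW := hR.S_le
  have hnS := hR.n_le
  have hB : ∀ {σ'}, Agree [9, 15, 17] [2] σ σ' → Ctx P i I lab σ' :=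
    fun h => hc.of_agree h (by simp) (by simp)
  refine Total.le_time (T := P.n * ((4 * (I.length + 2) ^ 2 + (1 + (1 + 1))) + 1 + 2) + 2) ?_
    (by ring_nf; omega)
  refine Total.forTo P.n (fun k σ' => Agree [9, 15, 17] [2] σ σ' ∧
    (∀ e < I.length, IsEdgeIndex I e → lab (srcAt P I e) = lab (dstAt P I e) → dstAt P I e < k →
        route P.M (labelCount P) (lab (dstAt P I e)) (lab (dstAt P I e)) = i →
        σ'.arr 2 (srcAt P I e) ≠ σ'.arr 2 (dstAt P I e)) ∧
    (∀ v < k, route P.M (labelCount P) (lab v) (lab v) = i → σ'.arr 2 v ≤ D) ∧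
    σ'.out = (List.range k).flatMap (vertexRecord P lab i (σ'.arr 2))) (by omega) ?_ ?_ ?_ ?_
  · exact ⟨(Agree.refl _ _ _).setVar (by simp), fun e _ _ _ h => absurd h (Nat.not_lt_zero _),
      fun v h => absurd h (Nat.not_lt_zero _), by simpa using ho⟩
  · rintro k σ' ⟨hA, -⟩
    exact (hB hA).base.n
  · rintro k hk σ' ⟨hA, hp, hC, ho'⟩ hx
    have hc' := hB hA
    have hmine : Expr.eval σ' (.eq (.mod (.mod (.add (.get 1 (.var 9)) (.get 1 (.var 9)))
        (.var 8)) (.var 3)) (.var 4)) ≠ 0 ↔ route P.M (labelCount P) (lab k) (lab k) = i := by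
      rw [Expr.eq_ne]
      simp only [Expr.eval, hx, hc'.base.q, hc'.base.M, hc'.base.self, hc'.lab k hk, route]
    have hl : σ'.out.length ≤ 2 * k := by
      rw [ho']
      exact length_flatMap_range_le _ 2 (length_vertexRecord_le P lab i _) k
    refine Total.ite (fun hg => ?_) (fun hg => ?_)
    · have hk1 := hmine.1 hg
      refine Total.seq ((Total.mex (b := .var 5) (by norm_num) I.length (fun e => IsEdgeIndex I e ∧
        lab (srcAt P I e) = lab (dstAt P I e) ∧ dstAt P I e = k) (fun e => σ'.arr 2 (srcAt P I e))
        (by omega) (fun σ'' hA' => (hc'.of_agree hA' (by simp) (by simp) :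
          Ctx P i I lab σ'').base.length) ?_).mono le_rfl ?_)
      · intro σ'' hA' _
        rw [(hc'.of_agree hA' (by simp) (by simp) : Ctx P i I lab σ'').eval_vertexHit hI,
          hA'.var 9 (by simp), hA'.arr 2 (by simp), hx]
      rintro σ₁ ⟨hA₁, ho₁, hf₁, hm₁⟩
      have hA₁' : Agree [9, 15, 17] [2] σ σ₁ := hA.trans (hA₁.mono (by simp) (by simp))
      set a := σ₁.var 15 with ha
      have haD : a ≤ D := (le_card_of_forall_hit hm₁).trans ((le_of_eq (by congr)).trans (hD k hk))
      have h9 : σ₁.var 9 = k := (hA₁.var 9 (by simp)).trans hx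
      have e9 : Expr.eval σ₁ (.var 9) = k := h9
      have e15 : Expr.eval σ₁ (.var 15) = a := rfl
      have hDW : 2 * D + 1 ≤ W := (Nat.le_mul_of_pos_right _ (Nat.succ_pos _)).trans hW
      refine Total.seq (T := 1) (T' := 2) (Total.put (by rw [e9]; omega) (by rw [e15]; omega) ?_)
      rw [e9, e15]
      have hA₂ : Agree [9, 15, 17] [2] σ (σ₁.setCell 2 k a) := hA₁'.setCell (by simp)
      have hb₂ := hB hA₂
      have ho₂ : (σ₁.setCell 2 k a).out = σ'.out := ho₁
      have h9₂ : (σ₁.setCell 2 k a).var 9 = k := h9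
      have h15₂ : (σ₁.setCell 2 k a).var 15 = a := rfl
      have h2₂ : ∀ v, (σ₁.setCell 2 k a).arr 2 v = if v = k then a else σ'.arr 2 v := by
        intro v
        simp [Function.update_apply, hA₁.arr 2 (by simp)]
      generalize σ₁.setCell 2 k a = σ₂ at *
      have e4 : Expr.eval σ₂ (.var 4) = i := hb₂.base.self
      refine Total.seq (T := 1) (T' := 1) (Total.send (by rw [ho₂]; omega) (by simp only [Expr.eval, h9₂]; omega) ?_)
      have e9' : Expr.eval σ₂ (.var 9) = k := h9₂
      rw [e4, e9']
      have ecol : Expr.eval (σ₂.addOut i k) (.add (.mul (.var 15) (.var 8)) (.get 1 (.var 9))) =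
          a * labelCount P + lab k := by
        simp only [Expr.eval, Mem.addOut_var, Mem.addOut_arr, h15₂, h9₂, hb₂.base.q, hb₂.lab k hk]
      have e4' : Expr.eval (σ₂.addOut i k) (.var 4) = i := hb₂.base.self
      refine Total.send (by simp [ho₂]; omega) ?_ ?_
      · rw [ecol]
        have h1 := hI.lab_lt k hk
        have h2 : a * labelCount P ≤ 2 * D * labelCount P := Nat.mul_le_mul_right _ (by omega)
        nlinarith
      · rw [ecol, e4']
        refine ⟨by simpa using h9₂, hA₂.addOut.addOut.setVar (by simp), ?_, ?_, ?_⟩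
        · intro e he hodd hlab hlt hr
          have hsd := (hI.getD_lt hodd).1
          simp only [Mem.setVar_arr, Mem.addOut_arr, h2₂]
          have hs : srcAt P I e < dstAt P I e := hsd
          -- The smaller end is below the larger one, which is at most `k`, so its colour has not
          -- just been overwritten.
          rw [if_neg (by omega)]
          split_ifs with h
          · exact hf₁ e he ⟨hodd, hlab, h⟩
          · exact hp e he hodd hlab (by omega) hr
        · intro v hv hr
          simp only [Mem.setVar_arr, Mem.addOut_arr, h2₂]
          split_ifs with h
          · exact haD
          · exact hC v (by omega) hr
        · simp only [Mem.setVar_arr, Mem.addOut_arr, Mem.setVar_out, Mem.addOut_out, ho₂]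
          rw [List.range_succ, List.flatMap_append, ho']
          have h3 : (List.range k).flatMap (vertexRecord P lab i (σ'.arr 2)) =
              (List.range k).flatMap (vertexRecord P lab i (σ₂.arr 2)) := by
            refine List.flatMap_congr fun v hv => ?_
            have : v ≠ k := (List.mem_range.1 hv).ne
            simp [vertexRecord, h2₂, this]
          rw [h3]
          simp [vertexRecord, hk1, h2₂]
    · have hne : route P.M (labelCount P) (lab k) (lab k) ≠ i := fun h => absurd hg (hmine.2 h)
      have hvk : ∀ v < k + 1, route P.M (labelCount P) (lab v) (lab v) = i → v < k := by
        intro v hv hr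
        rcases Nat.lt_succ_iff_lt_or_eq.1 hv with h | rfl
        · exact h
        · exact absurd hr hne
      refine Total.le_time (T := 1) (Total.skip ⟨hx, hA.setVar (by simp), ?_, ?_, ?_⟩) (by omega)
      · intro e he hodd hlab hlt hr
        exact hp e he hodd hlab (hvk _ hlt hr) hr
      · intro v hv hr
        exact hC v (hvk v hv hr) hr
      · rw [List.range_succ, List.flatMap_append]
        simp only [Mem.setVar_arr, Mem.setVar_out]
        rw [← ho']
        simp [vertexRecord, hne]
  · rintro σ' ⟨hA, hp, hC, ho'⟩
    exact ⟨σ'.arr 2, fun e he h1 h2 h3 => hp e he h1 h2 (hI.dstAt_lt h1) h3, hC, ho'⟩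

theorem Total.vertexColouring (hR : Roomy P S W) (hI : GoodInbox P lab I)
    (hlen : I.length ≤ S) (hn : 2 * P.n ≤ S) (hD : BackDegreeLe P lab I D)
    (hW : (2 * D + 1) * (labelCount P + 1) ≤ W) :
    Total S W ρ .vertexColouring (3 * P.n + 4 + ((4 * I.length + 2) +
      (P.n * (4 * (I.length + 2) ^ 2 + 6) + 2))) (initMem P i I) fun σ' =>
      ∃ c : ℕ → ℕ, (∀ e < I.length, IsEdgeIndex I e → lab (srcAt P I e) = lab (dstAt P I e) →
        route P.M (labelCount P) (lab (dstAt P I e)) (lab (dstAt P I e)) = i →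
        c (srcAt P I e) ≠ c (dstAt P I e)) ∧
      (∀ v < P.n, route P.M (labelCount P) (lab v) (lab v) = i → c v ≤ D) ∧
      σ'.out = (List.range P.n).flatMap (vertexRecord P lab i c) := by
  refine Total.seq ((Total.prelude hR).mono le_rfl ?_)
  rintro σ₁ ⟨hb₁, ho₁, -⟩
  refine Total.seq ((Total.readLabels hR hb₁ hI (by omega)).mono le_rfl ?_)
  rintro σ₂ ⟨hb₂, ho₂, hl₂⟩
  exact Total.colourVertices hR ⟨hb₂, hl₂⟩ hI hlen hn hD (by rw [ho₂, ho₁]) hW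

end

end MapReduce

namespace MapReduce

/-! ## The first two rounds -/

theorem Round.of_total {P : Params} {S W T : ℕ} {p : Cmd} {ρ : Fin P.M → Tape} {I : Data P.M}
    {Q : Fin P.M → List (ℕ × ℕ) → Prop} (hI : ∀ i, (I i).length ≤ S)
    (h : ∀ i, Total S W (ρ i) p T (initMem P i (I i)) fun σ => Q i σ.out) :
    ∃ out : Fin P.M → List (ℕ × ℕ), (∀ i, Q i (out i)) ∧ Round P S W T p ρ I (deliver out) := by
  choose t ht F hF hQ using h
  exact ⟨fun i => (F i).out, hQ, hI, F, fun i => ⟨t i, ht i, hF i⟩, rfl⟩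

theorem mem_deliver {M : ℕ} {out : Fin M → List (ℕ × ℕ)} {j : Fin M} {w : ℕ} :
    w ∈ deliver out j ↔ ∃ i, ((j : ℕ), w) ∈ out i := by
  simp [deliver]

theorem flatMap_ite_single {ι α : Type*} [DecidableEq ι] {l : List ι} (hl : l.Nodup) {j : ι}
    (hj : j ∈ l) (f : ι → List α) : (l.flatMap fun i => if i = j then f i else []) = f j := by
  induction l with
  | nil => simp at hj
  | cons i l ih =>
    rw [List.nodup_cons] at hl
    rw [List.flatMap_cons]
    by_cases h : i = j
    · subst h
      have : (l.flatMap fun k => if k = i then f k else []) = [] := by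
        rw [List.flatMap_eq_nil_iff]
        intro k hk
        exact if_neg fun h : k = i => hl.1 (h ▸ hk)
      rw [if_pos rfl, this, List.append_nil]
    · rw [if_neg h, List.nil_append, ih hl.2 ((List.mem_cons.1 hj).resolve_left fun e => h e.symm)]

theorem flatMap_finRange_single {M : ℕ} {α : Type*} (j : Fin M) (f : Fin M → List α) :
    ((List.finRange M).flatMap fun i => if i = j then f i else []) = f j :=
  flatMap_ite_single (List.nodup_finRange M) (List.mem_finRange j) f

theorem flatMap_ite_eq_filter {α β : Type*} (l : List α) (p : α → Prop) [DecidablePred p]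
    (f : α → List β) : (l.flatMap fun a => if p a then f a else []) = (l.filter p).flatMap f := by
  induction l with
  | nil => rfl
  | cons a l ih => by_cases h : p a <;> simp [h, ih]

/-- In the last round machines write only to themselves, so delivery neither reorders nor mixes the
output records. -/
theorem deliver_of_self {M : ℕ} {out : Fin M → List (ℕ × ℕ)}
    (h : ∀ i, ∀ q ∈ out i, q.1 = (i : ℕ)) (j : Fin M) : deliver out j = (out j).map Prod.snd := by
  rw [deliver, ← flatMap_finRange_single j fun i => (out i).map Prod.snd]
  refine List.flatMap_congr fun i _ => ?_
  split_ifs with hij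
  · subst hij
    rw [List.filter_eq_self.2 fun q hq => by simp [h i q hq]]
  · rw [List.filter_eq_nil_iff.2, List.map_nil]
    intro q hq
    rw [h i q hq]
    simpa using fun e => hij (Fin.ext e)

section
variable {P : Params} {G : SimpleGraph (Fin P.n)} {lab : ℕ → ℕ} {S W : ℕ}

/-- The word for the edge underlying a dart. -/
def dartWord (d : G.Dart) : ℕ := edgeWord P.n d.fst d.snd

/-- The machine responsible for a dart. -/
def dartRoute (lab : ℕ → ℕ) (d : G.Dart) : ℕ := route P.M (labelCount P) (lab d.fst) (lab d.snd)

/-- The darts handled by machine `j` in the third round. -/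
def routed (lab : ℕ → ℕ) (L : Fin P.M → List G.Dart) (j : Fin P.M) : List G.Dart :=
  (List.finRange P.M).flatMap fun i => (L i).filter fun d => dartRoute lab d = j

theorem route_comm (M q k l : ℕ) : route M q k l = route M q l k := by
  rw [route, route, add_comm]

theorem src_dartWord (d : G.Dart) : src P.n (dartWord d) = min (d.fst : ℕ) d.snd :=
  src_edgeWord d.fst.2 d.snd.2

theorem dst_dartWord (d : G.Dart) : dst P.n (dartWord d) = max (d.fst : ℕ) d.snd :=
  dst_edgeWord d.fst.2 d.snd.2

theorem forwardTo_dartWord (i : ℕ) (d : G.Dart) :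
    forwardTo P lab i (dartWord d) = dartRoute lab d := by
  have h : dartWord d % 2 = 1 := edgeWord_mod_two _ _ _
  rw [forwardTo, if_pos h, src_dartWord, dst_dartWord, dartRoute]
  rcases le_total (d.fst : ℕ) d.snd with h | h
  · rw [min_eq_left h, max_eq_right h]
  · rw [min_eq_right h, max_eq_left h, route_comm]

theorem edge_eq_of_dartWord_eq {d d' : G.Dart} (h : dartWord d = dartWord d') :
    d.edge = d'.edge := by
  have h1 := congrArg (src P.n) h
  have h2 := congrArg (dst P.n) h
  rw [src_dartWord, src_dartWord] at h1
  rw [dst_dartWord, dst_dartWord] at h2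
  have : (d.fst = d'.fst ∧ d.snd = d'.snd) ∨ (d.fst = d'.snd ∧ d.snd = d'.fst) := by
    simp only [Fin.ext_iff]
    omega
  rw [SimpleGraph.Dart.edge, SimpleGraph.Dart.edge]
  exact Sym2.eq_iff.2 this

theorem dartWord_eq_of_edge_eq {d d' : G.Dart} (h : d.edge = d'.edge) :
    dartWord d = dartWord d' := by
  rw [SimpleGraph.Dart.edge, SimpleGraph.Dart.edge] at h
  rcases Sym2.eq_iff.1 h with ⟨h1, h2⟩ | ⟨h1, h2⟩
  · simp only [dartWord, h1, h2]
  · have h1 : d.fst = d'.snd := h1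
    have h2 : d.snd = d'.fst := h2
    simp only [dartWord, h1, h2, edgeWord, min_comm, max_comm]

theorem filter_odd_deliver {out : Fin P.M → List (ℕ × ℕ)} (j : Fin P.M) (p : ℕ → Bool) :
    (deliver out j).filter p = (List.finRange P.M).flatMap fun i =>
      (((out i).filter fun q => q.1 = (j : ℕ)).map Prod.snd).filter p := by
  rw [deliver, List.filter_flatMap]

/-- Averaging, stated with a product to avoid division: each of the `M` senders contributes at most
a fraction `1 / M` of `a`. -/
theorem length_flatMap_finRange_le {M : ℕ} {α : Type*} (f : Fin M → List α) (a : ℕ)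
    (h : ∀ i, M * (f i).length ≤ a) : ((List.finRange M).flatMap f).length ≤ a := by
  rcases Nat.eq_zero_or_pos M with rfl | hM
  · simp
  rw [List.length_flatMap, ← List.ofFn_eq_map, List.sum_ofFn]
  refine Nat.le_of_mul_le_mul_left ?_ hM
  rw [Finset.mul_sum]
  refine (Finset.sum_le_card_nsmul _ _ a fun i _ => h i).trans ?_
  simp

/-- The result of the first two rounds. -/
theorem exists_rounds (hR : Roomy P S W) (ω : Coins P.M) (L : Fin P.M → List G.Dart) {s Λ T : ℕ}
    (hlab : ∀ v < P.n, lab v < labelCount P)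
    (hω : ∀ (i : Fin P.M) t, i + P.M * t < P.n →
      (ω (i, 0, t, labelCount P - 1) : ℕ) = lab (i + P.M * t))
    (hL : ∀ i, (L i).length ≤ s) (hΛ : ∀ j, (routed lab L j).length ≤ Λ)
    (hS : 2 * P.n + 2 * s ≤ S) (hS' : 2 * P.n + Λ ≤ S)
    (hT : 3 * P.n + 4 + ((P.n * (3 * P.M + 5) + 2) + (3 * s + 2)) ≤ T)
    (hT' : 3 * P.n + 4 + ((4 * S + 2) + (4 * S + 2)) ≤ T) :
    ∃ I₁ I₂ : Data P.M,
      Round P S W T .announce (fun i t k => ω (i, 0, t, k)) (edgeData L) I₁ ∧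
      Round P S W T .forward (fun i t k => ω (i, 1, t, k)) I₁ I₂ ∧
      ∀ j, GoodInbox P lab (I₂ j) ∧ (I₂ j).length ≤ 2 * P.n + Λ ∧
        (I₂ j).filter (fun w => w % 2 = 1) = (routed lab L j).map dartWord := by
  have hMn := hR.M_le
  have hM := hR.M_pos
  have hpair : ∀ i, edgeData L i = ((L i).map fun d : G.Dart => ((d.fst : ℕ), (d.snd : ℕ))).flatMap
      fun e => [e.1, e.2] := by
    intro i
    rw [List.flatMap_map]
    rfl
  obtain ⟨out₁, hout₁, hr₁⟩ := Round.of_total (P := P) (S := S) (W := W) (T := T) (p := .announce)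
    (ρ := fun i t k => ω (i, 0, t, k)) (I := edgeData L) (Q := fun i out => ∃ t,
      (∀ t', i + P.M * t' < P.n ↔ t' < t) ∧ P.M * t ≤ P.n + P.M ∧
      out = labelMessages P lab i t ++ (L i).map fun d => ((i : ℕ), dartWord d)) (fun i => by
      have := hL i
      simp [edgeData, List.length_flatMap]
      omega) (fun i => by
      rw [hpair i]
      refine (Total.announce hR i.2 hlab (hω i) ?_ ?_).mono ?_ ?_
      · intro e he
        obtain ⟨d, -, rfl⟩ := List.mem_map.1 he
        exact ⟨d.fst.2, d.snd.2⟩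
      · have := hL i
        rw [List.length_map]
        omega
      · have := hL i
        rw [List.length_map]
        omega
      · rintro σ ⟨t, h1, h2, h3⟩
        exact ⟨t, h1, h2, by rw [h3, List.map_map]; rfl⟩)
  set I₁ : Data P.M := deliver out₁ with hI₁
  have hgood₁ : ∀ j, GoodInbox P lab (I₁ j) := by
    intro j
    refine ⟨hlab, ?_, ?_, ?_⟩
    · intro w hw hw0
      obtain ⟨i, hi⟩ := mem_deliver.1 hw
      obtain ⟨t, ht, -, ho⟩ := hout₁ i
      rw [ho, List.mem_append] at hi
      rcases hi with hi | hi
      · simp only [labelMessages, List.mem_flatMap, List.mem_map, List.mem_range, Prod.mk.injEq] at hi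
        obtain ⟨t', ht', k, hk, -, rfl⟩ := hi
        exact ⟨_, (ht t').2 ht', rfl⟩
      · obtain ⟨d, -, hd⟩ := List.mem_map.1 hi
        have := edgeWord_mod_two P.n d.fst d.snd
        rw [Prod.mk.injEq] at hd
        rw [← hd.2, dartWord] at hw0
        omega
    · intro w hw hw1
      obtain ⟨i, hi⟩ := mem_deliver.1 hw
      obtain ⟨t, ht, -, ho⟩ := hout₁ i
      rw [ho, List.mem_append] at hi
      rcases hi with hi | hi
      · simp only [labelMessages, List.mem_flatMap, List.mem_map, List.mem_range, Prod.mk.injEq] at hi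
        obtain ⟨t', ht', k, hk, -, rfl⟩ := hi
        rw [labelWord_mod_two] at hw1
        omega
      · obtain ⟨d, -, hd⟩ := List.mem_map.1 hi
        rw [Prod.mk.injEq] at hd
        exact ⟨d.fst, d.fst.2, d.snd, d.snd.2, fun e => d.fst_ne_snd (Fin.ext e), hd.2.symm⟩
    · intro v hv
      -- The label of `v` comes from machine `v % M`, as its draw number `v / M`.
      refine mem_deliver.2 ⟨⟨v % P.M, Nat.mod_lt _ hM⟩, ?_⟩
      obtain ⟨t, ht, -, ho⟩ := hout₁ ⟨v % P.M, Nat.mod_lt _ hM⟩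
      rw [ho, List.mem_append]
      left
      have hv' : v % P.M + P.M * (v / P.M) = v := Nat.mod_add_div v P.M
      simp only [labelMessages, List.mem_flatMap, List.mem_map, List.mem_range, Prod.mk.injEq]
      exact ⟨v / P.M, (ht _).1 (by simpa [hv'] using hv), j, j.2, rfl, by rw [hv']⟩
  have hodd₁ : ∀ j, (I₁ j).filter (fun w => w % 2 = 1) = (L j).map dartWord := by
    intro j
    rw [hI₁, filter_odd_deliver, ← flatMap_finRange_single j fun i => (L i).map dartWord]
    refine List.flatMap_congr fun i _ => ?_
    obtain ⟨t, -, -, ho⟩ := hout₁ i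
    rw [ho, List.filter_append, List.map_append, List.filter_append]
    have h1 : (((labelMessages P lab i t).filter fun q => q.1 = (j : ℕ)).map Prod.snd).filter
        (fun w => w % 2 = 1) = [] := by
      rw [List.filter_eq_nil_iff]
      intro w hw
      obtain ⟨q, hq, rfl⟩ := List.mem_map.1 hw
      have hq := (List.mem_filter.1 hq).1
      simp only [labelMessages, List.mem_flatMap, List.mem_map, List.mem_range] at hq
      obtain ⟨t', -, k, -, rfl⟩ := hq
      simp [labelWord_mod_two]
    rw [h1, List.nil_append]
    split_ifs with hij
    · subst hij
      rw [List.filter_eq_self (p := fun q : ℕ × ℕ => decide (q.1 = (i : ℕ))).2 (by simp),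
        List.map_map]
      exact List.filter_eq_self.2 (by
        intro w hw
        obtain ⟨d, -, rfl⟩ := List.mem_map.1 hw
        simp [dartWord, edgeWord_mod_two])
    · rw [List.filter_eq_nil_iff (p := fun q : ℕ × ℕ => decide (q.1 = (j : ℕ))).2]
      · rfl
      · intro q hq
        obtain ⟨d, -, rfl⟩ := List.mem_map.1 hq
        simpa using fun e => hij (Fin.ext e)
  -- Each sender addresses one word per draw to machine `j`, and `M` times its number of draws is at
  -- most `n + M ≤ 2 * n`.
  have heven₁ : ∀ j, ((I₁ j).filter fun w => ¬ (decide (w % 2 = 1) = true)).length ≤ 2 * P.n := by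
    intro j
    rw [hI₁, filter_odd_deliver]
    refine (length_flatMap_finRange_le _ (P.n + P.M) fun i => ?_).trans (by omega)
    obtain ⟨t, -, ht, ho⟩ := hout₁ i
    refine (Nat.mul_le_mul_left _ (?_ : _ ≤ t)).trans ht
    rw [ho, List.filter_append, List.map_append, List.filter_append]
    have h1 : ((((L i).map fun d => ((i : ℕ), dartWord d)).filter fun q => q.1 = (j : ℕ)).map
        Prod.snd).filter (fun w => ¬ (decide (w % 2 = 1) = true)) = [] := by
      rw [List.filter_eq_nil_iff]
      intro w hw
      obtain ⟨q, hq, rfl⟩ := List.mem_map.1 hw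
      obtain ⟨d, -, rfl⟩ := List.mem_map.1 (List.mem_filter.1 hq).1
      simp [dartWord, edgeWord_mod_two]
    rw [h1, List.append_nil]
    refine (List.length_filter_le _ _).trans ?_
    rw [List.length_map, labelMessages, List.filter_flatMap]
    have h2 : ∀ t' : ℕ, ((List.range P.M).map fun k => (k, labelWord (labelCount P) (i + P.M * t')
        (lab (i + P.M * t')))).filter (fun q => q.1 = (j : ℕ)) =
        [((j : ℕ), labelWord (labelCount P) (i + P.M * t') (lab (i + P.M * t')))] := by
      intro t'
      rw [List.filter_map]
      have : (List.range P.M).filter ((fun q : ℕ × ℕ => decide (q.1 = (j : ℕ))) ∘ fun k =>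
          (k, labelWord (labelCount P) (i + P.M * t') (lab (i + P.M * t')))) = [(j : ℕ)] := by
        have h3 := flatMap_ite_single (List.nodup_range (n := P.M)) (List.mem_range.2 j.2)
          (fun k => [k])
        rw [flatMap_ite_eq_filter] at h3
        simpa [Function.comp_def] using h3
      rw [this]
      rfl
    simp [h2, List.length_flatMap]
  have hsplit : ∀ l : List ℕ, l.length = (l.filter fun w => w % 2 = 1).length +
      (l.filter fun w => ¬ (decide (w % 2 = 1) = true)).length := by
    intro l
    rw [List.length_eq_length_filter_add (l := l) fun w => decide (w % 2 = 1)]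
    congr 2
    exact List.filter_congr fun w _ => by by_cases h : w % 2 = 1 <;> simp [h]
  have hlen₁ : ∀ j, (I₁ j).length ≤ 2 * P.n + s := by
    intro j
    have h1 := heven₁ j
    have h2 := hL j
    rw [hsplit (I₁ j), hodd₁, List.length_map]
    omega
  obtain ⟨out₂, hout₂, hr₂⟩ := Round.of_total (P := P) (S := S) (W := W) (T := T) (p := .forward)
    (ρ := fun i t k => ω (i, 1, t, k)) (I := I₁) (Q := fun i out =>
      out = (I₁ i).map fun w => (forwardTo P lab i w, w)) (fun i => (hlen₁ i).trans (by omega))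
      (fun i => (Total.forward hR (hgood₁ i) ((hlen₁ i).trans (by omega))).mono (by
        have := hlen₁ i
        omega) fun _ h => h)
  refine ⟨I₁, deliver out₂, hr₁, hr₂, fun j => ?_⟩
  have hdel : deliver out₂ j = (List.finRange P.M).flatMap fun i =>
      (I₁ i).filter fun w => forwardTo P lab i w = j := by
    refine List.flatMap_congr fun i _ => ?_
    rw [hout₂ i, List.filter_map, List.map_map]
    simp [Function.comp_def]
  have hmem : ∀ w, w ∈ deliver out₂ j ↔ ∃ i, w ∈ I₁ i ∧ forwardTo P lab i w = j := by
    intro w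
    rw [hdel]
    simp
  have hodd₂ : (deliver out₂ j).filter (fun w => w % 2 = 1) = (routed lab L j).map dartWord := by
    rw [hdel, List.filter_flatMap, routed, List.map_flatMap]
    refine List.flatMap_congr fun i _ => ?_
    rw [List.filter_filter, List.filter_congr (q := fun w =>
      decide (forwardTo P lab i w = j) && decide (w % 2 = 1)) (fun w _ => Bool.and_comm _ _),
      ← List.filter_filter, hodd₁, List.filter_map]
    congr 1
    refine List.filter_congr fun d _ => ?_
    simp [forwardTo_dartWord]
  -- Label words travel only from a machine to itself, so their list is unchanged by the second
  -- round.
  have heven₂ : (deliver out₂ j).filter (fun w => ¬ (decide (w % 2 = 1) = true)) =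
      (I₁ j).filter fun w => ¬ (decide (w % 2 = 1) = true) := by
    rw [hdel, List.filter_flatMap, ← flatMap_finRange_single j fun i =>
      (I₁ i).filter fun w => ¬ (decide (w % 2 = 1) = true)]
    refine List.flatMap_congr fun i _ => ?_
    rw [List.filter_filter]
    split_ifs with hij
    · subst hij
      refine List.filter_congr fun w _ => ?_
      by_cases hw : w % 2 = 1 <;> simp [forwardTo, hw]
    · rw [List.filter_eq_nil_iff]
      intro w _
      by_cases hw : w % 2 = 1
      · simp [hw]
      · have : (i : ℕ) ≠ j := fun e => hij (Fin.ext e)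
        simp [forwardTo, hw, this]
  refine ⟨⟨hlab, ?_, ?_, ?_⟩, ?_, hodd₂⟩
  · intro w hw h0
    obtain ⟨i, hi, -⟩ := (hmem w).1 hw
    exact (hgood₁ i).even w hi h0
  · intro w hw h0
    obtain ⟨i, hi, -⟩ := (hmem w).1 hw
    exact (hgood₁ i).odd w hi h0
  · intro v hv
    refine (hmem _).2 ⟨j, (hgood₁ j).mem v hv, ?_⟩
    simp [forwardTo, labelWord_mod_two]
  · rw [hsplit, hodd₂, heven₂, List.length_map]
    have := hΛ j
    have := heven₁ j
    omega

end

end MapReduce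

namespace MapReduce

/-! ## The output of the third round -/

theorem sum_map_finRange {M : ℕ} (f : Fin M → ℕ) : ((List.finRange M).map f).sum = ∑ i, f i := by
  rw [← List.ofFn_eq_map, List.sum_ofFn]

theorem eq_of_getD_eq {I : List ℕ} {p : ℕ → Bool} (h : (I.filter p).Nodup) {a b : ℕ}
    (ha : a < I.length) (hb : b < I.length) (hp : p (I.getD a 0)) (hab : I.getD a 0 = I.getD b 0) :
    a = b := by
  rw [List.Nodup, List.pairwise_filter, List.pairwise_iff_getElem] at h
  rw [List.getD_eq_getElem _ _ ha] at hp hab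
  rw [List.getD_eq_getElem _ _ hb] at hab
  rcases lt_trichotomy a b with hlt | heq | hlt
  · exact absurd hab (h a b ha hb hlt hp (hab ▸ hp))
  · exact heq
  · exact absurd hab.symm (h b a hb ha hlt (hab ▸ hp) hp)

section
variable {P : Params} {G : SimpleGraph (Fin P.n)} {lab : ℕ → ℕ} {S W D : ℕ}

/-- The destination is a function of the dart, so every dart lands on exactly one machine. Counting
occurrences of an edge over senders and receivers and exchanging the two sums gives the count in
`L`. -/
theorem listsEdges_routed {L : Fin P.M → List G.Dart} (hM : 1 ≤ P.M) (hL : ListsEdges G L) :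
    ListsEdges G (routed lab L) := by
  intro e he
  rw [← hL e he, List.map_flatMap, List.map_flatMap, List.count_flatMap, List.count_flatMap,
    sum_map_finRange, sum_map_finRange]
  have h1 : ∀ j, (List.count e ∘ fun j => (routed lab L j).map SimpleGraph.Dart.edge) j =
      ∑ i, List.count e (((L i).filter fun d => dartRoute lab d = j).map SimpleGraph.Dart.edge) := by
    intro j
    rw [Function.comp_apply, routed, List.map_flatMap, List.count_flatMap, sum_map_finRange]
    rfl
  simp only [h1]
  rw [Finset.sum_comm]
  refine Finset.sum_congr rfl fun i _ => ?_
  rw [Function.comp_apply]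
  induction L i with
  | nil => simp
  | cons d l ih =>
    have hd : dartRoute lab d < P.M := Nat.mod_lt _ hM
    have h2 : ∀ j : Fin P.M, List.count e (((d :: l).filter fun d => dartRoute lab d = j).map
        SimpleGraph.Dart.edge) = (if (⟨_, hd⟩ : Fin P.M) = j then List.count e [d.edge] else 0) +
        List.count e ((l.filter fun d => dartRoute lab d = j).map SimpleGraph.Dart.edge) := by
      intro j
      by_cases h : dartRoute lab d = j
      · have h' : (⟨_, hd⟩ : Fin P.M) = j := Fin.ext h
        rw [List.filter_cons_of_pos (by simpa using h), if_pos h', List.map_cons,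
          ← List.singleton_append, List.count_append]
      · have h' : (⟨_, hd⟩ : Fin P.M) ≠ j := fun e => h (congrArg Fin.val e)
        rw [List.filter_cons_of_neg (by simpa using h), if_neg h', zero_add]
    simp only [h2]
    rw [Finset.sum_add_distrib, ih, List.map_cons, ← List.singleton_append (l := l.map _),
      List.count_append]
    simp

theorem mem_routed {L : Fin P.M → List G.Dart} {j : Fin P.M} {d : G.Dart}
    (h : d ∈ routed lab L j) : dartRoute lab d = j := by
  simp only [routed, List.mem_flatMap, List.mem_filter, decide_eq_true_eq] at h
  obtain ⟨i, -, -, h⟩ := h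
  exact h

theorem nodup_map_edge {E : Fin P.M → List G.Dart} (hE : ListsEdges G E) (j : Fin P.M) :
    ((E j).map SimpleGraph.Dart.edge).Nodup := by
  rw [List.nodup_iff_count_le_one]
  intro e
  by_cases he : e ∈ G.edgeSet
  · rw [← hE e he, List.map_flatMap, List.count_flatMap, sum_map_finRange]
    exact Finset.single_le_sum (f := List.count e ∘ fun j => (E j).map SimpleGraph.Dart.edge)
      (fun _ _ => Nat.zero_le _) (Finset.mem_univ j)
  · rw [List.count_eq_zero_of_not_mem]
    · exact zero_le_one
    · intro h
      obtain ⟨d, -, rfl⟩ := List.mem_map.1 h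
      exact he d.edge_mem

theorem nodup_map_dartWord {E : List G.Dart} (h : (E.map SimpleGraph.Dart.edge).Nodup) :
    (E.map dartWord).Nodup := by
  rw [List.Nodup, List.pairwise_map] at h ⊢
  exact h.imp fun h e => h (edge_eq_of_dartWord_eq e)

/-- The inbox `I` of a machine in the third round when it is responsible for the edges in `E`. -/
structure Inbox (P : Params) (G : SimpleGraph (Fin P.n)) (lab : ℕ → ℕ) (I : List ℕ)
    (E : List G.Dart) : Prop where
  good : GoodInbox P lab I
  filter_odd : I.filter (fun w => w % 2 = 1) = E.map dartWord
  nodup : (E.map SimpleGraph.Dart.edge).Nodup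

variable {I : List ℕ} {E : List G.Dart}

theorem Inbox.exists_dart (h : Inbox P G lab I E) {k : ℕ} (hk : k < I.length)
    (hodd : IsEdgeIndex I k) : ∃ d ∈ E, I.getD k 0 = dartWord d := by
  have : I.getD k 0 ∈ I.filter fun w => w % 2 = 1 := by
    refine List.mem_filter.2 ⟨?_, decide_eq_true hodd⟩
    rw [List.getD_eq_getElem _ _ hk]
    exact List.getElem_mem hk
  rw [h.filter_odd] at this
  obtain ⟨d, hd, he⟩ := List.mem_map.1 this
  exact ⟨d, hd, he.symm⟩

theorem Inbox.exists_index (h : Inbox P G lab I E) {d : G.Dart} (hd : d ∈ E) :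
    ∃ k < I.length, IsEdgeIndex I k ∧ I.getD k 0 = dartWord d := by
  have : dartWord d ∈ I.filter fun w => w % 2 = 1 := by
    rw [h.filter_odd]
    exact List.mem_map_of_mem hd
  obtain ⟨hmem, hodd⟩ := List.mem_filter.1 this
  obtain ⟨k, hk, he⟩ := List.getElem_of_mem hmem
  refine ⟨k, hk, ?_, by rw [List.getD_eq_getElem _ _ hk, he]⟩
  rw [IsEdgeIndex, List.getD_eq_getElem _ _ hk, he]
  simpa using hodd

theorem Inbox.index_eq (h : Inbox P G lab I E) {a b : ℕ} (ha : a < I.length) (hb : b < I.length)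
    (hodd : IsEdgeIndex I a) (hab : I.getD a 0 = I.getD b 0) : a = b :=
  eq_of_getD_eq (p := fun w => w % 2 = 1) (h.filter_odd ▸ nodup_map_dartWord h.nodup) ha hb
    (decide_eq_true hodd) hab

/-! ### From label degrees to degrees in the classes. -/

open Classical in
/-- The number of neighbours of `v` with label `l`. -/
noncomputable def labelDegree (G : SimpleGraph (Fin P.n)) (lab : ℕ → ℕ) (v : Fin P.n) (l : ℕ) : ℕ :=
  (Finset.univ.filter fun w => G.Adj v w ∧ lab w = l).card

theorem word_eq {n w w' : ℕ} (hw : w % 2 = 1) (hw' : w' % 2 = 1) (h1 : src n w = src n w')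
    (h2 : dst n w = dst n w') : w = w' := by
  have h := Nat.div_add_mod (w / 2) n
  have h' := Nat.div_add_mod (w' / 2) n
  rw [src, src] at h1
  rw [dst, dst] at h2
  rw [h1, h2, h'] at h
  omega

theorem src_dst_cases (d : G.Dart) : (src P.n (dartWord d) = d.fst ∧ dst P.n (dartWord d) = d.snd) ∨
    (src P.n (dartWord d) = d.snd ∧ dst P.n (dartWord d) = d.fst) := by
  rw [src_dartWord, dst_dartWord]
  omega

open Classical in
-- All neighbours of `x` in the class `r` have one common label: that of `x` if `r = q`, and `r -
-- lab x` mod `q` otherwise. Sending an edge to its other end is injective, so the class degree is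
-- at most one label degree.
theorem Inbox.classDegreeLe (h : Inbox P G lab I E) (hX : ∀ v l, labelDegree G lab v l ≤ D) :
    ClassDegreeLe P lab I D := by
  intro x hx r
  set q := labelCount P with hq
  refine le_trans ?_ (hX ⟨x, hx⟩ (if r = q then lab x else (r + q - lab x) % q))
  refine (?_ : _ ≤ (((Finset.univ.filter fun w : Fin P.n => G.Adj ⟨x, hx⟩ w ∧
    lab w = if r = q then lab x else (r + q - lab x) % q).image Fin.val).card)).trans
    Finset.card_image_le
  refine Finset.card_le_card_of_injOn
    (fun e => if srcAt P I e = x then dstAt P I e else srcAt P I e) ?_ ?_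
  · intro e he
    simp only [Finset.coe_filter, Finset.mem_range, Set.mem_ofPred_eq] at he
    obtain ⟨heN, hodd, hkey, hend⟩ := he
    have hs := h.good.lab_lt _ (h.good.srcAt_lt hodd)
    have hd := h.good.lab_lt _ (h.good.dstAt_lt hodd)
    have hlt : srcAt P I e < dstAt P I e := (h.good.getD_lt hodd).1
    obtain ⟨d, -, hde⟩ := h.exists_dart heN hodd
    have hadj : ∀ (a b : ℕ) (ha : a < P.n) (hb : b < P.n),
        (a = srcAt P I e ∧ b = dstAt P I e) ∨ (a = dstAt P I e ∧ b = srcAt P I e) →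
        G.Adj ⟨a, ha⟩ ⟨b, hb⟩ := by
      intro a b ha hb hab
      rw [srcAt, dstAt, hde] at hab
      have : ((⟨a, ha⟩ : Fin P.n) = d.fst ∧ (⟨b, hb⟩ : Fin P.n) = d.snd) ∨
          ((⟨a, ha⟩ : Fin P.n) = d.snd ∧ (⟨b, hb⟩ : Fin P.n) = d.fst) := by
        simp only [Fin.ext_iff]
        rcases src_dst_cases d with h | h <;> omega
      rcases this with ⟨h1, h2⟩ | ⟨h1, h2⟩
      · rw [h1, h2]; exact d.adj
      · rw [h1, h2]; exact d.adj.symm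
    have hlab : ∀ a b, (a = srcAt P I e ∧ b = dstAt P I e) ∨ (a = dstAt P I e ∧ b = srcAt P I e) →
        lab b = if r = q then lab a else (r + q - lab a) % q := by
      intro a b hab
      rw [keyAt, key] at hkey
      change (if lab (srcAt P I e) = lab (dstAt P I e) then q else
        (lab (srcAt P I e) + lab (dstAt P I e)) % q) = r at hkey
      have hq1 : 0 < q := by omega
      split_ifs at hkey with hsame
      · rw [if_pos hkey.symm]
        rcases hab with ⟨rfl, rfl⟩ | ⟨rfl, rfl⟩
        · exact hsame.symm
        · exact hsame
      · have hrq : r ≠ q := by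
          rw [← hkey]
          exact (Nat.mod_lt _ hq1).ne
        rw [if_neg hrq, ← hkey]
        rcases hab with ⟨rfl, rfl⟩ | ⟨rfl, rfl⟩
        · rw [mod_add_sub_cancel hs hd]
        · rw [add_comm (lab (srcAt P I e)), mod_add_sub_cancel hd hs]
    have hsn := h.good.srcAt_lt hodd
    have hdn := h.good.dstAt_lt hodd
    simp only [Finset.coe_image, Set.mem_image, Finset.coe_filter, Finset.mem_univ, true_and,
      Set.mem_ofPred_eq]
    by_cases hsx : srcAt P I e = x
    · rw [if_pos hsx]
      exact ⟨⟨_, hdn⟩, ⟨hadj _ _ _ _ (.inl ⟨hsx.symm, rfl⟩), hlab _ _ (.inl ⟨hsx.symm, rfl⟩)⟩, rfl⟩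
    · have hdx : dstAt P I e = x := hend.resolve_left hsx
      rw [if_neg hsx]
      exact ⟨⟨_, hsn⟩, ⟨hadj _ _ _ _ (.inr ⟨hdx.symm, rfl⟩), hlab _ _ (.inr ⟨hdx.symm, rfl⟩)⟩, rfl⟩
  · intro e he f hf hef
    simp only [Finset.coe_filter, Finset.mem_range, Set.mem_ofPred_eq] at he hf
    obtain ⟨heN, hodde, -, hende⟩ := he
    obtain ⟨hfN, hoddf, -, hendf⟩ := hf
    have h1 : srcAt P I e < dstAt P I e := (h.good.getD_lt hodde).1
    have h2 : srcAt P I f < dstAt P I f := (h.good.getD_lt hoddf).1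
    have hboth : srcAt P I e = srcAt P I f ∧ dstAt P I e = dstAt P I f := by
      unfold IsEnd at hende hendf
      simp only at hef
      split_ifs at hef <;> omega
    exact h.index_eq heN hfN hodde (word_eq hodde hoddf hboth.1 hboth.2)

theorem ClassDegreeLe.backDegreeLe (h : ClassDegreeLe P lab I D) : BackDegreeLe P lab I D := by
  intro v hv
  refine le_trans (Finset.card_le_card ?_) (h v hv (labelCount P))
  intro e he
  simp only [Finset.mem_filter, Finset.mem_range] at he ⊢
  refine ⟨he.1, he.2.1, ?_, .inr he.2.2.2⟩
  rw [keyAt, key]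
  exact if_pos he.2.2.1

/-! ### Putting the colourings of the machines together. -/

/-- The dart of an edge. -/
noncomputable def dartOf (e : G.edgeSet) : G.Dart :=
  Classical.choose (show ∃ d : G.Dart, d.edge = e by
    obtain ⟨e, he⟩ := e
    induction e with
    | h u v => exact ⟨⟨(u, v), he⟩, rfl⟩)

theorem edge_dartOf (e : G.edgeSet) : (dartOf e).edge = e :=
  Classical.choose_spec (show ∃ d : G.Dart, d.edge = e by
    obtain ⟨e, he⟩ := e
    induction e with
    | h u v => exact ⟨⟨(u, v), he⟩, rfl⟩)

/-- The dart with the same edge that leads from the smaller endpoint to the larger one. -/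
def sortDart (d : G.Dart) : G.Dart := if d.fst < d.snd then d else d.symm

theorem edge_sortDart (d : G.Dart) : (sortDart d).edge = d.edge := by
  unfold sortDart
  split_ifs
  · rfl
  · exact d.edge_symm

theorem sortDart_ends (d : G.Dart) : ((sortDart d).fst : ℕ) = src P.n (dartWord d) ∧
    ((sortDart d).snd : ℕ) = dst P.n (dartWord d) := by
  rw [src_dartWord, dst_dartWord, sortDart]
  split_ifs with h
  · have h' : (d.fst : ℕ) < d.snd := h
    exact ⟨(min_eq_left h'.le).symm, (max_eq_right h'.le).symm⟩
  · have h' : (d.snd : ℕ) ≤ d.fst := not_lt.1 h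
    exact ⟨(min_eq_right h').symm, (max_eq_left h').symm⟩

theorem exists_mem_of_listsEdges {E : Fin P.M → List G.Dart} (hE : ListsEdges G E) {d : G.Dart} :
    ∃ j, ∃ d' ∈ E j, d'.edge = d.edge := by
  have h := hE d.edge d.edge_mem
  have : d.edge ∈ ((List.finRange P.M).flatMap E).map SimpleGraph.Dart.edge :=
    List.count_pos_iff.1 (by omega)
  obtain ⟨d', hd', he⟩ := List.mem_map.1 this
  obtain ⟨j, -, hj⟩ := List.mem_flatMap.1 hd'
  exact ⟨j, d', hj, he⟩

theorem dartRoute_eq_of_edge_eq {d d' : G.Dart} (h : d.edge = d'.edge) :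
    dartRoute lab d = dartRoute lab d' := by
  rw [← forwardTo_dartWord 0, ← forwardTo_dartWord 0, dartWord_eq_of_edge_eq h]

theorem getD_flatMap_range {α : Type*} (I : List ℕ) (f : ℕ → List α) :
    ((List.range I.length).flatMap fun k => f (I.getD k 0)) = I.flatMap f := by
  have : (List.range I.length).map (fun k => I.getD k 0) = I := by
    refine List.ext_getElem (by simp) fun k h1 h2 => ?_
    simp [List.getElem?_eq_getElem h2]
  conv_rhs => rw [← this, List.flatMap_map]

theorem ncard_range_le_of_code {α : Type*} (χ : α → ℕ) (s : Finset ℕ) (h : ∀ x, χ x ∈ s) :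
    (Set.range χ).ncard ≤ s.card := by
  rw [← Set.ncard_coe_finset]
  refine Set.ncard_le_ncard ?_ (Finset.finite_toSet s)
  rintro _ ⟨x, rfl⟩
  exact h x

/-- The colouring of the edges put together from those of the machines. -/
theorem isEdgeColouringOutput {E : Fin P.M → List G.Dart} {I J : Data P.M} {C : Fin P.M → ℕ → ℕ}
    (hq : 1 ≤ labelCount P) (hE : ListsEdges G E) (hroute : ∀ j, ∀ d ∈ E j, dartRoute lab d = j)
    (hI : ∀ j, Inbox P G lab (I j) (E j))
    (hp : ∀ j, Proper (IsEdgeIndex (I j)) (srcAt P (I j)) (dstAt P (I j)) (keyAt P lab (I j)) (C j)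
      (I j).length)
    (hC : ∀ j, Bounded P lab (I j) D (C j) (I j).length)
    (hJ : ∀ j, J j = ((List.range (I j).length).flatMap (edgeRecord P lab j (I j) (C j))).map
      Prod.snd) {K : ℝ} (hK : ((labelCount P * (D + 1) + (2 * D + 1) : ℕ) : ℝ) ≤ K) :
    IsEdgeColouringOutput G K J := by
  classical
  set q := labelCount P with hqdef
  -- Colours are stored by position in the inbox. Edge words occur there only once, so they can be
  -- reindexed by the word, and thus by the edge.
  have hex : ∀ j, ∃ c : ℕ → ℕ, ∀ k < (I j).length, IsEdgeIndex (I j) k →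
      c ((I j).getD k 0) = C j k := by
    intro j
    refine ⟨fun w => if h : ∃ k < (I j).length, IsEdgeIndex (I j) k ∧ (I j).getD k 0 = w then
      C j (Classical.choose h) else 0, fun k hk hodd => ?_⟩
    have h : ∃ k' < (I j).length, IsEdgeIndex (I j) k' ∧ (I j).getD k' 0 = (I j).getD k 0 :=
      ⟨k, hk, hodd, rfl⟩
    simp only [dif_pos h]
    obtain ⟨h1, h2, h3⟩ := Classical.choose_spec h
    rw [(hI j).index_eq h1 hk h2 h3]
  choose c hc using hex
  -- every edge has a machine and an index
  have hfind : ∀ d : G.Dart, ∃ j, ∃ k < (I j).length, IsEdgeIndex (I j) k ∧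
      (I j).getD k 0 = dartWord d ∧ dartRoute lab d = j := by
    intro d
    obtain ⟨j, d', hd', he⟩ := exists_mem_of_listsEdges hE (d := d)
    obtain ⟨k, hk, hodd, hw⟩ := (hI j).exists_index hd'
    exact ⟨j, k, hk, hodd, hw.trans (dartWord_eq_of_edge_eq he),
      (dartRoute_eq_of_edge_eq he).symm.trans (hroute j d' hd')⟩
  set col : G.Dart → ℕ := fun d => if h : dartRoute lab d < P.M then
    c ⟨_, h⟩ (dartWord d) * (q + 1) + key lab q P.n (dartWord d) else 0 with hcol
  have hcol_eq : ∀ (j : Fin P.M) (d : G.Dart), dartRoute lab d = j →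
      col d = c j (dartWord d) * (q + 1) + key lab q P.n (dartWord d) := by
    intro j d h
    have h' : dartRoute lab d < P.M := h ▸ j.2
    have : (⟨_, h'⟩ : Fin P.M) = j := Fin.ext h
    simp only [hcol, dif_pos h', this]
  have hcol_edge : ∀ d d' : G.Dart, d.edge = d'.edge → col d = col d' := by
    intro d d' h
    simp only [hcol, dartRoute_eq_of_edge_eq h, dartWord_eq_of_edge_eq h]
  have hkeylt : ∀ w, key lab q P.n w < q + 1 := fun w => Nat.lt_succ_of_le (key_le hq)
  let χ : G.lineGraph.Coloring ℕ := SimpleGraph.Coloring.mk (fun e => col (dartOf e)) (by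
    intro e f hef heq
    rw [SimpleGraph.lineGraph_adj_iff_exists] at hef
    obtain ⟨hne, x, hxe, hxf⟩ := hef
    rw [← edge_dartOf e] at hxe
    rw [← edge_dartOf f] at hxf
    have hned : (dartOf e).edge ≠ (dartOf f).edge := by
      rw [edge_dartOf, edge_dartOf]
      exact fun h => hne (Subtype.ext h)
    generalize dartOf e = d at *
    generalize dartOf f = d' at *
    obtain ⟨j, a, ha, hodda, hwa, hra⟩ := hfind d
    obtain ⟨j', b, hb, hoddb, hwb, hrb⟩ := hfind d'
    rw [hcol_eq j d hra, hcol_eq j' d' hrb] at heq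
    have hkey : key lab q P.n (dartWord d) = key lab q P.n (dartWord d') := by
      have := congrArg (· % (q + 1)) heq
      simpa [Nat.mul_add_mod_of_lt, Nat.mul_add_mod', Nat.mod_eq_of_lt (hkeylt _)] using this
    have hcc : c j (dartWord d) = c j' (dartWord d') := by
      rw [hkey] at heq
      exact Nat.eq_of_mul_eq_mul_right (Nat.succ_pos q) (Nat.add_right_cancel heq)
    have hendd : ∀ (d : G.Dart), x ∈ d.edge → (x : ℕ) = src P.n (dartWord d) ∨
        (x : ℕ) = dst P.n (dartWord d) := by
      intro d hx
      have hx' : x = d.fst ∨ x = d.snd := by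
        rw [SimpleGraph.Dart.edge] at hx
        exact Sym2.mem_iff.1 hx
      rcases src_dst_cases d with h | h <;> rcases hx' with rfl | rfl <;> simp [h]
    have hrt : ∀ d : G.Dart, dartRoute lab d =
        (lab (src P.n (dartWord d)) + lab (dst P.n (dartWord d))) % q % P.M := by
      intro d
      have h : dartWord d % 2 = 1 := edgeWord_mod_two _ _ _
      rw [← forwardTo_dartWord 0 d, forwardTo, if_pos h]
      rfl
    -- Equal classes that meet are on one machine. Off the last class the machine is the class
    -- number mod `M`; in the last class the common vertex passes its label on to all ends of both
    -- edges.
    have hroutes : dartRoute lab d = dartRoute lab d' := by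
      rw [hrt, hrt]
      have hqlt : ∀ a : ℕ, a % q ≠ q := fun a => (Nat.mod_lt _ hq).ne
      unfold key at hkey
      split_ifs at hkey with h1 h2 h2
      · have : lab (src P.n (dartWord d)) = lab (src P.n (dartWord d')) := by
          rcases hendd d hxe with h3 | h3 <;> rcases hendd d' hxf with h4 | h4 <;>
            rw [h3] at h4
          · rw [h4]
          · rw [h4, h2]
          · rw [h1, h4]
          · rw [h1, h4, h2]
        rw [← h1, ← h2, this]
      · exact absurd hkey.symm (hqlt _)
      · exact absurd hkey (hqlt _)
      · rw [hkey]
    have hjj : j = j' := Fin.ext (hra.symm.trans (hroutes.trans hrb))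
    subst hjj
    have hab : a ≠ b := by
      rintro rfl
      exact hned (edge_eq_of_dartWord_eq (hwa.symm.trans hwb))
    refine hp j a ha b hb hodda hoddb hab ?_ x ?_ ?_ ?_
    · rw [keyAt, keyAt, hwa, hwb]
      exact hkey
    · rw [IsEnd, srcAt, dstAt, hwa]
      rcases hendd d hxe with h | h
      · exact .inl h.symm
      · exact .inr h.symm
    · rw [IsEnd, srcAt, dstAt, hwb]
      rcases hendd d' hxf with h | h
      · exact .inl h.symm
      · exact .inr h.symm
    · rw [← hc j a ha hodda, ← hc j b hb hoddb, hwa, hwb, hcc])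
  have hχ : ∀ e, χ e = col (dartOf e) := fun _ => rfl
  refine ⟨χ, fun j => (E j).map sortDart, ?_, ?_, ?_⟩
  -- There are `D + 1` colours for each of the `q` bipartite classes and `2 * D + 1` for the last
  -- class.
  · refine le_trans (Nat.cast_le.2 ((ncard_range_le_of_code χ
      (((Finset.range q ×ˢ Finset.range (D + 1)).image fun p => p.2 * (q + 1) + p.1) ∪
      (Finset.range (2 * D + 1)).image fun a => a * (q + 1) + q) ?_).trans ?_)) hK
    · intro e
      rw [hχ]
      obtain ⟨j, a, ha, hodda, hwa, hra⟩ := hfind (dartOf e)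
      rw [hcol_eq j _ hra, ← hwa, hc j a ha hodda]
      have hb := hC j a ha hodda
      rw [keyAt, ← hqdef] at hb
      rw [Finset.mem_union, Finset.mem_image, Finset.mem_image]
      by_cases hkq : key lab q P.n ((I j).getD a 0) = q
      · rw [if_pos hkq] at hb
        exact .inr ⟨C j a, Finset.mem_range.2 (by omega), by rw [hkq]⟩
      · rw [if_neg hkq] at hb
        have := hkeylt ((I j).getD a 0)
        refine .inl ⟨(key lab q P.n ((I j).getD a 0), C j a), ?_, rfl⟩
        simp only [Finset.mem_product, Finset.mem_range]
        omega
    · refine (Finset.card_union_le _ _).trans (Nat.add_le_add (Finset.card_image_le.trans ?_)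
        (Finset.card_image_le.trans ?_)) <;> simp
  · intro e he
    rw [← hE e he]
    have : ((List.finRange P.M).flatMap fun j => (E j).map sortDart).map SimpleGraph.Dart.edge =
        ((List.finRange P.M).flatMap E).map SimpleGraph.Dart.edge := by
      simp only [List.map_flatMap, List.map_map]
      refine List.flatMap_congr fun j _ => List.map_congr_left fun d _ => edge_sortDart d
    rw [this]
  · intro j
    rw [hJ j, List.map_flatMap, List.flatMap_map]
    set rec : ℕ → List ℕ := fun w => if w % 2 = 1 then
      [src P.n w, dst P.n w, c j w * (q + 1) + key lab q P.n w] else [] with hrec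
    have h1 : ((List.range (I j).length).flatMap fun k =>
        (edgeRecord P lab j (I j) (C j) k).map Prod.snd) = (I j).flatMap rec := by
      rw [← getD_flatMap_range (I j) rec]
      refine List.flatMap_congr fun k hk => ?_
      rw [edgeRecord, hrec]
      by_cases hodd : (I j).getD k 0 % 2 = 1
      · simp only [if_pos hodd, List.map_cons, List.map_nil]
        rw [hc j k (List.mem_range.1 hk) hodd]
        rfl
      · simp only [if_neg hodd, List.map_nil]
    rw [h1, hrec, flatMap_ite_eq_filter, (hI j).filter_odd, List.flatMap_map]
    refine List.flatMap_congr fun d hd => ?_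
    rw [(sortDart_ends d).1, (sortDart_ends d).2, hχ]
    have h2 : col (dartOf ⟨(sortDart d).edge, (sortDart d).edge_mem⟩) = col d :=
      hcol_edge _ _ ((edge_dartOf _).trans (edge_sortDart d))
    rw [h2, hcol_eq j d (hroute j d hd)]

/-- The colouring of the vertices put together from those of the machines. -/
theorem isVertexColouringOutput {E : Fin P.M → List G.Dart} {I J : Data P.M} {c : Fin P.M → ℕ → ℕ}
    (hM : 1 ≤ P.M) (hE : ListsEdges G E) (hroute : ∀ j, ∀ d ∈ E j, dartRoute lab d = j)
    (hI : ∀ j, Inbox P G lab (I j) (E j)) (hlab : ∀ v < P.n, lab v < labelCount P)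
    (hp : ∀ j : Fin P.M, ∀ e < (I j).length, IsEdgeIndex (I j) e →
      lab (srcAt P (I j) e) = lab (dstAt P (I j) e) →
      route P.M (labelCount P) (lab (dstAt P (I j) e)) (lab (dstAt P (I j) e)) = j →
      c j (srcAt P (I j) e) ≠ c j (dstAt P (I j) e))
    (hC : ∀ j : Fin P.M, ∀ v < P.n, route P.M (labelCount P) (lab v) (lab v) = j → c j v ≤ D)
    (hJ : ∀ j, J j = ((List.range P.n).flatMap (vertexRecord P lab j (c j))).map Prod.snd) {K : ℝ}
    (hK : ((labelCount P * (D + 1) : ℕ) : ℝ) ≤ K) : IsVertexColouringOutput G K J := by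
  classical
  set q := labelCount P with hqdef
  set m : Fin P.n → Fin P.M := fun v => ⟨route P.M q (lab v) (lab v), Nat.mod_lt _ hM⟩ with hm
  let χ : G.Coloring ℕ := SimpleGraph.Coloring.mk (fun v => c (m v) v * q + lab v) (by
    intro u v huv heq
    have hu := hlab u u.2
    have hv := hlab v v.2
    have hl : lab u = lab v := by
      have := congrArg (· % q) heq
      simpa [Nat.mul_add_mod', Nat.mod_eq_of_lt hu, Nat.mod_eq_of_lt hv] using this
    have hcc : c (m u) u = c (m v) v := by
      rw [hl] at heq
      exact Nat.eq_of_mul_eq_mul_right (by omega) (Nat.add_right_cancel heq)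
    have hmm : m u = m v := by simp only [hm, hl]
    rw [hmm] at hcc
    -- Equal colours force equal labels. Then the edge `uv` lies on the machine that coloured both
    -- `u` and `v`, where they received different colours.
    obtain ⟨j, d, hd, he⟩ := exists_mem_of_listsEdges hE (d := ⟨(u, v), huv⟩)
    have hdr := hroute j d hd
    rw [dartRoute_eq_of_edge_eq he, dartRoute] at hdr
    have hj : m v = j := Fin.ext (by
      rw [← hdr]
      simp [hm, hl, hqdef])
    obtain ⟨k, hk, hodd, hw⟩ := (hI j).exists_index hd
    rw [dartWord_eq_of_edge_eq he] at hw
    have hpk := hp j k hk hodd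
    rw [srcAt, dstAt, hw] at hpk
    have hr : ∀ w : Fin P.n, lab w = lab v → route P.M q (lab w) (lab w) = j := by
      intro w h
      rw [h, ← hj]
    rcases src_dst_cases (⟨(u, v), huv⟩ : G.Dart) with ⟨h1, h2⟩ | ⟨h1, h2⟩
    · rw [h1, h2] at hpk
      exact hpk hl (hr v rfl) (hj ▸ hcc)
    · rw [h1, h2] at hpk
      exact hpk hl.symm (hr u hl) (hj ▸ hcc.symm))
  have hχ : ∀ v, χ v = c (m v) v * q + lab v := fun _ => rfl
  refine ⟨χ, fun j => (List.finRange P.n).filter fun v => m v = j, ?_, ?_, ?_⟩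
  · refine le_trans (Nat.cast_le.2 ((ncard_range_le_of_code χ
      ((Finset.range q ×ˢ Finset.range (D + 1)).image fun p => p.2 * q + p.1) ?_).trans ?_)) hK
    · intro v
      rw [hχ, Finset.mem_image]
      refine ⟨(lab v, c (m v) v), ?_, rfl⟩
      simp only [Finset.mem_product, Finset.mem_range]
      exact ⟨hlab v v.2, Nat.lt_succ_of_le (hC (m v) v v.2 rfl)⟩
    · exact Finset.card_image_le.trans (by simp)
  · intro v
    rw [List.count_flatMap, sum_map_finRange]
    have : ∀ j, (List.count v ∘ fun j => (List.finRange P.n).filter fun v => m v = j) j =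
        if m v = j then 1 else 0 := by
      intro j
      rw [Function.comp_apply]
      split_ifs with h
      · rw [List.count_filter (by simpa using h)]
        exact List.count_eq_one_of_mem (List.nodup_finRange _) (List.mem_finRange v)
      · refine List.count_eq_zero_of_not_mem fun hv => h ?_
        simpa using (List.mem_filter.1 hv).2
    rw [Finset.sum_congr rfl fun j _ => this j]
    simp
  · intro j
    rw [hJ j, List.map_flatMap, ← List.map_coe_finRange_eq_range, List.flatMap_map, ← flatMap_ite_eq_filter]
    refine List.flatMap_congr fun v _ => ?_
    have : (m v = j) ↔ route P.M q (lab v) (lab v) = j := Fin.ext_iff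
    rw [vertexRecord]
    by_cases h : m v = j
    · rw [if_pos h, if_pos (this.1 h), hχ, h]
      rfl
    · rw [if_neg h, if_neg fun h' => h (this.2 h')]
      rfl

end

end MapReduce

namespace MapReduce

/-! ## The algorithms -/

def vertexAlgorithm : List Cmd := [.announce, .forward, .vertexColouring]

def edgeAlgorithm : List Cmd := [.announce, .forward, .edgeColouring]

/-- The label drawn for the vertex `v`. -/
def labelOf (P : Params) (ω : Coins P.M) (v : ℕ) : ℕ :=
  if h : v % P.M < P.M then (ω (⟨v % P.M, h⟩, 0, v / P.M, labelCount P - 1) : ℕ) else 0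

theorem labelOf_lt {P : Params} (hq : 1 ≤ labelCount P) (ω : Coins P.M) (v : ℕ) :
    labelOf P ω v < labelCount P := by
  unfold labelOf
  split_ifs with h
  · have := (ω (⟨v % P.M, h⟩, 0, v / P.M, labelCount P - 1)).2
    simp only at this
    omega
  · omega

theorem labelOf_add_mul {P : Params} (ω : Coins P.M) (i : Fin P.M) (t : ℕ) :
    labelOf P ω (i + P.M * t) = ω (i, 0, t, labelCount P - 1) := by
  have h1 : (i + P.M * t) % P.M = i := by
    rw [Nat.add_mul_mod_self_left, Nat.mod_eq_of_lt i.2]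
  have hM : 0 < P.M := i.pos
  have h2 : (i + P.M * t) / P.M = t := by
    rw [Nat.add_mul_div_left _ _ hM, Nat.div_eq_of_lt i.2, zero_add]
  have h3 : (i + P.M * t) % P.M < P.M := by rw [h1]; exact i.2
  have h4 : (⟨(i + P.M * t) % P.M, h3⟩ : Fin P.M) = i := Fin.ext h1
  rw [labelOf, dif_pos h3, h4, h2]

/-- The parameters are in the range considered here. -/
structure Params.Moderate (P : Params) : Prop where
  n_ge : 100 ≤ P.n
  M_pos : 1 ≤ P.M
  M_le : P.M ≤ P.n
  n_le : P.n ≤ P.s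
  s_le : P.s ≤ P.n ^ 3

section
variable {P : Params} {G : SimpleGraph (Fin P.n)} {L : Fin P.M → List G.Dart} {ω : Coins P.M}
  {D : ℕ}

theorem Params.Moderate.labelCount_le (h : P.Moderate) : labelCount P ≤ 2 * P.n ^ 2 := by
  have h1 := h.n_ge
  have hcl : Nat.clog 2 P.n ≤ P.n :=
    (Nat.clog_le_iff_le_pow (b := 2) (by norm_num)).2 (Nat.lt_two_pow_self).le
  calc labelCount P ≤ P.n * (P.n + 1) := Nat.mul_le_mul h.M_le (by omega)
    _ ≤ 2 * P.n ^ 2 := by nlinarith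

theorem Params.Moderate.mul_pow_le (h : P.Moderate) : 10 ^ 8 * P.n ^ 9 ≤ P.n ^ 100 := by
  have h1 := h.n_ge
  calc 10 ^ 8 * P.n ^ 9 = 100 ^ 4 * P.n ^ 9 := by norm_num
    _ ≤ P.n ^ 4 * P.n ^ 9 := Nat.mul_le_mul_right _ (Nat.pow_le_pow_left h1 4)
    _ = P.n ^ 13 := by ring
    _ ≤ P.n ^ 100 := Nat.pow_le_pow_right (by omega) (by norm_num)

theorem Params.Moderate.roomy (h : P.Moderate) : Roomy P (100 * P.s) (P.n ^ 100) := by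
  have h1 := h.n_ge
  have h2 := h.n_le
  have h3 := h.s_le
  have h4 := h.mul_pow_le
  have h39 : P.n ^ 3 ≤ P.n ^ 9 := Nat.pow_le_pow_right (by omega) (by norm_num)
  have h29 : P.n ^ 2 ≤ P.n ^ 9 := Nat.pow_le_pow_right (by omega) (by norm_num)
  refine ⟨by omega, h.M_pos, h.M_le, by omega, by omega, ?_, ?_⟩
  · rw [mul_assoc, ← pow_two]
    omega
  · have := Nat.mul_le_mul_left (2 * P.n) h.labelCount_le
    have h5 : 2 * P.n * (2 * P.n ^ 2) = 4 * P.n ^ 3 := by ring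
    omega

/-- Applied with `y = n ^ 3`, which bounds both `n` and `s`, and with an inbox of length `N ≤ 22 *
s`. The resulting `10 ^ 8 * n ^ 9` is below `n ^ 100` because `n ≥ 100`. -/
theorem time_le {n N y : ℕ} (hn : n ≤ y) (hN : N ≤ 22 * y) (hy : 1 ≤ y) :
    3 * n + 4 + ((4 * N + 2) + ((N * (100 * (n + N + 2) ^ 2 + 3) + 2) + (6 * N + 2))) ≤
      10 ^ 8 * y ^ 3 := by
  have h1 : n + N + 2 ≤ 25 * y := by omega
  have h2 : N * (100 * (n + N + 2) ^ 2 + 3) ≤ 22 * y * (100 * (25 * y) ^ 2 + 3) := by gcongr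
  have h3 : y ≤ y ^ 3 := Nat.le_self_pow (by norm_num) y
  have h4 : 22 * y * (100 * (25 * y) ^ 2 + 3) = 1375000 * y ^ 3 + 66 * y := by ring
  omega

theorem time_le' {n N y : ℕ} (hn : n ≤ y) (hN : N ≤ 22 * y) (hy : 1 ≤ y) :
    3 * n + 4 + ((4 * N + 2) + (n * (4 * (N + 2) ^ 2 + 6) + 2)) ≤ 10 ^ 8 * y ^ 3 := by
  have h1 : N + 2 ≤ 24 * y := by omega
  have h2 : n * (4 * (N + 2) ^ 2 + 6) ≤ y * (4 * (24 * y) ^ 2 + 6) := by gcongr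
  have h3 : y ≤ y ^ 3 := Nat.le_self_pow (by norm_num) y
  have h4 : y * (4 * (24 * y) ^ 2 + 6) = 2304 * y ^ 3 + 6 * y := by ring
  omega

/-- The first two rounds succeed, and the third one starts with suitable inboxes. -/
theorem exists_inboxes (hP : P.Moderate) (hL : ListsEdges G L) (hs : ∀ i, (L i).length ≤ P.s)
    (hΛ : ∀ j, (routed (labelOf P ω) L j).length ≤ 20 * P.s) :
    ∃ I₁ I₂ : Data P.M,
      Round P (100 * P.s) (P.n ^ 100) (P.n ^ 100) .announce (fun i t k => ω (i, 0, t, k))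
        (edgeData L) I₁ ∧
      Round P (100 * P.s) (P.n ^ 100) (P.n ^ 100) .forward (fun i t k => ω (i, 1, t, k)) I₁ I₂ ∧
      ∀ j, (I₂ j).length ≤ 22 * P.s ∧
        Inbox P G (labelOf P ω) (I₂ j) (routed (labelOf P ω) L j) := by
  have hR := hP.roomy
  have h1 := hP.n_ge
  have h2 := hP.n_le
  have h3 := hP.s_le
  have h4 := hP.mul_pow_le
  have hMn := hP.M_le
  have h39 : P.n ^ 3 ≤ P.n ^ 9 := Nat.pow_le_pow_right (by omega) (by norm_num)
  have hM : P.n * (3 * P.M + 5) ≤ 8 * P.n ^ 3 := by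
    calc P.n * (3 * P.M + 5) ≤ P.n * (8 * P.n) := Nat.mul_le_mul_left _ (by omega)
      _ = 8 * P.n ^ 2 := by ring
      _ ≤ 8 * P.n ^ 3 := Nat.mul_le_mul_left _ (Nat.pow_le_pow_right (by omega) (by norm_num))
  obtain ⟨I₁, I₂, hr₁, hr₂, hI⟩ := exists_rounds (T := P.n ^ 100) hR ω L
    (fun v _ => labelOf_lt hR.labelCount_pos ω v) (fun i t _ => (labelOf_add_mul ω i t).symm) hs hΛ
    (by omega) (by omega) (by omega) (by omega)
  refine ⟨I₁, I₂, hr₁, hr₂, fun j => ⟨(hI j).2.1.trans (by omega), (hI j).1, (hI j).2.2, ?_⟩⟩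
  exact nodup_map_edge (listsEdges_routed hP.M_pos hL) j

theorem colour_le {n D q W : ℕ} (hn : 100 ≤ n) (hD : D ≤ n) (hq : q ≤ 2 * n ^ 2)
    (hW : 10 ^ 8 * n ^ 9 ≤ W) : (2 * D + 1) * (q + 1) ≤ W := by
  have h2 : 1 ≤ n ^ 2 := Nat.one_le_pow _ _ (by omega)
  have h39 : n ^ 3 ≤ n ^ 9 := Nat.pow_le_pow_right (by omega) (by norm_num)
  calc (2 * D + 1) * (q + 1) ≤ (3 * n) * (3 * n ^ 2) := Nat.mul_le_mul (by omega) (by omega)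
    _ = 9 * n ^ 3 := by ring
    _ ≤ W := by omega

theorem succeeds_edgeAlgorithm (hP : P.Moderate) (hL : ListsEdges G L)
    (hs : ∀ i, (L i).length ≤ P.s) (hΛ : ∀ j, (routed (labelOf P ω) L j).length ≤ 20 * P.s)
    (hD : D ≤ P.n) (hX : ∀ v l, labelDegree G (labelOf P ω) v l ≤ D) {k : ℝ}
    (hk : ((labelCount P * (D + 1) + (2 * D + 1) : ℕ) : ℝ) ≤ k) :
    Succeeds P 100 edgeAlgorithm L (IsEdgeColouringOutput G k) ω := by
  have hR := hP.roomy
  have h1 := hP.n_ge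
  have h2 := hP.n_le
  have h3 := hP.s_le
  have h4 := hP.mul_pow_le
  have hn3 : P.n ≤ P.n ^ 3 := Nat.le_self_pow (by norm_num) _
  have hW := colour_le h1 hD hP.labelCount_le h4
  obtain ⟨I₁, I₂, hr₁, hr₂, hI⟩ := exists_inboxes (ω := ω) hP hL hs hΛ
  obtain ⟨out, hout, hr₃⟩ := Round.of_total (P := P) (S := 100 * P.s) (W := P.n ^ 100)
    (T := P.n ^ 100) (p := .edgeColouring) (ρ := fun i t k => ω (i, 2, t, k)) (I := I₂)
    (Q := fun i out => ∃ C : ℕ → ℕ,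
      Proper (IsEdgeIndex (I₂ i)) (srcAt P (I₂ i)) (dstAt P (I₂ i)) (keyAt P (labelOf P ω) (I₂ i)) C
        (I₂ i).length ∧
      Bounded P (labelOf P ω) (I₂ i) D C (I₂ i).length ∧
      out = (List.range (I₂ i).length).flatMap (edgeRecord P (labelOf P ω) i (I₂ i) C))
    (fun i => (hI i).1.trans (by omega)) (fun i => by
      have hlen := (hI i).1
      refine (Total.edgeColouring hR (hI i).2.good (by omega) ((hI i).2.classDegreeLe hX)
        hW).mono ?_ fun _ h => h
      refine (time_le hn3 (hlen.trans (Nat.mul_le_mul_left _ h3)) (by omega)).trans ?_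
      rw [← pow_mul]
      exact h4)
  choose C hC using hout
  refine ⟨deliver out, ⟨I₁, hr₁, I₂, hr₂, deliver out, hr₃, ?_, rfl⟩, ?_⟩
  all_goals
    have hdel : ∀ j, deliver out j = ((List.range (I₂ j).length).flatMap
        (edgeRecord P (labelOf P ω) j (I₂ j) (C j))).map Prod.snd := by
      intro j
      rw [deliver_of_self, (hC j).2.2]
      intro i q hq
      rw [(hC i).2.2] at hq
      obtain ⟨e, -, he⟩ := List.mem_flatMap.1 hq
      rw [edgeRecord] at he
      split_ifs at he
      · simp only [List.mem_cons, List.not_mem_nil, or_false] at he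
        rcases he with rfl | rfl | rfl <;> rfl
      · simp at he
  -- At most three output words for each of at most `22 * s` inbox words.
  · intro j
    rw [hdel, List.length_map]
    refine (length_flatMap_range_le _ 3 (length_edgeRecord_le P _ j _ _) _).trans ?_
    have := (hI j).1
    omega
  · exact isEdgeColouringOutput hR.labelCount_pos (listsEdges_routed hP.M_pos hL)
      (fun j d hd => mem_routed hd) (fun j => (hI j).2) (fun j => (hC j).1) (fun j => (hC j).2.1)
      hdel hk

theorem succeeds_vertexAlgorithm (hP : P.Moderate) (hL : ListsEdges G L)
    (hs : ∀ i, (L i).length ≤ P.s) (hΛ : ∀ j, (routed (labelOf P ω) L j).length ≤ 20 * P.s)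
    (hD : D ≤ P.n) (hX : ∀ v l, labelDegree G (labelOf P ω) v l ≤ D) {k : ℝ}
    (hk : ((labelCount P * (D + 1) : ℕ) : ℝ) ≤ k) :
    Succeeds P 100 vertexAlgorithm L (IsVertexColouringOutput G k) ω := by
  have hR := hP.roomy
  have h1 := hP.n_ge
  have h2 := hP.n_le
  have h3 := hP.s_le
  have h4 := hP.mul_pow_le
  have hn3 : P.n ≤ P.n ^ 3 := Nat.le_self_pow (by norm_num) _
  have hW := colour_le h1 hD hP.labelCount_le h4
  obtain ⟨I₁, I₂, hr₁, hr₂, hI⟩ := exists_inboxes (ω := ω) hP hL hs hΛ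
  obtain ⟨out, hout, hr₃⟩ := Round.of_total (P := P) (S := 100 * P.s) (W := P.n ^ 100)
    (T := P.n ^ 100) (p := .vertexColouring) (ρ := fun i t k => ω (i, 2, t, k)) (I := I₂)
    (Q := fun i out => ∃ c : ℕ → ℕ,
      (∀ e < (I₂ i).length, IsEdgeIndex (I₂ i) e →
        labelOf P ω (srcAt P (I₂ i) e) = labelOf P ω (dstAt P (I₂ i) e) →
        route P.M (labelCount P) (labelOf P ω (dstAt P (I₂ i) e))
          (labelOf P ω (dstAt P (I₂ i) e)) = i →
        c (srcAt P (I₂ i) e) ≠ c (dstAt P (I₂ i) e)) ∧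
      (∀ v < P.n, route P.M (labelCount P) (labelOf P ω v) (labelOf P ω v) = i → c v ≤ D) ∧
      out = (List.range P.n).flatMap (vertexRecord P (labelOf P ω) i c))
    (fun i => (hI i).1.trans (by omega)) (fun i => by
      have hlen := (hI i).1
      refine (Total.vertexColouring hR (hI i).2.good (by omega) (by omega)
        ((hI i).2.classDegreeLe hX).backDegreeLe hW).mono ?_ fun _ h => h
      refine (time_le' hn3 (hlen.trans (Nat.mul_le_mul_left _ h3)) (by omega)).trans ?_
      rw [← pow_mul]
      exact h4)
  choose c hC using hout
  refine ⟨deliver out, ⟨I₁, hr₁, I₂, hr₂, deliver out, hr₃, ?_, rfl⟩, ?_⟩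
  all_goals
    have hdel : ∀ j, deliver out j = ((List.range P.n).flatMap
        (vertexRecord P (labelOf P ω) j (c j))).map Prod.snd := by
      intro j
      rw [deliver_of_self, (hC j).2.2]
      intro i q hq
      rw [(hC i).2.2] at hq
      obtain ⟨e, -, he⟩ := List.mem_flatMap.1 hq
      rw [vertexRecord] at he
      split_ifs at he
      · simp only [List.mem_cons, List.not_mem_nil, or_false] at he
        rcases he with rfl | rfl <;> rfl
      · simp at he
  · intro j
    rw [hdel, List.length_map]
    refine (length_flatMap_range_le _ 2 (length_vertexRecord_le P _ j _) _).trans ?_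
    omega
  · exact isVertexColouringOutput hP.M_pos (listsEdges_routed hP.M_pos hL)
      (fun j d hd => mem_routed hd) (fun j => (hI j).2)
      (fun v _ => labelOf_lt hR.labelCount_pos ω v) (fun j => (hC j).1) (fun j => (hC j).2.1)
      hdel hk

/-! ## The load of the machines -/

/-- Adding `a` permutes the residues mod `q = M * ℓ`, and each residue mod `M` is attained by `ℓ` of
them; the quotient by `M` is the injection into `range ℓ`. This is why `q` is a multiple of `M`. -/
theorem card_route_le {M ℓ q a j : ℕ} (hM : 1 ≤ M) (hq : q = M * ℓ) :
    ((Finset.range q).filter fun l => route M q a l = j).card ≤ ℓ := by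
  have : ((Finset.range q).filter fun l => route M q a l = j).card ≤ (Finset.range ℓ).card := by
    refine Finset.card_le_card_of_injOn (fun l => (a + l) % q / M) ?_ ?_
    · intro l hl
      simp only [Finset.coe_filter, Finset.mem_range, Set.mem_ofPred_eq] at hl
      simp only [Finset.coe_range, Set.mem_Iio]
      rw [Nat.div_lt_iff_lt_mul hM, mul_comm, ← hq]
      exact Nat.mod_lt _ (by omega)
    · intro l hl l' hl' h
      have hl := Finset.mem_filter.1 (Finset.mem_coe.1 hl)
      have hl' := Finset.mem_filter.1 (Finset.mem_coe.1 hl')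
      simp only [Finset.mem_range, route] at hl hl' h
      have e1 := Nat.mod_add_div ((a + l) % q) M
      have e2 := Nat.mod_add_div ((a + l') % q) M
      have h3 : (a + l) % q = (a + l') % q := by
        rw [← e1, ← e2, hl.2, hl'.2, h]
      have h4 : l % q = l' % q := Nat.ModEq.add_left_cancel' a h3
      rwa [Nat.mod_eq_of_lt hl.1, Nat.mod_eq_of_lt hl'.1] at h4
  simpa using this

open Classical in
-- Charge each edge on machine `j` to the first vertex `v` of its dart and the label `l` of the
-- other one. For fixed `v` only `q / M` labels lead to `j`, each accounting for at most `B v`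
-- edges. So the load needs no concentration argument of its own.
theorem length_routed_le {lab : ℕ → ℕ} (hM : 1 ≤ P.M) (hlab : ∀ v, lab v < labelCount P)
    (hL : ListsEdges G L) {B : Fin P.n → ℝ} (hB : ∀ v l, (labelDegree G lab v l : ℝ) ≤ B v)
    (j : Fin P.M) : ((routed lab L j).length : ℝ) ≤ (Nat.clog 2 P.n + 1 : ℕ) * ∑ v, B v := by
  have hnd : ((routed lab L j).map SimpleGraph.Dart.toProd).Nodup := by
    have h := nodup_map_edge (listsEdges_routed (lab := lab) hM hL) j
    rw [List.Nodup, List.pairwise_map] at h ⊢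
    exact h.imp fun h e => h (by rw [SimpleGraph.Dart.edge, SimpleGraph.Dart.edge, e])
  have h1 : (routed lab L j).length ≤ ∑ v : Fin P.n, ((Finset.range (labelCount P)).filter fun l =>
      route P.M (labelCount P) (lab v) l = j).sum fun l => labelDegree G lab v l := by
    calc (routed lab L j).length = ((routed lab L j).map SimpleGraph.Dart.toProd).toFinset.card := by
          rw [List.toFinset_card_of_nodup hnd, List.length_map]
      _ ≤ (Finset.univ.sigma fun v : Fin P.n => ((Finset.range (labelCount P)).filter fun l =>
          route P.M (labelCount P) (lab v) l = j).sigma fun l =>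
            Finset.univ.filter fun w : Fin P.n => G.Adj v w ∧ lab w = l).card := by
          refine Finset.card_le_card_of_injOn (fun p => ⟨p.1, lab p.2, p.2⟩) ?_ ?_
          · intro p hp
            simp only [List.coe_toFinset, List.mem_map, Set.mem_ofPred_eq] at hp
            obtain ⟨d, hd, rfl⟩ := hp
            simp only [Finset.coe_sigma, Set.mem_sigma_iff, Finset.mem_coe, Finset.mem_univ,
              Finset.mem_filter, Finset.mem_range, true_and]
            exact ⟨⟨hlab _, mem_routed hd⟩, d.adj, trivial⟩
          · rintro ⟨a, b⟩ _ ⟨a', b'⟩ _ h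
            simp only [Sigma.mk.injEq] at h
            obtain ⟨rfl, h⟩ := h
            have h := eq_of_heq h
            simp only [Sigma.mk.injEq] at h
            rw [eq_of_heq h.2]
      _ = _ := by
          rw [Finset.card_sigma]
          refine Finset.sum_congr rfl fun v _ => ?_
          rw [Finset.card_sigma]
          rfl
  calc ((routed lab L j).length : ℝ) ≤ ((∑ v : Fin P.n, ((Finset.range (labelCount P)).filter fun l =>
      route P.M (labelCount P) (lab v) l = j).sum fun l => labelDegree G lab v l : ℕ) : ℝ) :=
        Nat.cast_le.2 h1
    _ ≤ ∑ v, (Nat.clog 2 P.n + 1 : ℕ) * B v := by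
        push_cast
        refine Finset.sum_le_sum fun v _ => ?_
        have hB0 : 0 ≤ B v := (Nat.cast_nonneg _).trans (hB v 0)
        refine (Finset.sum_le_card_nsmul _ _ (B v) fun l _ => hB v l).trans ?_
        rw [nsmul_eq_mul]
        refine mul_le_mul_of_nonneg_right ?_ hB0
        exact_mod_cast card_route_le hM rfl
    _ = _ := (Finset.mul_sum _ _ _).symm

end

end MapReduce

namespace MapReduce

/-! ## Concentration of the label degrees -/

theorem exp_le_one_add {δ : ℝ} (h0 : 0 ≤ δ) (h1 : δ ≤ 1) : Real.exp δ ≤ 1 + δ + δ ^ 2 := by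
  have h := Real.abs_exp_sub_one_sub_id_le (x := δ) (by rwa [abs_of_nonneg h0])
  have := (abs_le.1 h).2
  linarith

section
variable {ι : Type*} (k : ι → ℕ)

/-- Independent uniform choices `ω i ∈ {0, …, k i}`. -/
noncomputable def uniformPi : Measure ((i : ι) → Fin (k i + 1)) :=
  Measure.infinitePi fun i => (PMF.uniformOfFintype (Fin (k i + 1))).toMeasure

instance : IsProbabilityMeasure (uniformPi k) := by
  unfold uniformPi; infer_instance

variable {k} {q : ℕ}

theorem measurable_indicator_eq (i : ι) (l : ℕ) :
    Measurable fun ω : (i : ι) → Fin (k i + 1) => if (ω i : ℕ) = l then (1 : ℝ) else 0 :=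
  (measurable_from_top (f := fun x : Fin (k i + 1) => if (x : ℕ) = l then (1 : ℝ) else 0)).comp
    (measurable_pi_apply i)

theorem uniformPi_eq_le (i : ι) (hq : k i + 1 = q) (l : ℕ) :
    (uniformPi k).real {ω | (ω i : ℕ) = l} ≤ 1 / q := by
  have h1 : {ω : (i : ι) → Fin (k i + 1) | (ω i : ℕ) = l} =
      Function.eval i ⁻¹' {x : Fin (k i + 1) | (x : ℕ) = l} := rfl
  rw [h1, Measure.real, uniformPi,
    (measurePreserving_eval_infinitePi _ i).measure_preimage
      MeasurableSet.of_discrete.nullMeasurableSet]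
  by_cases hl : l < k i + 1
  · have h2 : {x : Fin (k i + 1) | (x : ℕ) = l} = {⟨l, hl⟩} := by
      ext x; simp [Fin.ext_iff]
    rw [h2, PMF.toMeasure_apply_singleton _ _ (MeasurableSet.singleton _),
      PMF.uniformOfFintype_apply, Fintype.card_fin, ENNReal.toReal_inv, ENNReal.toReal_natCast, hq,
      one_div]
  · have h2 : {x : Fin (k i + 1) | (x : ℕ) = l} = ∅ := by
      ext x
      simp only [Set.mem_ofPred_eq, Set.mem_empty_iff_false, iff_false]
      omega
    rw [h2]
    simp

/-- An indicator of probability `p` has moment generating function `1 + p (exp t - 1) ≤ exp (p (exp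
t - 1))`, and `p ≤ 1 / q`, with `p = 0` for values out of range. -/
theorem mgf_indicator_eq_le (i : ι) (hq : k i + 1 = q) (l : ℕ) {t : ℝ} (ht : 0 ≤ t) :
    ProbabilityTheory.mgf (fun ω => if (ω i : ℕ) = l then (1 : ℝ) else 0) (uniformPi k) t ≤
      Real.exp ((Real.exp t - 1) / q) := by
  have hm : MeasurableSet {ω : (i : ι) → Fin (k i + 1) | (ω i : ℕ) = l} :=
    (measurable_pi_apply (X := fun i => Fin (k i + 1)) i)
      (MeasurableSet.of_discrete (s := {x : Fin (k i + 1) | (x : ℕ) = l}))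
  have h1 : (fun ω : (i : ι) → Fin (k i + 1) =>
      Real.exp (t * if (ω i : ℕ) = l then (1 : ℝ) else 0)) = fun ω =>
        1 + {ω : (i : ι) → Fin (k i + 1) | (ω i : ℕ) = l}.indicator
          (fun _ => Real.exp t - 1) ω := by
    funext ω
    by_cases h : (ω i : ℕ) = l <;> simp [h]
  rw [ProbabilityTheory.mgf, h1, integral_add (integrable_const _)
    ((integrable_const _).indicator hm), integral_indicator hm, setIntegral_const,
    integral_const, probReal_univ, one_smul, smul_eq_mul]
  have h2 : 0 ≤ Real.exp t - 1 := by linarith [Real.add_one_le_exp t]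
  have h3 := mul_le_mul_of_nonneg_right (uniformPi_eq_le i hq l) h2
  have h4 := Real.add_one_le_exp ((Real.exp t - 1) / q)
  have h5 : 1 / (q : ℝ) * (Real.exp t - 1) = (Real.exp t - 1) / q := by ring
  linarith

/-- A Chernoff bound for the number of occurrences of a value among independent uniform choices. -/
theorem uniformPi_count_le {s : Finset ι} (hq : ∀ i ∈ s, k i + 1 = q) (l : ℕ) {δ x : ℝ}
    (h0 : 0 ≤ δ) (h1 : δ ≤ 1) (hx : (s.card : ℝ) ≤ q * x) (hx0 : 0 ≤ x) :
    uniformPi k {ω | (1 + 2 * δ) * x ≤ ((s.filter fun i => (ω i : ℕ) = l).card : ℝ)} ≤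
      ENNReal.ofReal (Real.exp (-(δ ^ 2 * x))) := by
  set X : ι → ((i : ι) → Fin (k i + 1)) → ℝ := fun i ω => if (ω i : ℕ) = l then (1 : ℝ) else 0
    with hX
  have hcard : ∀ ω : (i : ι) → Fin (k i + 1),
      ((s.filter fun i => (ω i : ℕ) = l).card : ℝ) = (∑ i ∈ s, X i) ω := by
    intro ω
    simp [hX, Finset.sum_apply, Finset.sum_boole]
  have hmeas : ∀ i, Measurable (X i) := fun i => measurable_indicator_eq i l
  have hind : ProbabilityTheory.iIndepFun X (uniformPi k) :=
    ProbabilityTheory.iIndepFun_infinitePi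
      (X := fun i (x : Fin (k i + 1)) => if (x : ℕ) = l then (1 : ℝ) else 0)
      fun i => measurable_from_top
  have hXle : ∀ ω, (∑ i ∈ s, X i) ω ≤ s.card := fun ω => by
    rw [← hcard]
    exact_mod_cast Finset.card_filter_le _ _
  have hint : Integrable (fun ω => Real.exp (δ * (∑ i ∈ s, X i) ω)) (uniformPi k) := by
    refine Integrable.of_bound (C := Real.exp (δ * s.card)) ?_ (ae_of_all _ fun ω => ?_)
    · have hsum : Measurable fun ω => (∑ i ∈ s, X i) ω := by
        simp only [Finset.sum_apply]
        exact Finset.measurable_sum _ fun i _ => hmeas i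
      exact (Real.measurable_exp.comp (hsum.const_mul δ)).aestronglyMeasurable
    · rw [Real.norm_eq_abs, Real.abs_exp, Real.exp_le_exp]
      exact mul_le_mul_of_nonneg_left (hXle ω) h0
  have h := ProbabilityTheory.measure_ge_le_exp_mul_mgf (μ := uniformPi k) ((1 + 2 * δ) * x) h0 hint
  rw [hind.mgf_sum hmeas] at h
  simp only [← hcard] at h
  rw [← ENNReal.ofReal_toReal (measure_ne_top (uniformPi k) _)]
  refine ENNReal.ofReal_le_ofReal (h.trans ?_)
  have hprod : ∏ i ∈ s, ProbabilityTheory.mgf (X i) (uniformPi k) δ ≤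
      Real.exp ((Real.exp δ - 1) / q) ^ s.card :=
    (Finset.prod_le_prod (fun i _ => ProbabilityTheory.mgf_nonneg)
      fun i hi => mgf_indicator_eq_le i (hq i hi) l h0).trans_eq (Finset.prod_const _)
  refine (mul_le_mul_of_nonneg_left hprod (Real.exp_pos _).le).trans ?_
  rw [← Real.exp_nat_mul, ← Real.exp_add, Real.exp_le_exp]
  have h2 : 0 ≤ Real.exp δ - 1 := by linarith [Real.add_one_le_exp δ]
  have h3 : (s.card : ℝ) * ((Real.exp δ - 1) / q) ≤ x * (Real.exp δ - 1) := by
    -- For `q = 0` the quotient is zero by convention.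
    rcases Nat.eq_zero_or_pos q with rfl | hq0
    · simpa using mul_nonneg hx0 h2
    · have hq0 : (0 : ℝ) < q := Nat.cast_pos.2 hq0
      calc (s.card : ℝ) * ((Real.exp δ - 1) / q) ≤ q * x * ((Real.exp δ - 1) / q) :=
            mul_le_mul_of_nonneg_right hx (div_nonneg h2 hq0.le)
        _ = x * (Real.exp δ - 1) := by field_simp
  have h4 : x * (Real.exp δ - 1) ≤ x * (δ + δ ^ 2) :=
    mul_le_mul_of_nonneg_left (by linarith [exp_le_one_add h0 h1]) hx0
  -- The exponents add up to at most `-δ (1 + 2 δ) x + (δ + δ²) x = -δ² x`.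
  nlinarith

end

/-- The index of the draw that yields the label of `v`. -/
def labelIndex (P : Params) (hM : 1 ≤ P.M) (v : Fin P.n) : DrawIndex P.M :=
  (⟨v % P.M, Nat.mod_lt _ hM⟩, 0, v / P.M, labelCount P - 1)

/-- Distinct vertices use distinct draws, whence the labels are independent. -/
theorem labelIndex_injective (P : Params) (hM : 1 ≤ P.M) :
    Function.Injective (labelIndex P hM) := by
  intro v w h
  simp only [labelIndex, Prod.mk.injEq, Fin.mk.injEq, true_and, and_true] at h
  rw [Fin.ext_iff, ← Nat.mod_add_div (v : ℕ) P.M, ← Nat.mod_add_div (w : ℕ) P.M, h.1, h.2]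

open Classical in
theorem measure_labelDegree_le {P : Params} (G : SimpleGraph (Fin P.n)) (hM : 1 ≤ P.M)
    (hq : 1 ≤ labelCount P) (v : Fin P.n) (l : ℕ) {δ x : ℝ} (h0 : 0 ≤ δ) (h1 : δ ≤ 1)
    (hx : (((Finset.univ.filter fun w => G.Adj v w).card : ℕ) : ℝ) ≤ labelCount P * x)
    (hx0 : 0 ≤ x) :
    coinMeasure P.M {ω | (1 + 2 * δ) * x ≤ (labelDegree G (labelOf P ω) v l : ℝ)} ≤
      ENNReal.ofReal (Real.exp (-(δ ^ 2 * x))) := by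
  set s := (Finset.univ.filter fun w => G.Adj v w).map ⟨labelIndex P hM, labelIndex_injective P hM⟩
    with hs
  have h := uniformPi_count_le (k := fun i : DrawIndex P.M => i.2.2.2) (q := labelCount P) (s := s)
    (by
      intro i hi
      obtain ⟨w, -, rfl⟩ := Finset.mem_map.1 hi
      exact Nat.sub_add_cancel hq) l h0 h1 (by rwa [hs, Finset.card_map]) hx0
  refine le_trans (le_of_eq ?_) h
  rw [coinMeasure, uniformPi]
  congr 1
  ext ω
  simp only [Set.mem_ofPred_eq]
  have : labelDegree G (labelOf P ω) v l = (s.filter fun i => (ω i : ℕ) = l).card := by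
    rw [hs, Finset.filter_map, Finset.card_map, Finset.filter_filter, labelDegree]
    congr 1
    refine Finset.filter_congr fun w _ => ?_
    rw [labelOf, dif_pos (Nat.mod_lt _ hM)]
    rfl
  rw [this]

/-- With the probability given by the Chernoff bound, all label degrees are close to their means. -/
theorem measure_exists_labelDegree_le {P : Params} (G : SimpleGraph (Fin P.n)) (hM : 1 ≤ P.M)
    (hq : 1 ≤ labelCount P) {δ y : ℝ} (h0 : 0 ≤ δ) (h1 : δ ≤ 1) {x : Fin P.n → ℝ} (hy : 0 ≤ y)
    (hyx : ∀ v, y ≤ x v)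
    (hx : ∀ v, ((G.neighborSet v).ncard : ℝ) ≤ labelCount P * x v) :
    coinMeasure P.M {ω | ¬ ∀ v l, (labelDegree G (labelOf P ω) v l : ℝ) ≤ (1 + 2 * δ) * x v} ≤
      ENNReal.ofReal ((P.n * labelCount P : ℕ) * Real.exp (-(δ ^ 2 * y))) := by
  classical
  have hsub : {ω : Coins P.M |
      ¬ ∀ v l, (labelDegree G (labelOf P ω) v l : ℝ) ≤ (1 + 2 * δ) * x v} ⊆
      ⋃ p ∈ (Finset.univ : Finset (Fin P.n)) ×ˢ Finset.range (labelCount P),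
        {ω | (1 + 2 * δ) * x p.1 ≤ (labelDegree G (labelOf P ω) p.1 p.2 : ℝ)} := by
    intro ω hω
    simp only [Set.mem_ofPred_eq, not_forall, not_le] at hω
    obtain ⟨v, l, hvl⟩ := hω
    -- Labels from `q` on never occur and cannot violate the bound, so the union runs over `n * q`
    -- pairs only.
    have hl : l < labelCount P := by
      by_contra hl
      have : labelDegree G (labelOf P ω) v l = 0 := by
        rw [labelDegree, Finset.card_eq_zero, Finset.filter_eq_empty_iff]
        rintro w - ⟨-, hw⟩
        have := labelOf_lt hq ω w
        omega
      rw [this, Nat.cast_zero] at hvl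
      have := hy.trans (hyx v)
      nlinarith
    simp only [Set.mem_iUnion]
    exact ⟨(v, l), by simpa using hl, hvl.le⟩
  refine (measure_mono hsub).trans ((measure_biUnion_finset_le _ _).trans ?_)
  refine (Finset.sum_le_card_nsmul _ _ (ENNReal.ofReal (Real.exp (-(δ ^ 2 * y)))) ?_).trans ?_
  · rintro ⟨v, l⟩ -
    refine (measure_labelDegree_le G hM hq v l h0 h1 ?_ (hy.trans (hyx v))).trans
      (ENNReal.ofReal_le_ofReal (Real.exp_le_exp.2 ?_))
    · refine le_trans (le_of_eq ?_) (hx v)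
      rw [← Set.ncard_coe_finset]
      congr 2
      ext w
      simp
    · exact neg_le_neg (mul_le_mul_of_nonneg_left (hyx v) (sq_nonneg δ))
  · rw [Finset.card_product, Finset.card_univ, Fintype.card_fin, Finset.card_range, nsmul_eq_mul,
      ENNReal.ofReal_mul (Nat.cast_nonneg _), ENNReal.ofReal_natCast]

end MapReduce

namespace MapReduce

/-! ## The algorithms succeed with high probability -/

theorem log_le_clog {n : ℕ} (hn : 1 ≤ n) : Real.log n ≤ Nat.clog 2 n := by
  have h1 : (n : ℝ) ≤ 2 ^ Nat.clog 2 n := by exact_mod_cast Nat.le_pow_clog (by norm_num) n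
  have h2 := Real.log_le_log (by exact_mod_cast hn) h1
  rw [Real.log_pow] at h2
  have h3 : Real.log 2 ≤ 1 := by linarith [Real.log_two_lt_d9]
  nlinarith [Nat.cast_nonneg (α := ℝ) (Nat.clog 2 n)]

theorem clog_le_log {n : ℕ} (hn : 2 ≤ n) : (Nat.clog 2 n : ℝ) ≤ 1 + 2 * Real.log n := by
  have h0 : 1 ≤ Nat.clog 2 n := Nat.clog_pos (by norm_num) hn
  have h1 : (2 : ℝ) ^ (Nat.clog 2 n - 1) ≤ n := by
    exact_mod_cast (Nat.pow_pred_clog_lt_self (b := 2) (by norm_num) (by omega)).le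
  have h2 := Real.log_le_log (by positivity) h1
  rw [Real.log_pow, Nat.cast_sub h0, Nat.cast_one] at h2
  have h3 : 1 / 2 ≤ Real.log 2 := by linarith [Real.log_two_gt_d9]
  have h4 : (1 : ℝ) ≤ Nat.clog 2 n := by exact_mod_cast h0
  nlinarith

/-! ### Sizes of the parameters when the memory is at least `n` times a power of `log n`. -/

/-- The parameters of a graph with average degree `2 * x` when a machine has memory of order
`n * u`. -/
structure Params.Regime (P : Params) (G : SimpleGraph (Fin P.n)) [DecidableRel G.Adj] (x u : ℝ) :
    Prop where
  log_ge : 100 ≤ Real.log P.n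
  pow_log_le : Real.log P.n ^ 6 ≤ u
  le : u ≤ x
  card_edges : (G.edgeFinset.card : ℝ) = P.n * x
  M_eq : P.M = ⌈x / u⌉₊
  s_eq : P.s = ⌈P.n * u⌉₊

namespace Params.Regime
variable {P : Params} {G : SimpleGraph (Fin P.n)} [DecidableRel G.Adj] {x u : ℝ}

theorem n_ge (h : P.Regime G x u) : 100 ≤ P.n := by
  have h1 := h.log_ge
  have h2 := Real.log_le_self (Nat.cast_nonneg (α := ℝ) P.n)
  exact_mod_cast h1.trans h2

theorem cast_n_ge (h : P.Regime G x u) : (100 : ℝ) ≤ P.n := by exact_mod_cast h.n_ge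

theorem u_ge (h : P.Regime G x u) : 100 ≤ u :=
  (h.log_ge.trans (le_self_pow₀ (by linarith [h.log_ge]) (by norm_num))).trans h.pow_log_le

theorem x_le (h : P.Regime G x u) : x ≤ P.n / 2 := by
  have h1 := G.card_edgeFinset_le_card_choose_two
  rw [Fintype.card_fin] at h1
  have h2 : (G.edgeFinset.card : ℝ) ≤ (P.n.choose 2 : ℕ) := by exact_mod_cast h1
  rw [h.card_edges, Nat.cast_choose_two] at h2
  have h3 := h.cast_n_ge
  have h4 : (P.n : ℝ) * x ≤ P.n * (P.n / 2) := by nlinarith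
  exact le_of_mul_le_mul_left h4 (by linarith)

theorem le_M (h : P.Regime G x u) : x / u ≤ P.M := by
  rw [h.M_eq]
  exact Nat.le_ceil _

theorem M_le (h : P.Regime G x u) : (P.M : ℝ) ≤ 2 * (x / u) := by
  have hu := h.u_ge
  have h1 : 1 ≤ x / u := (one_le_div (by linarith)).2 h.le
  have h2 := Nat.ceil_lt_add_one (zero_le_one.trans h1)
  rw [← h.M_eq] at h2
  linarith

theorem le_s (h : P.Regime G x u) : P.n * u ≤ P.s := by
  rw [h.s_eq]
  exact Nat.le_ceil _

theorem moderate (h : P.Regime G x u) : P.Moderate := by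
  have hn := h.cast_n_ge
  have hu := h.u_ge
  have hx := h.x_le
  have hux := h.le
  have h1 : 1 ≤ x / u := (one_le_div (by linarith)).2 h.le
  refine ⟨h.n_ge, ?_, ?_, ?_, ?_⟩
  · exact_mod_cast h1.trans h.le_M
  · have h2 : x / u ≤ x / 2 := div_le_div_of_nonneg_left (by linarith) (by norm_num) (by linarith)
    have h3 : (P.M : ℝ) ≤ P.n := by linarith [h.M_le]
    exact_mod_cast h3
  · have h2 : (P.n : ℝ) ≤ P.s := by nlinarith [h.le_s]
    exact_mod_cast h2
  · have h2 := Nat.ceil_lt_add_one (a := P.n * u) (by positivity)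
    rw [← h.s_eq] at h2
    have h3 : (P.n : ℝ) * u ≤ P.n * (P.n / 2) := by gcongr; linarith
    have h4 : (P.s : ℝ) ≤ P.n ^ 3 := by nlinarith
    exact_mod_cast h4

theorem log_le_labelCount (h : P.Regime G x u) : Real.log P.n ≤ labelCount P := by
  have h1 := log_le_clog (n := P.n) (by linarith [h.n_ge])
  have h2 : Nat.clog 2 P.n ≤ labelCount P :=
    (Nat.le_succ _).trans (Nat.le_mul_of_pos_left _ h.moderate.M_pos)
  have h3 : (Nat.clog 2 P.n : ℝ) ≤ labelCount P := by exact_mod_cast h2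
  linarith

/-- `M` is at most twice `x / u`, and the logarithmic factor is at most `2 + 2 log n ≤ 3 log n`. -/
theorem labelCount_mul_le (h : P.Regime G x u) : labelCount P * u ≤ 6 * Real.log P.n * x := by
  have h1 := clog_le_log (n := P.n) (by linarith [h.n_ge])
  have h2 := h.log_ge
  have h3 : (labelCount P : ℝ) = P.M * (Nat.clog 2 P.n + 1) := by
    rw [labelCount]; push_cast; ring
  have h4 : (labelCount P : ℝ) ≤ 2 * (x / u) * (3 * Real.log P.n) := by
    rw [h3]
    refine mul_le_mul h.M_le (by linarith) (by positivity) ?_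
    have := h.u_ge
    have := h.le
    exact mul_nonneg zero_le_two (div_nonneg (by linarith) (by linarith))
  have hu := h.u_ge
  calc (labelCount P : ℝ) * u ≤ 2 * (x / u) * (3 * Real.log P.n) * u := by gcongr
    _ = 6 * Real.log P.n * x := by field_simp; ring

/-- Used twice: it makes `q` negligible against `Δ`, and it makes the mean label degree scale `x /
q` at least `(log n) ^ 5 / 6`, large enough for concentration. -/
theorem labelCount_le (h : P.Regime G x u) : labelCount P * Real.log P.n ^ 5 ≤ 6 * x := by
  have h0 : 0 < Real.log P.n := by linarith [h.log_ge]
  refine le_of_mul_le_mul_right ?_ h0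
  calc labelCount P * Real.log P.n ^ 5 * Real.log P.n = labelCount P * Real.log P.n ^ 6 := by ring
    _ ≤ labelCount P * u := by gcongr; exact h.pow_log_le
    _ ≤ 6 * Real.log P.n * x := h.labelCount_mul_le
    _ = 6 * x * Real.log P.n := by ring

theorem two_mul_x_le (h : P.Regime G x u) : 2 * x ≤ G.maxDegree := by
  have h1 := G.sum_degrees_eq_twice_card_edges
  have h2 : ∑ v, G.degree v ≤ P.n * G.maxDegree := by
    refine (Finset.sum_le_card_nsmul _ _ _ fun v _ => G.degree_le_maxDegree v).trans_eq ?_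
    simp
  rw [h1] at h2
  have h3 : (2 : ℝ) * G.edgeFinset.card ≤ P.n * G.maxDegree := by exact_mod_cast h2
  rw [h.card_edges] at h3
  have h4 := h.cast_n_ge
  refine le_of_mul_le_mul_left ?_ (show (0 : ℝ) < P.n by linarith)
  linarith

/-- When all label degrees are close to their means, both algorithms succeed. -/
theorem succeeds (h : P.Regime G x u) {L : Fin P.M → List G.Dart} (hL : ListsEdges G L)
    (hs : ∀ i, (L i).length ≤ P.s) {ω : Coins P.M}
    (hω : ∀ v l, (labelDegree G (labelOf P ω) v l : ℝ) ≤
      (1 + 2 * (1 / Real.log P.n)) * (max (G.degree v : ℝ) x / labelCount P)) :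
    Succeeds P 100 vertexAlgorithm L
      (IsVertexColouringOutput G ((1 + 10 / Real.log P.n) * G.maxDegree)) ω ∧
    Succeeds P 100 edgeAlgorithm L
      (IsEdgeColouringOutput G ((1 + 10 / Real.log P.n) * G.maxDegree)) ω := by
  have hl := h.log_ge
  have hn := h.cast_n_ge
  have hP := h.moderate
  have hu := h.u_ge
  have hux := h.le
  have hq0 := h.log_le_labelCount
  have hq : 1 ≤ labelCount P := by
    have : (1 : ℝ) ≤ labelCount P := by linarith
    exact_mod_cast this
  have hΔ := h.two_mul_x_le
  have hql := h.labelCount_le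
  have hM : (1 : ℝ) ≤ P.M := by exact_mod_cast hP.M_pos
  have hqM : (labelCount P : ℝ) = P.M * (Nat.clog 2 P.n + 1 : ℕ) := by rw [labelCount, Nat.cast_mul]
  set ℓ := Real.log P.n with hℓ
  set q : ℝ := (labelCount P : ℝ) with hqdef
  set Δ : ℝ := (G.maxDegree : ℝ) with hΔdef
  have hδ : 1 + 2 * (1 / ℓ) ≤ 3 := by
    have : 1 / ℓ ≤ 1 := (div_le_one (by linarith)).2 (by linarith)
    linarith
  have hδ0 : 0 ≤ 1 / ℓ := by positivity
  -- The sum of `max (deg v) x` is at most `2 n x + n x`, and the factor `1 + 2 / log n` is at most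
  -- 3, so the load is at most `9 n x / M ≤ 9 s`.
  have hΛ : ∀ j, (routed (labelOf P ω) L j).length ≤ 20 * P.s := by
    intro j
    have h1 := length_routed_le hP.M_pos (labelOf_lt hq ω) hL hω j
    have h2 : ∑ v, max (G.degree v : ℝ) x ≤ 3 * (P.n * x) := by
      calc ∑ v, max (G.degree v : ℝ) x ≤ ∑ v, ((G.degree v : ℝ) + x) :=
            Finset.sum_le_sum fun v _ => max_le (by linarith) (by
              have := Nat.cast_nonneg (α := ℝ) (G.degree v); linarith)
        _ = 3 * (P.n * x) := by
          rw [Finset.sum_add_distrib, ← Nat.cast_sum, G.sum_degrees_eq_twice_card_edges]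
          push_cast
          rw [h.card_edges]
          simp
          ring
    have h3 : P.n * x / P.M ≤ P.s := by
      rw [div_le_iff₀ (by linarith)]
      have h4 : x ≤ u * P.M := by
        have := h.le_M
        rwa [div_le_iff₀' (by linarith)] at this
      calc P.n * x ≤ P.n * (u * P.M) := by gcongr
        _ = P.n * u * P.M := by ring
        _ ≤ P.s * P.M := by gcongr; exact h.le_s
    have h5 : (Nat.clog 2 P.n + 1 : ℕ) * ∑ v : Fin P.n,
        (1 + 2 * (1 / ℓ)) * (max (G.degree v : ℝ) x / q) =
        (1 + 2 * (1 / ℓ)) * (∑ v, max (G.degree v : ℝ) x) / P.M := by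
      rw [← Finset.mul_sum, ← Finset.sum_div, hqM]
      have : ((Nat.clog 2 P.n + 1 : ℕ) : ℝ) ≠ 0 := by positivity
      field_simp
    rw [h5] at h1
    have h6 : (1 + 2 * (1 / ℓ)) * (∑ v, max (G.degree v : ℝ) x) / P.M ≤
        3 * (3 * (P.n * x)) / P.M := by
      gcongr
    have h7 : 3 * (3 * (P.n * x)) / P.M = 9 * (P.n * x / P.M) := by ring
    have h8 : ((routed (labelOf P ω) L j).length : ℝ) ≤ 20 * P.s := by
      have := Nat.cast_nonneg (α := ℝ) P.s
      linarith
    exact_mod_cast h8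
  have hΔ0 : 0 ≤ Δ := Nat.cast_nonneg _
  have hbound : 0 ≤ (1 + 2 * (1 / ℓ)) * (Δ / q) := by positivity
  have hX : ∀ v l, labelDegree G (labelOf P ω) v l ≤ ⌊(1 + 2 * (1 / ℓ)) * (Δ / q)⌋₊ := by
    intro v l
    refine Nat.le_floor ((hω v l).trans ?_)
    have : (G.degree v : ℝ) ≤ Δ := Nat.cast_le.2 (G.degree_le_maxDegree v)
    gcongr
    exact max_le this (by linarith)
  have hDle := Nat.floor_le hbound
  set D := ⌊(1 + 2 * (1 / ℓ)) * (Δ / q)⌋₊ with hDdef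
  have hΔq : Δ / q ≤ Δ / ℓ := by gcongr
  have hD : D ≤ P.n := by
    have h1 : Δ ≤ P.n := by
      have : G.maxDegree ≤ P.n := by
        refine G.maxDegree_le_of_forall_degree_le _ fun v => ?_
        have := G.degree_lt_card_verts v
        rw [Fintype.card_fin] at this
        exact this.le
      exact Nat.cast_le.2 this
    have h2 : Δ / ℓ ≤ Δ / 3 := by gcongr; linarith
    have h3 : (1 + 2 * (1 / ℓ)) * (Δ / q) ≤ 3 * (Δ / 3) :=
      mul_le_mul hδ (hΔq.trans h2) (by positivity) (by norm_num)
    have h4 : (D : ℝ) ≤ P.n := by linarith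
    exact_mod_cast h4
  -- From `q ℓ ^ 5 ≤ 6 x` and `6 ℓ ≤ ℓ ^ 5` one gets `q ℓ ≤ x ≤ Δ`.
  have hqΔ : q ≤ Δ / ℓ := by
    rw [le_div_iff₀ (by linarith)]
    have h1 : 6 * ℓ ≤ ℓ ^ 5 := by
      have : 6 ≤ ℓ ^ 4 := le_trans (by linarith) (le_self_pow₀ (by linarith : 1 ≤ ℓ) four_ne_zero)
      calc 6 * ℓ ≤ ℓ ^ 4 * ℓ := by gcongr
        _ = ℓ ^ 5 := by ring
    have h2 : q * (6 * ℓ) ≤ q * ℓ ^ 5 := by gcongr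
    linarith
  have hqD : q * D ≤ Δ + 2 * (Δ / ℓ) := by
    calc q * D ≤ q * ((1 + 2 * (1 / ℓ)) * (Δ / q)) := by gcongr
      _ = Δ + 2 * (Δ / ℓ) := by
        have : q ≠ 0 := by linarith
        field_simp
  have hD3 : (D : ℝ) ≤ 3 * (Δ / ℓ) :=
    hDle.trans (mul_le_mul hδ hΔq (by positivity) (by norm_num))
  -- In units of `Δ / ℓ` the excess over `Δ` is at most 2 from `q * D`, 1 from `q`, and for edges 6
  -- from `2 * D` and 1 from the last summand, as `1 ≤ q ≤ Δ / ℓ`. This is the origin of the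
  -- constant 10.
  have hcol : (1 + 10 / ℓ) * Δ = Δ + 10 * (Δ / ℓ) := by ring
  constructor
  · refine succeeds_vertexAlgorithm hP hL hs hΛ hD hX ?_
    rw [hcol]
    push_cast
    rw [← hqdef]
    have : 0 ≤ Δ / ℓ := by positivity
    linarith
  · refine succeeds_edgeAlgorithm hP hL hs hΛ hD hX ?_
    rw [hcol]
    push_cast
    rw [← hqdef]
    linarith

theorem measure_not_succeeds_le (h : P.Regime G x u) {L : Fin P.M → List G.Dart}
    (hL : ListsEdges G L) (hs : ∀ i, (L i).length ≤ P.s) {a : ℕ}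
    (ha : 6 * (4 + a) ≤ Real.log P.n) :
    coinMeasure P.M {ω | ¬ (Succeeds P 100 vertexAlgorithm L
      (IsVertexColouringOutput G ((1 + 10 / Real.log P.n) * G.maxDegree)) ω ∧
    Succeeds P 100 edgeAlgorithm L
      (IsEdgeColouringOutput G ((1 + 10 / Real.log P.n) * G.maxDegree)) ω)} ≤
      ENNReal.ofReal (1 / (P.n : ℝ) ^ a) := by
  have hl := h.log_ge
  have hn := h.cast_n_ge
  have hP := h.moderate
  have hu := h.u_ge
  have hux := h.le
  have hq0 := h.log_le_labelCount
  have hq1 : (0 : ℝ) < labelCount P := by linarith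
  have hq : 1 ≤ labelCount P := Nat.cast_pos.1 hq1
  have hδ0 : 0 ≤ 1 / Real.log P.n := by positivity
  have hδ1 : 1 / Real.log P.n ≤ 1 := (div_le_one (by linarith)).2 (by linarith)
  have hgood : {ω | ¬ (Succeeds P 100 vertexAlgorithm L
        (IsVertexColouringOutput G ((1 + 10 / Real.log P.n) * G.maxDegree)) ω ∧
      Succeeds P 100 edgeAlgorithm L
        (IsEdgeColouringOutput G ((1 + 10 / Real.log P.n) * G.maxDegree)) ω)} ⊆
      {ω | ¬ ∀ v l, (labelDegree G (labelOf P ω) v l : ℝ) ≤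
        (1 + 2 * (1 / Real.log P.n)) * (max (G.degree v : ℝ) x / labelCount P)} :=
    fun ω (hω : ¬ _) hX => hω (h.succeeds hL hs hX)
  -- Replacing the degree by `max (deg v) x` gives vertices of small degree the same tail bound as
  -- those of degree `x`, while increasing the sum over all vertices by at most `n x`.
  refine (measure_mono hgood).trans
    ((measure_exists_labelDegree_le G hP.M_pos hq hδ0 hδ1 (y := x / labelCount P)
      (x := fun v => max (G.degree v : ℝ) x / labelCount P)
      (div_nonneg (by linarith) hq1.le) (fun v => by gcongr; exact le_max_right _ _)
      fun v => ?_).trans (ENNReal.ofReal_le_ofReal ?_))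
  · rw [mul_div_cancel₀ _ hq1.ne', Set.ncard_eq_toFinset_card']
    exact le_max_left _ _
  · set ℓ := Real.log P.n with hℓ
    have h1 : ((P.n * labelCount P : ℕ) : ℝ) ≤ (P.n : ℝ) ^ 4 := by
      have h2 : P.n * labelCount P ≤ P.n ^ 4 := by
        calc P.n * labelCount P ≤ P.n * (2 * P.n ^ 2) := Nat.mul_le_mul_left _ hP.labelCount_le
          _ = 2 * P.n ^ 3 := by ring
          _ ≤ P.n * P.n ^ 3 := Nat.mul_le_mul_right _ (by linarith [h.n_ge])
          _ = P.n ^ 4 := by ring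
      exact_mod_cast h2
    -- With `δ = 1 / ℓ` the Chernoff exponent is at least `ℓ ^ 3 / 6`; this beats the `n ^ 4` of the
    -- union bound and leaves `n ^ (-a)`.
    have h3 : (4 + a) * ℓ ≤ (1 / ℓ) ^ 2 * (x / labelCount P) := by
      have h4 := h.labelCount_le
      have h5 : ℓ ^ 5 / 6 ≤ x / labelCount P := by
        rw [div_le_div_iff₀ (by norm_num) hq1]
        linarith
      calc (4 + a) * ℓ ≤ ℓ ^ 2 / 6 * ℓ := by
            gcongr
            nlinarith
        _ = (1 / ℓ) ^ 2 * (ℓ ^ 5 / 6) := by field_simp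
        _ ≤ _ := by gcongr
    have hexp : Real.exp ℓ = P.n := Real.exp_log (by linarith)
    calc ((P.n * labelCount P : ℕ) : ℝ) * Real.exp (-((1 / ℓ) ^ 2 * (x / labelCount P)))
        ≤ (P.n : ℝ) ^ 4 * Real.exp (-((4 + a) * ℓ)) := by gcongr
      _ = 1 / (P.n : ℝ) ^ a := by
        have h6 : (4 + (a : ℝ)) * ℓ = ((4 + a : ℕ) : ℝ) * ℓ := by push_cast; ring
        rw [h6, Real.exp_neg, Real.exp_nat_mul, hexp, pow_add]
        have : (P.n : ℝ) ≠ 0 := by linarith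
        field_simp

end Params.Regime

/-- The growth of `μ` enters only here: once `μ n ≥ 6 log log n / log n`, one has `n ^ μ ≥ (log n) ^
6`. The remaining conditions are the identities `m = n * n ^ c`, `n ^ (c - μ) = n ^ c / n ^ μ` and
`n ^ (1 + μ) = n * n ^ μ`. The parameter `b` makes room for the dependence on the exponent of the
failure probability. -/
theorem eventually_regime {μ : ℕ → ℝ}
    (hμ : Tendsto (fun n : ℕ => μ n / (Real.log (Real.log n) / Real.log n)) atTop atTop) (b : ℝ) :
    ∀ᶠ n : ℕ in atTop, b ≤ Real.log n ∧ ∀ (G : SimpleGraph (Fin n)) [hG : DecidableRel G.Adj] (c : ℝ),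
      (G.edgeFinset.card : ℝ) = (n : ℝ) ^ (1 + c) → μ n < c →
      @Params.Regime (graphParams n G.edgeFinset.card c (μ n)) G hG ((n : ℝ) ^ c)
        ((n : ℝ) ^ μ n) := by
  have hlog : Tendsto (fun n : ℕ => Real.log n) atTop atTop :=
    Real.tendsto_log_atTop.comp tendsto_natCast_atTop_atTop
  filter_upwards [hμ.eventually_ge_atTop 6, hlog.eventually_ge_atTop b,
    hlog.eventually_ge_atTop 100] with n h6 hb h100
  refine ⟨hb, fun G hG c hm hc => ?_⟩
  have hn1 : (1 : ℝ) ≤ n := by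
    have := Real.log_le_self (Nat.cast_nonneg (α := ℝ) n)
    linarith
  have hn0 : (0 : ℝ) < n := by linarith
  have hll : 0 < Real.log (Real.log n) := Real.log_pos (by linarith)
  have hmul : 6 * Real.log (Real.log n) ≤ Real.log n * μ n := by
    rw [le_div_iff₀ (div_pos hll (by linarith))] at h6
    rw [mul_div_assoc', div_le_iff₀ (by linarith)] at h6
    linarith
  refine @Params.Regime.mk (graphParams n G.edgeFinset.card c (μ n)) G hG _ _ h100 ?_
    (Real.rpow_le_rpow_of_exponent_le hn1 hc.le) ?_ ?_ ?_
  · calc Real.log n ^ 6 = Real.exp (6 * Real.log (Real.log n)) := by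
          rw [show (6 : ℝ) = ((6 : ℕ) : ℝ) by norm_num, Real.exp_nat_mul,
            Real.exp_log (by linarith)]
      _ ≤ Real.exp (Real.log n * μ n) := Real.exp_le_exp.2 hmul
      _ = (n : ℝ) ^ μ n := (Real.rpow_def_of_pos hn0 _).symm
  · exact hm.trans (by rw [Real.rpow_add hn0, Real.rpow_one]; rfl)
  · rw [← Real.rpow_sub hn0]
    rfl
  · change ⌈(n : ℝ) ^ (1 + μ n)⌉₊ = _
    rw [Real.rpow_add hn0, Real.rpow_one]
    rfl

theorem tendsto_const_div_log (b : ℝ) :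
    Tendsto (fun n : ℕ => b / Real.log n) atTop (𝓝 0) :=
  (Real.tendsto_log_atTop.comp tendsto_natCast_atTop_atTop).const_div_atTop b

end MapReduce

theorem mainTheorem9 :
    (∃ (ps : List MapReduce.Cmd) (K : ℕ), ∀ μ : ℕ → ℝ,
      Tendsto (fun n : ℕ => μ n / (Real.log (Real.log n) / Real.log n)) atTop atTop →
      ∃ ε : ℕ → ℝ, Tendsto ε atTop (𝓝 0) ∧ ∀ a : ℕ, ∀ᶠ n : ℕ in atTop,
        ∀ (G : SimpleGraph (Fin n)) [DecidableRel G.Adj] (c : ℝ),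
          (G.edgeFinset.card : ℝ) = (n : ℝ) ^ (1 + c) → μ n < c →
          ∀ L : Fin (MapReduce.graphParams n G.edgeFinset.card c (μ n)).M → List G.Dart,
            MapReduce.ListsEdges G L →
            (∀ i, (L i).length ≤ (MapReduce.graphParams n G.edgeFinset.card c (μ n)).s) →
            MapReduce.coinMeasure (MapReduce.graphParams n G.edgeFinset.card c (μ n)).M
              {ω | ¬ MapReduce.Succeeds (MapReduce.graphParams n G.edgeFinset.card c (μ n)) K ps
                      L (MapReduce.IsVertexColouringOutput G ((1 + ε n) * G.maxDegree)) ω}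
              ≤ ENNReal.ofReal (1 / (n : ℝ) ^ a)) ∧
    (∃ (ps : List MapReduce.Cmd) (K : ℕ), ∀ μ : ℕ → ℝ,
      Tendsto (fun n : ℕ => μ n / (Real.log (Real.log n) / Real.log n)) atTop atTop →
      ∃ ε : ℕ → ℝ, Tendsto ε atTop (𝓝 0) ∧ ∀ a : ℕ, ∀ᶠ n : ℕ in atTop,
        ∀ (G : SimpleGraph (Fin n)) [DecidableRel G.Adj] (c : ℝ),
          (G.edgeFinset.card : ℝ) = (n : ℝ) ^ (1 + c) → μ n < c →
          ∀ L : Fin (MapReduce.graphParams n G.edgeFinset.card c (μ n)).M → List G.Dart,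
            MapReduce.ListsEdges G L →
            (∀ i, (L i).length ≤ (MapReduce.graphParams n G.edgeFinset.card c (μ n)).s) →
            MapReduce.coinMeasure (MapReduce.graphParams n G.edgeFinset.card c (μ n)).M
              {ω | ¬ MapReduce.Succeeds (MapReduce.graphParams n G.edgeFinset.card c (μ n)) K ps
                      L (MapReduce.IsEdgeColouringOutput G ((1 + ε n) * G.maxDegree)) ω}
              ≤ ENNReal.ofReal (1 / (n : ℝ) ^ a)) := by
  refine ⟨⟨MapReduce.vertexAlgorithm, 100, fun μ hμ => ⟨fun n => 10 / Real.log n,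
    MapReduce.tendsto_const_div_log 10, fun a => ?_⟩⟩, ⟨MapReduce.edgeAlgorithm, 100, fun μ hμ =>
    ⟨fun n => 10 / Real.log n, MapReduce.tendsto_const_div_log 10, fun a => ?_⟩⟩⟩
  · filter_upwards [MapReduce.eventually_regime hμ (6 * (4 + a))] with n hn G hG c hm hc L hL hs
    have h := @MapReduce.Params.Regime.measure_not_succeeds_le
      (MapReduce.graphParams n G.edgeFinset.card c (μ n)) G hG _ _ (hn.2 G c hm hc) L hL hs a hn.1
    refine le_trans (measure_mono ?_) h
    exact fun ω (hω : ¬ _) hgood => hω hgood.1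
  · filter_upwards [MapReduce.eventually_regime hμ (6 * (4 + a))] with n hn G hG c hm hc L hL hs
    have h := @MapReduce.Params.Regime.measure_not_succeeds_le
      (MapReduce.graphParams n G.edgeFinset.card c (μ n)) G hG _ _ (hn.2 G c hm hc) L hL hs a hn.1
    refine le_trans (measure_mono ?_) h
    exact fun ω (hω : ¬ _) hgood => hω hgood.2
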